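/- Let $m\ge 2$ be an integer. Put $F(t)=\dfrac{(t-2)t^{2m-1}}{(t-1)^m}$, $\ \Sigma(t)=\sum_{j=1}^m\frac{j}{m}\binom{2m-j-1}{m-1}t^{j-1}$, $\ E(t)=(t-1)\Sigma(t)$, $\ G=E-\tfrac12F$, and let $\mathbf V$ be the real vector space of rational functions spanned by $t-1$, $(t-1)E$, $(t-1)F$. The *moduli curve* $\mathcal C\subset\mathbf R^2$ consists of $(0,0)$ and of all $(u,v)$ with $u<v$ for which some $Q\in\mathbf V$ satisfies: (a) $Q$ is analytic on $[u,v]$; (b) $Q(u)=Q(v)=0$; (c) $Q(t)\neq0$ for every $t$ with $u<t<v$ at which $Q$ is analytic; (d) $Q'(u)$ and $Q'(v)$ exist and are nonzero; (e) $Q'(u)=-Q'(v)$. Let $\mathcal H=\{(u,v)\in\mathbf R^2: uv=u+v\}$, and write $t^*=t/(t-1)$ for $t\ne1$. Let $\mathsf I=\{(u,v)\in\mathcal H:1<u<2\}$. If $m$ is even, let $\triangleleft=\{(u,v)\in\mathcal H:u\le0\}$. If $m$ is odd, there are unique real numbers $z,w<0$ with $G(z)=E(0)$ and $G'(w)=0$;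 they satisfy $z<w$. Also, there is a unique symmetric real polynomial $T(u,v)$ such that, for all $u,v\in\mathbf R\smallsetminus\{1\}$, $$(u-1)^m(v-1)^m\,[\Pi(u,v)-\Pi(v,u)]=2(v-u)^3(uv-u-v)\,T(u,v),$$ where $\Pi(u,v)=(v-1)\{[F(v)-F(u)]E'(v)-[E(v)-E(u)]F'(v)\}$. Let $\mathcal T=\{(u,v)\in\mathbf R^2:T(u,v)=0\}$. For odd $m$, let $\triangleleft=\{(u,v)\in\mathcal H:w<u\le0\}$, and let $\mathsf X$ be the union of the $\mathcal H$-beam $\{(u,v)\in\mathcal H:u<z\}$ and the $\mathcal T$-beam $\mathcal T\cap\big((-\infty,0)\times(0,1)\big)$. Then: 1. If $m$ is even, the connected components of $\mathcal C$ are exactly the two distinct sets $\triangleleft$ and $\mathsf I$. 2. If $m$ is odd, the connected components of $\mathcal C$ are exactly the three distinct sets $\mathsf X$, $\triangleleft$ and $\mathsf I$. Moreover, the $\mathcal H$-beam equals $\mathsf X\cap\mathcal H$, the $\mathcal T$-beam equals $\mathsf X\cap\mathcal T$, the equation $T(t,t^*)=0$ has a unique negative real solution $t=x$, and the two beams intersect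 in the single point $(x,x^*)$. -/

import Mathlib

open Set

noncomputable section

namespace ModuliCurve

/-- The rational function `F(t) = (t - 2) t^(2m-1) / (t - 1)^m`. Its only pole is `t = 1`; the value
that Lean assigns there is never used. -/
def F (m : ℕ) (t : ℝ) : ℝ := (t - 2) * t ^ (2 * m - 1) / (t - 1) ^ m

/-- The polynomial `Σ(t) = ∑_{j=1}^m (j/m) binom(2m-j-1, m-1) t^(j-1)`. -/
def Sig (m : ℕ) (t : ℝ) : ℝ :=
  ∑ j ∈ Finset.Icc 1 m, ((j : ℝ) / (m : ℝ)) * ((2 * m - j - 1).choose (m - 1) : ℝ) * t ^ (j - 1)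

/-- The polynomial `E(t) = (t - 1) Σ(t)`. -/
def E (m : ℕ) (t : ℝ) : ℝ := (t - 1) * Sig m t

/-- The rational function `G = E - F/2`. -/
def G (m : ℕ) (t : ℝ) : ℝ := E m t - F m t / 2

/-- The space `V = Span {t - 1, (t - 1) E, (t - 1) F}` of functions
`Q(t) = (t - 1) [A + B E(t) + C F(t)]`. As `m ≥ 2`, the function `Q` has a pole at `t = 1` when
`C ≠ 0`, and is a polynomial when `C = 0`; in the latter case `Q(1) = 0` is the true value. -/
def V (m : ℕ) : Submodule ℝ (ℝ → ℝ) :=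
  Submodule.span ℝ
    {fun t => t - 1, fun t => (t - 1) * E m t, fun t => (t - 1) * F m t}

/-- The five conditions on a function `Q` and the interval `[u, v]`. -/
structure Conditions (Q : ℝ → ℝ) (u v : ℝ) : Prop where
  /-- `Q` is analytic on `[u, v]`. -/
  a : AnalyticOnNhd ℝ Q (Icc u v)
  /-- `Q` vanishes at both endpoints. -/
  b : Q u = 0 ∧ Q v = 0
  /-- `Q` is nonzero at all interior points at which it is analytic. -/
  c : ∀ t ∈ Ioo u v, AnalyticAt ℝ Q t → Q t ≠ 0
  /-- The derivative of `Q` exists and is nonzero at both endpoints. -/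
  d : (DifferentiableAt ℝ Q u ∧ deriv Q u ≠ 0) ∧ (DifferentiableAt ℝ Q v ∧ deriv Q v ≠ 0)
  /-- The derivatives of `Q` at the endpoints exist and are mutually opposite. -/
  e : (DifferentiableAt ℝ Q u ∧ DifferentiableAt ℝ Q v) ∧ deriv Q u = - deriv Q v

/-- The moduli curve: the point `(0, 0)` and all `(u, v)` with `u < v` such that some `Q ∈ V`
satisfies the five conditions on `[u, v]`. -/
def curve (m : ℕ) : Set (ℝ × ℝ) :=
  {p | p = (0, 0) ∨ (p.1 < p.2 ∧ ∃ Q ∈ V m, Conditions Q p.1 p.2)}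

/-- The set of connected components of a subset of the plane (with its subspace topology). -/
def components (S : Set (ℝ × ℝ)) : Set (Set (ℝ × ℝ)) :=
  {K | ∃ p ∈ S, K = connectedComponentIn S p}

/-- `Π(u, v) = (v - 1) {[F(v) - F(u)] E'(v) - [E(v) - E(u)] F'(v)}`, used for `u ≠ 1 ≠ v`. -/
def Pi (m : ℕ) (u v : ℝ) : ℝ :=
  (v - 1) * ((F m v - F m u) * deriv (E m) v - (E m v - E m u) * deriv (F m) v)

/-- The value at `(u, v)` of a polynomial in two variables. -/
def ev (T : MvPolynomial (Fin 2) ℝ) (u v : ℝ) : ℝ := MvPolynomial.eval ![u, v] T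

/-- The property that characterizes the polynomial `T`: it is symmetric, and
`(u-1)^m (v-1)^m [Π(u,v) - Π(v,u)] = 2 (v-u)^3 (uv-u-v) T(u,v)`, an equality of rational
functions, i.e. for all `u, v` different from `1`. -/
def IsT (m : ℕ) (T : MvPolynomial (Fin 2) ℝ) : Prop :=
  T.IsSymmetric ∧ ∀ u v : ℝ, u ≠ 1 → v ≠ 1 →
    (u - 1) ^ m * (v - 1) ^ m * (Pi m u v - Pi m v u)
      = 2 * (v - u) ^ 3 * (u * v - u - v) * ev T u v

/-- The polynomial `T` (that it exists and is unique is part of the theorem). -/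
def T (m : ℕ) : MvPolynomial (Fin 2) ℝ := Classical.epsilon (IsT m)

/-- The property that characterizes `z` for odd `m`: `z < 0` and `G(z) = E(0)`. -/
def IsZ (m : ℕ) (z : ℝ) : Prop := z < 0 ∧ G m z = E m 0

/-- The property that characterizes `w` for odd `m`: `w < 0` and `G'(w) = 0`. -/
def IsW (m : ℕ) (w : ℝ) : Prop := w < 0 ∧ deriv (G m) w = 0

/-- The constant `z` for odd `m` (existence and uniqueness are part of the theorem). -/
def z (m : ℕ) : ℝ := Classical.epsilon (IsZ m)

/-- The constant `w` for odd `m` (existence and uniqueness are part of the theorem). -/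
def w (m : ℕ) : ℝ := Classical.epsilon (IsW m)

/-- The hyperbola `uv = u + v`. -/
def hyperbola : Set (ℝ × ℝ) := {p | p.1 * p.2 = p.1 + p.2}

/-- The zero set of `T`. -/
def zeroT (m : ℕ) : Set (ℝ × ℝ) := {p | ev (T m) p.1 p.2 = 0}

/-- The segment of the hyperbola that projects onto the set `J` in the `u` axis
(used with `1 ∉ J`). -/
def segment (J : Set ℝ) : Set (ℝ × ℝ) := {p ∈ hyperbola | p.1 ∈ J}

/-- The set `I`. -/
def setI : Set (ℝ × ℝ) := segment (Ioo 1 2)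

/-- The set `◁`. -/
def setTri (m : ℕ) : Set (ℝ × ℝ) :=
  if Even m then segment (Iic 0) else segment (Ioc (w m) 0)

/-- The segment of the hyperbola over `(-∞, z)`. -/
def beamH (m : ℕ) : Set (ℝ × ℝ) := segment (Iio (z m))

/-- The part of the zero set of `T` in `(-∞, 0) × (0, 1)`. -/
def beamT (m : ℕ) : Set (ℝ × ℝ) := zeroT m ∩ (Iio 0 ×ˢ Ioo 0 1)

/-- The set `X` (for odd `m`), the union of its two beams. -/
def setX (m : ℕ) : Set (ℝ × ℝ) := beamH m ∪ beamT m

/-- `t* = t / (t - 1)`, used for `t ≠ 1`. -/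
def star (t : ℝ) : ℝ := t / (t - 1)

end ModuliCurve

end

/-! Write m = n + 1, so that m and n have opposite parities. Everything rests on one first-order
linear equation: `F` solves t(t-1)(t-2)y' = `lam`·y, and `E` solves it with the extra term
`kap`·(t-1). Hence E(t) - E(t*) solves the homogeneous equation and turns out to equal F(t)
(`E_star`), so `G` is invariant under t ↦ t*.

Conditions (a)-(e) force 1 ∉ [u, v] and u, v ≠ 0. Then (b) and (e) give a homogeneous linear system
for the coefficients of E and F, with determinant Π(u,v) - Π(v,u). The differential equations remove
all derivatives from it and split off the factor uv - u - v; what remains becomes, through τ =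
(t-2)/t, the integral of (X² - ab)·`W` from b to a, with a = u(v-2), b = v(u-2), e = uv. This
integral is `S`. It is divisible by (v-u)³, and the quotient is `T` up to a constant (`Pi_sub_eq`,
`T_spec`). Sign arguments for the integrand show that S has no zero when 1 < u < v, when u < v < 1
with 0 < u or v < 0, or when u < 0 < v < 1 with n odd. So points off the hyperbola occur only for
even n, and lie on the T-beam; conversely the whole T-beam belongs to the curve
(`mem_curve_of_ev_T`).

On the hyperbola Q must be a multiple of (t-1)(G - G(v)). By the symmetry of G it remains to see
whether G'(v) ≠ 0 and whether G takes the value G(v) between a fixed point of t ↦ t* (0 or 2) and v.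
G is increasing on [2, ∞) and, for odd n, on [0, 1). For even n it increases on (0, w*), decreases
on (w*, 1), and regains its initial level E(0) at z*; this excludes exactly w* ≤ v ≤ z*
(`mem_curve_iff_of_even`).

For even n the T-beam is described by ρ² = pq and l² = p/q, with p = u/(u-2), q = v/(2-v). Its
equation `M` = 0 is strictly monotone in ρ and symmetric under l ↦ 1/l, and the admissible l fill
out an interval around 1, so the beam is a connected graph over l. It meets the hyperbola only at l
= 1, where ρ is smallest. A level set of -uv/((u-2)(v-2)), which is ρ² on the beam, therefore
separates X from ◁. -/

noncomputable section

namespace ModuliCurve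

/-! ### Coefficients of Σ and the differential equations for E and F -/

/-- The coefficients of `Sig (n + 1)`. -/
def coef (n i : ℕ) : ℝ := ((i : ℝ) + 1) / ((n : ℝ) + 1) * ((2 * n - i).choose n : ℝ)

/-- The logarithmic-derivative numerator: `t (t - 1) (t - 2) F' = lam F`. -/
def lam (n : ℕ) (t : ℝ) : ℝ := (n + 1) * t ^ 2 - 2 * (2 * n + 1) * t + 2 * (2 * n + 1)

/-- The constant `2 (2m - 1) E(0)`, where `m = n + 1`. -/
def kap (n : ℕ) : ℝ := 2 * (2 * n + 1) * E (n + 1) 0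

theorem Sig_eq (n : ℕ) (t : ℝ) : Sig (n + 1) t = ∑ i ∈ Finset.range (n + 1), coef n i * t ^ i := by
  unfold Sig coef
  rw [← Finset.Ico_add_one_right_eq_Icc, Finset.sum_Ico_eq_sum_range]
  refine Finset.sum_congr (by simp) fun i _ => ?_
  have h1 : 2 * (n + 1) - (1 + i) - 1 = 2 * n - i := by omega
  have h2 : 1 + i - 1 = i := by omega
  rw [h1, h2]
  push_cast
  simp [add_comm]

theorem coef_succ {n i : ℕ} (hi : i ≤ n) :
    ((i : ℝ) + 1) * (2 * n - i) * coef n (i + 1) = (i + 2) * (n - i) * coef n i := by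
  unfold coef
  rcases Nat.eq_zero_or_pos n with rfl | hn
  · have : i = 0 := by omega
    subst this; simp
  obtain ⟨k, hk⟩ : ∃ k, 2 * n - i = k + 1 := ⟨2 * n - i - 1, by omega⟩
  have h1 : 2 * n - (i + 1) = k := by omega
  have h2 := Nat.choose_mul_succ_eq k n
  have h3 : k + 1 - n = n - i := by omega
  rw [h3] at h2
  have h4 : ((k.choose n : ℕ) : ℝ) * (k + 1) = ((k + 1).choose n : ℕ) * ((n : ℝ) - i) := by
    rw [← Nat.cast_sub hi]; exact_mod_cast h2
  have h5 : (k : ℝ) + 1 = 2 * n - i := by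
    have : k + 1 + i = 2 * n := by omega
    have : (k : ℝ) + 1 + i = 2 * n := by exact_mod_cast this
    linarith
  rw [h1, hk, ← h5]
  push_cast
  linear_combination ((i : ℝ) + 2) * (i + 1) / (n + 1) * h4

theorem coef_pos {n i : ℕ} (hi : i ≤ n) : 0 < coef n i := by
  unfold coef
  have : 0 < (2 * n - i).choose n := Nat.choose_pos (by omega)
  positivity

theorem coef_succ_self (n : ℕ) : coef n n = 1 := by
  unfold coef
  have : 2 * n - n = n := by omega
  rw [this]
  have : (n : ℝ) + 1 ≠ 0 := by positivity
  simp [this]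

theorem coef_anti {n i : ℕ} (hi' : i < n) : coef n (i + 1) ≤ coef n i := by
  have hi := hi'.le
  have h := coef_succ hi
  have hp := coef_pos hi
  have h0 : (0 : ℝ) ≤ i := by positivity
  have h1 : (i : ℝ) + 1 ≤ n := by exact_mod_cast hi'
  have h2 : 0 < ((i : ℝ) + 1) * (2 * n - i) := by apply mul_pos <;> linarith
  by_contra! hlt
  have h3 : ((i : ℝ) + 1) * (2 * n - i) * coef n i < (i + 2) * (n - i) * coef n i := by
    rw [← h]; exact mul_lt_mul_of_pos_left hlt h2
  have h4 := lt_of_mul_lt_mul_right h3 hp.le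
  nlinarith

/-- This coincidence makes E'(0) = 0, and hence keeps 0 from being an endpoint u or v. -/
theorem coef_zero_eq_one {n : ℕ} (hn : 1 ≤ n) : coef n 1 = coef n 0 := by
  have h := coef_succ (n := n) (i := 0) (by omega)
  have : (n : ℝ) ≠ 0 := by positivity
  simp at h
  rcases h with h | h
  · exact h
  · omega

theorem coef_two_lt {n : ℕ} (hn : 2 ≤ n) : coef n 2 < coef n 1 := by
  have h := coef_succ (n := n) (i := 1) (by omega)
  have hp := coef_pos (n := n) (i := 1) (by omega)
  have h1 : (2 : ℝ) ≤ n := by exact_mod_cast hn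
  norm_num at h
  nlinarith

/-- The recurrence `coef_succ` makes the differential expression telescope: a partial sum leaves one
boundary term, which vanishes at N = n. -/
theorem sum_coef_ode {n : ℕ} (t : ℝ) {N : ℕ} (hN : N ≤ n) :
    (t - 1) * (t - 2) * ∑ i ∈ Finset.range (N + 1), i * coef n i * t ^ i
      - (n * (t - 2) ^ 2 + 2) * ∑ i ∈ Finset.range (N + 1), coef n i * t ^ i
      + 2 * (2 * n + 1) * coef n 0
    = coef n N * t ^ (N + 1) * (n - N) * (2 * (N + 2) / (N + 1) - t) := by
  induction N with
  | zero => simp; ring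
  | succ N ih =>
    have ih := ih (by omega)
    rw [Finset.sum_range_succ, Finset.sum_range_succ _ (N + 1)]
    have h := coef_succ (n := n) (i := N) (by omega)
    have h1 : (N : ℝ) + 1 ≠ 0 := by positivity
    have h2 : (N : ℝ) + 2 ≠ 0 := by positivity
    have h3 : coef n N * (n - N) = (N + 1) * (2 * n - N) * coef n (N + 1) / (N + 2) := by
      rw [eq_div_iff h2]; linarith
    have h4 : coef n N * t ^ (N + 1) * (n - N) * (2 * (N + 2) / (N + 1) - t)
      = (coef n N * (n - N)) * t ^ (N + 1) * (2 * (N + 2) / (N + 1) - t) := by ring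
    rw [h4, h3] at ih
    have h5 : ((N : ℝ) + 1 + 1) ≠ 0 := by positivity
    have key : (t - 1) * (t - 2) * ((N + 1) * coef n (N + 1) * t ^ (N + 1))
        - (n * (t - 2) ^ 2 + 2) * (coef n (N + 1) * t ^ (N + 1))
        + (N + 1) * (2 * n - N) * coef n (N + 1) / (N + 2) * t ^ (N + 1) * (2 * (N + 2) / (N + 1) - t)
        = coef n (N + 1) * t ^ (N + 1 + 1) * (n - (N + 1)) * (2 * ((N + 1) + 2) / ((N + 1) + 1) - t) := by
      rw [show (N : ℝ) + 1 + 1 = N + 2 by ring]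
      field_simp
      ring
    push_cast
    linear_combination ih + key

/-- The derivative of `Sig (n + 1)`. -/
def dSig (n : ℕ) (t : ℝ) : ℝ := ∑ i ∈ Finset.range (n + 1), coef n i * (i * t ^ (i - 1))

theorem hasDerivAt_Sig (n : ℕ) (t : ℝ) : HasDerivAt (Sig (n + 1)) (dSig n t) t := by
  have : Sig (n + 1) = fun t => ∑ i ∈ Finset.range (n + 1), coef n i * t ^ i :=
    funext (Sig_eq n)
  rw [this]
  exact HasDerivAt.fun_sum fun i _ => (hasDerivAt_pow i t).const_mul _

theorem mul_dSig (n : ℕ) (t : ℝ) :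
    t * dSig n t = ∑ i ∈ Finset.range (n + 1), i * coef n i * t ^ i := by
  unfold dSig
  rw [Finset.mul_sum]
  refine Finset.sum_congr rfl fun i _ => ?_
  rcases i with _ | i
  · simp
  · simp [pow_succ]; ring

theorem Sig_zero (n : ℕ) : Sig (n + 1) 0 = coef n 0 := by
  rw [Sig_eq, Finset.sum_range_succ']; simp

theorem E_zero (n : ℕ) : E (n + 1) 0 = - coef n 0 := by
  unfold E; rw [Sig_zero]; ring

theorem E_zero_neg (n : ℕ) : E (n + 1) 0 < 0 := by
  rw [E_zero]; linarith [coef_pos (Nat.zero_le n)]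

theorem E_one (m : ℕ) : E m 1 = 0 := by simp [E]

theorem kap_neg (n : ℕ) : kap n < 0 := by
  unfold kap
  exact mul_neg_of_pos_of_neg (by positivity) (E_zero_neg n)

theorem Sig_ode (n : ℕ) (t : ℝ) :
    t * (t - 1) * (t - 2) * dSig n t = (n * (t - 2) ^ 2 + 2) * Sig (n + 1) t + kap n := by
  have h := sum_coef_ode t (le_refl n)
  rw [← mul_dSig, ← Sig_eq] at h
  unfold kap; rw [E_zero]
  simp at h
  linear_combination h

theorem hasDerivAt_E (n : ℕ) (t : ℝ) :
    HasDerivAt (E (n + 1)) (Sig (n + 1) t + (t - 1) * dSig n t) t := by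
  have := ((hasDerivAt_id t).sub_const 1).mul (hasDerivAt_Sig n t)
  simp only [id, one_mul] at this
  exact this

theorem differentiable_E (n : ℕ) : Differentiable ℝ (E (n + 1)) :=
  fun t => (hasDerivAt_E n t).differentiableAt

theorem continuous_E (n : ℕ) : Continuous (E (n + 1)) := (differentiable_E n).continuous

theorem deriv_E (n : ℕ) (t : ℝ) : deriv (E (n + 1)) t = Sig (n + 1) t + (t - 1) * dSig n t :=
  (hasDerivAt_E n t).deriv

theorem E_ode (n : ℕ) (t : ℝ) :
    t * (t - 1) * (t - 2) * deriv (E (n + 1)) t = lam n t * E (n + 1) t + kap n * (t - 1) := by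
  have h := Sig_ode n t
  rw [deriv_E]; unfold lam E
  linear_combination (t - 1) * h

/-- A quarter of the discriminant of this quadratic is -(2n + 1). -/
theorem lam_pos (n : ℕ) (t : ℝ) : 0 < lam n t := by
  unfold lam
  have : (0 : ℝ) ≤ n := by positivity
  nlinarith [sq_nonneg (t - 2), sq_nonneg ((n+1) * t - (2 * n + 1)), sq_nonneg (t-1), sq_nonneg t]

/-- By `coef_anti` all nonconstant coefficients are nonnegative, which gives the bounds on E' for t
> 0. -/
theorem E_eq_sum (n : ℕ) (t : ℝ) :
    E (n + 1) t = - coef n 0 + t ^ (n + 1)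
      + ∑ i ∈ Finset.range n, (coef n i - coef n (i + 1)) * t ^ (i + 1) := by
  have h1 := Finset.sum_range_succ (fun i => coef n i * t ^ i) n
  have h2 := Finset.sum_range_succ' (fun i => coef n i * t ^ i) n
  have h3 : t * ∑ i ∈ Finset.range n, coef n i * t ^ i
      = ∑ i ∈ Finset.range n, coef n i * t ^ (i + 1) := by
    rw [Finset.mul_sum]; exact Finset.sum_congr rfl fun i _ => by ring
  unfold E
  rw [Sig_eq, sub_mul, one_mul]
  simp only [sub_mul, Finset.sum_sub_distrib]
  rw [coef_succ_self] at h1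
  simp only [pow_zero, mul_one] at h2
  linear_combination t * h1 - h2 + h3

theorem deriv_E_ge {n : ℕ} {t : ℝ} (ht : 0 < t) (k : ℕ) (hk : k < n) :
    (k + 1) * (coef n k - coef n (k + 1)) * t ^ k + (n + 1) * t ^ n ≤ deriv (E (n + 1)) t := by
  have h : HasDerivAt (E (n + 1)) (((n + 1 : ℕ) : ℝ) * t ^ n
      + ∑ i ∈ Finset.range n, (coef n i - coef n (i + 1)) * (((i + 1 : ℕ) : ℝ) * t ^ i)) t := by
    have : E (n + 1) = fun t => (- coef n 0 + t ^ (n + 1))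
      + ∑ i ∈ Finset.range n, (coef n i - coef n (i + 1)) * t ^ (i + 1) := funext (E_eq_sum n)
    rw [this]
    refine HasDerivAt.add ?_ ?_
    · exact (hasDerivAt_pow (n + 1) t).const_add _
    · exact HasDerivAt.fun_sum fun i _ => (hasDerivAt_pow (i + 1) t).const_mul _
  rw [h.deriv]
  have := Finset.single_le_sum (f := fun i => (coef n i - coef n (i + 1)) * (((i + 1 : ℕ) : ℝ) * t ^ i))
    (s := Finset.range n) (fun i hi => by
      have := coef_anti (n := n) (i := i) (Finset.mem_range.1 hi)
      have : 0 ≤ coef n i - coef n (i + 1) := by linarith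
      positivity) (Finset.mem_range.2 hk)
  beta_reduce at this
  push_cast at this ⊢
  linarith

theorem deriv_E_pos {n : ℕ} (hn : 1 ≤ n) {t : ℝ} (ht : 0 < t) : 0 < deriv (E (n + 1)) t := by
  have h := deriv_E_ge ht 0 (by omega : 0 < n)
  have := coef_anti (n := n) (i := 0) (by omega)
  have h2 : 0 < ((n : ℝ) + 1) * t ^ n := by positivity
  norm_num at h this
  linarith

theorem dSig_pos {n : ℕ} (hn : 1 ≤ n) {t : ℝ} (ht : 0 ≤ t) : 0 < dSig n t := by
  unfold dSig
  have := Finset.single_le_sum (f := fun i : ℕ => coef n i * (i * t ^ (i - 1)))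
    (s := Finset.range (n + 1)) (fun i hi => by
      have := coef_pos (n := n) (i := i) (by have := Finset.mem_range.1 hi; omega)
      positivity) (Finset.mem_range.2 (by omega : 1 < n + 1))
  have h := coef_pos hn
  simp at this
  linarith

theorem F_eq (n : ℕ) (t : ℝ) : F (n + 1) t = (t - 2) * t ^ (2 * n + 1) / (t - 1) ^ (n + 1) := by
  unfold F
  rw [show 2 * (n + 1) - 1 = 2 * n + 1 by omega]

theorem hasDerivAt_F (n : ℕ) {t : ℝ} (ht : t ≠ 1) :
    HasDerivAt (F (n + 1)) (t ^ (2 * n) * lam n t / (t - 1) ^ (n + 2)) t := by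
  have h1 : t - 1 ≠ 0 := sub_ne_zero.2 ht
  have h : HasDerivAt (fun t : ℝ => (t - 2) * t ^ (2 * n + 1) / (t - 1) ^ (n + 1))
      (((1 * t ^ (2 * n + 1) + (t - 2) * (((2 * n + 1 : ℕ) : ℝ) * t ^ (2 * n))) * (t - 1) ^ (n + 1)
        - (t - 2) * t ^ (2 * n + 1) * (((n + 1 : ℕ) : ℝ) * (t - 1) ^ n * 1))
        / ((t - 1) ^ (n + 1)) ^ 2) t := by
    refine HasDerivAt.fun_div ?_ ?_ (pow_ne_zero _ h1)
    · exact ((hasDerivAt_id t).sub_const 2).mul (hasDerivAt_pow (2 * n + 1) t)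
    · exact ((hasDerivAt_id t).sub_const 1).pow (n + 1)
  rw [show F (n + 1) = fun t : ℝ => (t - 2) * t ^ (2 * n + 1) / (t - 1) ^ (n + 1) from
    funext (F_eq n)]
  convert h using 1
  unfold lam
  rw [div_eq_div_iff (pow_ne_zero _ h1) (pow_ne_zero _ (pow_ne_zero _ h1))]
  push_cast
  ring

theorem deriv_F (n : ℕ) {t : ℝ} (ht : t ≠ 1) :
    deriv (F (n + 1)) t = t ^ (2 * n) * lam n t / (t - 1) ^ (n + 2) := (hasDerivAt_F n ht).deriv

theorem F_ode (n : ℕ) {t : ℝ} (ht : t ≠ 1) :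
    t * (t - 1) * (t - 2) * deriv (F (n + 1)) t = lam n t * F (n + 1) t := by
  have h1 : t - 1 ≠ 0 := sub_ne_zero.2 ht
  rw [deriv_F n ht, F_eq]
  field_simp
  ring

theorem F_ne_zero (n : ℕ) {t : ℝ} (h0 : t ≠ 0) (h1 : t ≠ 1) (h2 : t ≠ 2) : F (n + 1) t ≠ 0 := by
  rw [F_eq]
  exact div_ne_zero (mul_ne_zero (sub_ne_zero.2 h2) (pow_ne_zero _ h0))
    (pow_ne_zero _ (sub_ne_zero.2 h1))

theorem F_zero (n : ℕ) : F (n + 1) 0 = 0 := by simp [F_eq]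

/-! ### The involution t ↦ t* and the symmetry of G -/

theorem star_sub_one {t : ℝ} (ht : t ≠ 1) : star t - 1 = 1 / (t - 1) := by
  have h1 : t - 1 ≠ 0 := sub_ne_zero.2 ht
  unfold star; field_simp; ring

theorem star_sub_two {t : ℝ} (ht : t ≠ 1) : star t - 2 = -(t - 2) / (t - 1) := by
  have h1 : t - 1 ≠ 0 := sub_ne_zero.2 ht
  unfold star; field_simp; ring

theorem star_ne_one {t : ℝ} (ht : t ≠ 1) : star t ≠ 1 := by
  have h1 : t - 1 ≠ 0 := sub_ne_zero.2 ht
  have := star_sub_one ht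
  rw [← sub_ne_zero, this]; positivity

theorem star_star {t : ℝ} (ht : t ≠ 1) : star (star t) = t := by
  have h1 : t - 1 ≠ 0 := sub_ne_zero.2 ht
  have h2 : star (star t) = star t / (star t - 1) := rfl
  rw [h2, star_sub_one ht]; unfold star; field_simp

theorem F_star (n : ℕ) {t : ℝ} (ht : t ≠ 1) : F (n + 1) (star t) = - F (n + 1) t := by
  have h1 : t - 1 ≠ 0 := sub_ne_zero.2 ht
  rw [F_eq, F_eq, star_sub_one ht, star_sub_two ht]
  unfold star
  rw [div_pow, div_pow, one_pow]
  field_simp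
  ring

theorem hasDerivAt_star {t : ℝ} (ht : t ≠ 1) : HasDerivAt star (-1 / (t - 1) ^ 2) t := by
  have h1 : t - 1 ≠ 0 := sub_ne_zero.2 ht
  have := (hasDerivAt_id t).fun_div ((hasDerivAt_id t).sub_const 1) h1
  refine this.congr_deriv ?_
  simp only [id]
  ring

theorem lam_star (n : ℕ) {t : ℝ} (ht : t ≠ 1) : lam n (star t) = lam n t / (t - 1) ^ 2 := by
  have h1 : t - 1 ≠ 0 := sub_ne_zero.2 ht
  unfold lam star; field_simp; ring

theorem E_sub_star_ode (n : ℕ) {t : ℝ} (ht : t ≠ 1) :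
    t * (t - 1) * (t - 2) *
      (deriv (E (n + 1)) t - deriv (E (n + 1)) (star t) * (-1 / (t - 1) ^ 2))
      = lam n t * (E (n + 1) t - E (n + 1) (star t)) := by
  have h1 : t - 1 ≠ 0 := sub_ne_zero.2 ht
  have h2 := E_ode n t
  have h3 := E_ode n (star t)
  rw [star_sub_one ht, star_sub_two ht, lam_star n ht] at h3
  have h4 : star t * (1 / (t - 1)) * (-(t - 2) / (t - 1)) = - (t * (t - 2)) / (t - 1) ^ 3 := by
    unfold star; field_simp
  rw [h4] at h3
  have h5 : t * (t - 1) * (t - 2) * (deriv (E (n + 1)) (star t) * (-1 / (t - 1) ^ 2))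
      = (t - 1) ^ 2 * (-(t * (t - 2)) / (t - 1) ^ 3 * deriv (E (n + 1)) (star t)) := by
    field_simp
  rw [mul_sub, h2, h5, h3]
  field_simp
  ring

/-- `(t - 1)^(n + 1) E(t*)` as a polynomial in `t`. -/
def starNum (n : ℕ) (t : ℝ) : ℝ :=
  ∑ i ∈ Finset.range (n + 1), coef n i * t ^ i * (t - 1) ^ (n - i)

theorem pow_mul_E_star (n : ℕ) {t : ℝ} (ht : t ≠ 1) :
    (t - 1) ^ (n + 1) * E (n + 1) (star t) = starNum n t := by
  have h1 : t - 1 ≠ 0 := sub_ne_zero.2 ht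
  unfold E starNum
  rw [star_sub_one ht, Sig_eq, Finset.mul_sum, Finset.mul_sum]
  refine Finset.sum_congr rfl fun i hi => ?_
  have hi : i ≤ n := by have := Finset.mem_range.1 hi; omega
  obtain ⟨k, rfl⟩ := Nat.exists_eq_add_of_le hi
  unfold star
  rw [div_pow, show i + k - i = k by omega]
  field_simp
  ring

theorem starNum_one (n : ℕ) : starNum n 1 = 1 := by
  unfold starNum
  rw [Finset.sum_range_succ, Finset.sum_eq_zero]
  · simp [coef_succ_self]
  · intro i hi
    have : n - i ≠ 0 := by have := Finset.mem_range.1 hi; omega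
    simp [this]

/-- Both sides solve the same homogeneous first-order equation, so their quotient is constant on an
interval avoiding 0, 1, 2. Letting t → 1 identifies the constant as 1. -/
theorem E_star_of_mem (n : ℕ) {J : Set ℝ} (hJo : IsOpen J) (hJc : IsPreconnected J)
    (h0 : 0 ∉ J) (h1 : 1 ∉ J) (h2 : 2 ∉ J) (hcl : (1 : ℝ) ∈ closure J) {t : ℝ} (ht : t ∈ J) :
    E (n + 1) t - E (n + 1) (star t) = F (n + 1) t := by
  have ne (x : ℝ) (y : ℝ) (hy : y ∉ J) (hx : x ∈ J) : x ≠ y := fun h => hy (h ▸ hx)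
  set R : ℝ → ℝ := fun t => (E (n + 1) t - E (n + 1) (star t)) / F (n + 1) t with hR
  have hder : ∀ x ∈ J, HasDerivAt R 0 x := by
    intro x hx
    have hx1 := ne x 1 h1 hx
    have hx0 := ne x 0 h0 hx
    have hx2 := ne x 2 h2 hx
    have hF := F_ne_zero n hx0 hx1 hx2
    have hE := (differentiable_E n x).hasDerivAt
    have hEs := ((differentiable_E n (star x)).hasDerivAt).comp x (hasDerivAt_star hx1)
    have hFd := (hasDerivAt_F n hx1).differentiableAt.hasDerivAt
    have := (hE.sub hEs).fun_div hFd hF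
    refine this.congr_deriv ?_
    rw [div_eq_zero_iff]; left
    have hode := E_sub_star_ode n hx1
    have hode2 := F_ode n hx1
    have hne : x * (x - 1) * (x - 2) ≠ 0 :=
      mul_ne_zero (mul_ne_zero hx0 (sub_ne_zero.2 hx1)) (sub_ne_zero.2 hx2)
    apply mul_left_cancel₀ hne
    simp only [Pi.sub_apply, Function.comp]
    linear_combination F (n + 1) x * hode - (E (n + 1) x - E (n + 1) (star x)) * hode2
  have hconst : ∀ x ∈ J, R x = R t := fun x hx =>
    hJo.is_const_of_deriv_eq_zero hJc (fun y hy => (hder y hy).differentiableAt.differentiableWithinAt)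
      (fun y hy => (hder y hy).deriv) hx ht
  -- φ is the quotient R with the pole at 1 cleared, hence continuous there; its value is (0 -
  -- 1)/(-1) = 1.
  set φ : ℝ → ℝ := fun t => ((t - 1) ^ (n + 1) * E (n + 1) t - starNum n t)
    / ((t - 2) * t ^ (2 * n + 1)) with hφ
  have hφR : ∀ x ∈ J, φ x = R x := by
    intro x hx
    have hx1 := sub_ne_zero.2 (ne x 1 h1 hx)
    have hx0 := ne x 0 h0 hx
    have hx2 := sub_ne_zero.2 (ne x 2 h2 hx)
    simp only [hφ, hR]
    rw [← pow_mul_E_star n (ne x 1 h1 hx), F_eq]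
    field_simp
  have hcont : ContinuousAt φ 1 := by
    refine ContinuousAt.div ?_ (by fun_prop) (by norm_num)
    have := continuous_E n
    unfold starNum
    fun_prop
  have hlim : φ 1 = R t := by
    have hne : (nhdsWithin (1 : ℝ) J).NeBot := mem_closure_iff_nhdsWithin_neBot.1 hcl
    refine tendsto_nhds_unique (hcont.tendsto.mono_left nhdsWithin_le_nhds : Filter.Tendsto φ (nhdsWithin 1 J) _) ?_
    refine tendsto_const_nhds.congr' ?_
    filter_upwards [self_mem_nhdsWithin] with x hx
    rw [hφR x hx, hconst x hx]
  have hφ1 : φ 1 = 1 := by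
    simp only [hφ, starNum_one]; norm_num
  rw [hφ1] at hlim
  have hF := F_ne_zero n (ne t 0 h0 ht) (ne t 1 h1 ht) (ne t 2 h2 ht)
  simp only [hR] at hlim
  field_simp at hlim
  linarith

theorem E_star (n : ℕ) {t : ℝ} (ht : t ≠ 1) :
    E (n + 1) t - E (n + 1) (star t) = F (n + 1) t := by
  have key : ∀ t : ℝ, 0 < t → t < 2 → t ≠ 1 → E (n + 1) t - E (n + 1) (star t) = F (n + 1) t := by
    intro t h0 h2 h1
    rcases h1.lt_or_gt with h | h
    · exact E_star_of_mem n isOpen_Ioo isPreconnected_Ioo (J := Ioo 0 1) (by simp) (by simp) (by simp)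
        (by rw [closure_Ioo (by norm_num)]; simp) ⟨h0, h⟩
    · exact E_star_of_mem n isOpen_Ioo isPreconnected_Ioo (J := Ioo 1 2) (by simp) (by simp) (by simp)
        (by rw [closure_Ioo (by norm_num)]; simp) ⟨h, h2⟩
  -- Only intervals adjacent to 1 see the limit above. The involution carries t < 0 into (0, 1) and
  -- t > 2 into (1, 2).
  have conv : ∀ t : ℝ, t ≠ 1 → 0 < star t → star t < 2 →
      E (n + 1) t - E (n + 1) (star t) = F (n + 1) t := by
    intro t h1 h0 h2
    have := key (star t) h0 h2 (star_ne_one h1)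
    rw [star_star h1, F_star n h1] at this
    linarith
  rcases lt_trichotomy t 0 with h | rfl | h
  · apply conv t ht
    · unfold star; exact div_pos_of_neg_of_neg h (by linarith)
    · unfold star; rw [div_lt_iff_of_neg (by linarith)]; linarith
  · rw [F_zero]; simp [star]
  rcases lt_trichotomy t 2 with h' | rfl | h'
  · exact key t h h' ht
  · have : star 2 = 2 := by norm_num [star]
    rw [this, F_eq]; simp
  · apply conv t ht
    · unfold star; exact div_pos h (by linarith)
    · unfold star; rw [div_lt_iff₀ (by linarith)]; linarith

theorem G_star (n : ℕ) {t : ℝ} (ht : t ≠ 1) : G (n + 1) (star t) = G (n + 1) t := by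
  unfold G
  rw [F_star n ht]
  linarith [E_star n ht]

/-! ### Critical points of Σ -/

theorem alternating_sum_bounds {b : ℕ → ℝ} (hb : ∀ i, 0 ≤ b i) (ha : ∀ i, b (i + 1) ≤ b i) (N : ℕ) :
    0 ≤ ∑ i ∈ Finset.range N, (-1) ^ i * b i ∧ ∑ i ∈ Finset.range N, (-1) ^ i * b i ≤ b 0 := by
  induction N generalizing b with
  | zero => simpa using hb 0
  | succ N ih =>
    have h := ih (b := fun i => b (i + 1)) (fun i => hb _) (fun i => ha _)
    have h2 : ∑ i ∈ Finset.range N, (-1 : ℝ) ^ (i + 1) * b (i + 1)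
        = - ∑ i ∈ Finset.range N, (-1) ^ i * b (i + 1) := by
      rw [← Finset.sum_neg_distrib]; exact Finset.sum_congr rfl fun i _ => by ring
    rw [Finset.sum_range_succ', h2]
    have := ha 0
    simp at h ⊢
    constructor <;> linarith

theorem coef_eq_zero {n i : ℕ} (hn : 1 ≤ n) (hi : n < i) : coef n i = 0 := by
  unfold coef
  rw [Nat.choose_eq_zero_of_lt (by omega)]; simp

/-- For -2/n < t < 0 the sum Σ'(t) alternates with nonincreasing absolute values, the first two
being different, so it has the sign of its first term. -/
theorem dSig_pos_of_neg {n : ℕ} (hn : 1 ≤ n) {t : ℝ} (ht : t < 0) (ht2 : -2 < n * t) :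
    0 < dSig n t := by
  have hn' : (1 : ℝ) ≤ n := by exact_mod_cast hn
  set x := -t with hx
  have hx0 : 0 < x := by linarith
  have hx2 : n * x < 2 := by rw [hx]; linarith
  set b : ℕ → ℝ := fun i => (i + 1) * coef n (i + 1) * x ^ i with hb
  have hcn : ∀ i, 0 ≤ coef n i := by
    intro i
    rcases le_or_gt i n with h | h
    · exact (coef_pos h).le
    · rw [coef_eq_zero hn h]
  have hb0 : ∀ i, 0 ≤ b i := fun i => by have := hcn (i + 1); simp only [hb]; positivity
  have hstep : ∀ i, i + 1 < n → ((i : ℝ) + 2) * coef n (i + 2) * x < (i + 1) * coef n (i + 1) := by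
    intro i hi
    have h := coef_succ (n := n) (i := i + 1) (by omega)
    push_cast at h
    have hi' : (i : ℝ) + 2 ≤ n := by exact_mod_cast hi
    have hi0 : (0 : ℝ) ≤ i := by positivity
    have hp := coef_pos (n := n) (i := i + 1) (by omega)
    have hA : 0 < 2 * (n : ℝ) - (i + 1) := by linarith
    have hq : ((i : ℝ) + 3) * (n - (i + 1)) * 2 ≤ n * (i + 1) * (2 * n - (i + 1)) := by
      rcases Nat.eq_zero_or_pos i with rfl | hi1
      · simp; nlinarith
      · have : (1 : ℝ) ≤ i := by exact_mod_cast hi1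
        nlinarith [mul_nonneg (by linarith : (0 : ℝ) ≤ n - (i + 2)) (by linarith : (0 : ℝ) ≤ i - 1),
          mul_nonneg (mul_nonneg (by linarith : (0 : ℝ) ≤ n) (by linarith : (0 : ℝ) ≤ i + 1)) (by linarith : (0 : ℝ) ≤ n - 2),
          mul_nonneg (by linarith : (0 : ℝ) ≤ n - (i + 1)) (by linarith : (0 : ℝ) ≤ i - 1)]
    have h3 : ((i : ℝ) + 1 + 1) * (2 * n - (i + 1)) * coef n (i + 1 + 1) * (n * x)
        < (i + 3) * (n - (i + 1)) * coef n (i + 1) * 2 := by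
      rw [h, show (i : ℝ) + 1 + 2 = i + 3 by ring]
      apply mul_lt_mul_of_pos_left hx2
      exact mul_pos (mul_pos (by linarith) (by linarith)) hp
    have h4 := mul_le_mul_of_nonneg_right hq hp.le
    have h5 : 0 < (n : ℝ) * (2 * n - (i + 1)) := mul_pos (by linarith) hA
    refine lt_of_mul_lt_mul_left (?_ : (n : ℝ) * (2 * n - (i + 1)) * _ < n * (2 * n - (i + 1)) * _) h5.le
    rw [show i + 1 + 1 = i + 2 by ring] at h3
    linarith
  have hanti : ∀ i, b (i + 1) ≤ b i := by
    intro i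
    rcases lt_or_ge (i + 1) n with h | h
    · have := mul_le_mul_of_nonneg_right (hstep i h).le (pow_nonneg hx0.le i)
      simp only [hb]; push_cast
      rw [show i + 1 + 1 = i + 2 by ring]
      calc _ = _ := ?_
        _ ≤ _ := this
      ring
    · have : b (i + 1) = 0 := by
        simp only [hb]; rw [coef_eq_zero hn (by omega)]; simp
      rw [this]; exact hb0 i
  have hsum : dSig n t = ∑ i ∈ Finset.range n, (-1) ^ i * b i := by
    unfold dSig
    rw [Finset.sum_range_succ']
    simp only [Nat.cast_zero, zero_mul, mul_zero, add_zero]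
    refine Finset.sum_congr rfl fun i _ => ?_
    have : t = -1 * x := by rw [hx]; ring
    simp only [hb]
    rw [this, mul_pow]; push_cast
    ring
  have hlt : b 1 < b 0 := by
    rcases lt_or_ge 1 n with h | h
    · have := hstep 0 (by omega)
      simp only [hb]; norm_num at this ⊢; linarith
    · have h1 : b 1 = 0 := by
        simp only [hb]; rw [coef_eq_zero hn (by omega)]; simp
      have h2 : 0 < b 0 := by
        simp only [hb]; have := coef_pos (n := n) (i := 1) hn; simpa using this
      rw [h1]; exact h2
  obtain ⟨N, rfl⟩ : ∃ N, n = N + 1 := ⟨n - 1, by omega⟩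
  have h := (alternating_sum_bounds (b := fun i => b (i + 1)) (fun i => hb0 _) (fun i => hanti _) N).2
  have h2 : ∑ i ∈ Finset.range N, (-1 : ℝ) ^ (i + 1) * b (i + 1)
      = - ∑ i ∈ Finset.range N, (-1) ^ i * b (i + 1) := by
    rw [← Finset.sum_neg_distrib]; exact Finset.sum_congr rfl fun i _ => by ring
  rw [hsum, Finset.sum_range_succ', h2]
  simp only [zero_add] at h
  simp only [pow_zero, one_mul]
  linarith

/-- This rules out v = 1 as an endpoint. At a critical point u < 0 and nu ≤ -2, and the equation for
Σ gives 2(2n+1)(E(u) - E(0)) = Σ(u)·u(nu + 2) ≥ 0. So E(u) lies in [E(0), 0) and is attained on [0,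
1), since E(1) = 0. -/
theorem exists_E_eq_of_dSig_eq_zero {n : ℕ} (hn : 1 ≤ n) {u : ℝ} (hu : dSig n u = 0) :
    ∃ t ∈ Ioo u 1, E (n + 1) t = E (n + 1) u := by
  have hn' : (1 : ℝ) ≤ n := by exact_mod_cast hn
  have hu0 : u < 0 := by
    by_contra! h
    exact (dSig_pos hn h).ne' hu
  have hu2 : n * u ≤ -2 := by
    by_contra! h
    exact (dSig_pos_of_neg hn hu0 h).ne' hu
  have hode := Sig_ode n u
  rw [hu, mul_zero] at hode
  unfold kap at hode
  rw [E_zero] at hode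
  have ha := coef_pos (Nat.zero_le n)
  have hS : 0 < Sig (n + 1) u := by
    by_contra! h
    nlinarith [mul_nonneg_of_nonpos_of_nonpos h (by nlinarith [sq_nonneg (u-2)] : -(n * (u - 2) ^ 2 + 2) ≤ 0), mul_pos ha (by linarith : (0:ℝ) < n)]
  have hE1 : E (n + 1) u < 0 := by unfold E; nlinarith
  have hE0 : E (n + 1) 0 ≤ E (n + 1) u := by
    rw [E_zero]; unfold E
    have h1 : 2 * (2 * n + 1) * (coef n 0 - (1 - u) * Sig (n + 1) u)
      = Sig (n + 1) u * (u * (n * u + 2)) := by linear_combination hode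
    have h2 : 0 ≤ Sig (n + 1) u * (u * (n * u + 2)) :=
      mul_nonneg hS.le (mul_nonneg_of_nonpos_of_nonpos hu0.le (by linarith))
    rw [← h1] at h2
    have := nonneg_of_mul_nonneg_right h2 (by positivity)
    linarith
  have hiv := intermediate_value_Ico (by norm_num : (0 : ℝ) ≤ 1) (continuous_E n).continuousOn
  rw [E_one] at hiv
  obtain ⟨t, ht, hteq⟩ := hiv ⟨hE0, hE1⟩
  exact ⟨t, ⟨by linarith [ht.1], ht.2⟩, hteq⟩

/-! ### Polynomial functions of two variables -/

/-- A function of two real variables given by a polynomial. -/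
def IsPoly (f : ℝ → ℝ → ℝ) : Prop := ∃ P : MvPolynomial (Fin 2) ℝ, ∀ u v, ev P u v = f u v

namespace IsPoly

theorem const (c : ℝ) : IsPoly fun _ _ => c := ⟨MvPolynomial.C c, fun u v => by simp [ev]⟩

theorem fst : IsPoly fun u _ => u := ⟨MvPolynomial.X 0, fun u v => by simp [ev]⟩

theorem snd : IsPoly fun _ v => v := ⟨MvPolynomial.X 1, fun u v => by simp [ev]⟩

theorem add {f g : ℝ → ℝ → ℝ} (hf : IsPoly f) (hg : IsPoly g) : IsPoly fun u v => f u v + g u v := by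
  obtain ⟨P, hP⟩ := hf
  obtain ⟨R, hR⟩ := hg
  exact ⟨P + R, fun u v => by simp only [← hP, ← hR]; simp [ev]⟩

theorem sub {f g : ℝ → ℝ → ℝ} (hf : IsPoly f) (hg : IsPoly g) : IsPoly fun u v => f u v - g u v := by
  obtain ⟨P, hP⟩ := hf
  obtain ⟨R, hR⟩ := hg
  exact ⟨P - R, fun u v => by simp only [← hP, ← hR]; simp [ev]⟩

theorem mul {f g : ℝ → ℝ → ℝ} (hf : IsPoly f) (hg : IsPoly g) : IsPoly fun u v => f u v * g u v := by
  obtain ⟨P, hP⟩ := hf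
  obtain ⟨R, hR⟩ := hg
  exact ⟨P * R, fun u v => by simp only [← hP, ← hR]; simp [ev]⟩

theorem div_const {f : ℝ → ℝ → ℝ} (hf : IsPoly f) (c : ℝ) : IsPoly fun u v => f u v / c := by
  simpa [div_eq_mul_inv] using hf.mul (const c⁻¹)

theorem pow {f : ℝ → ℝ → ℝ} (hf : IsPoly f) (k : ℕ) : IsPoly fun u v => f u v ^ k := by
  obtain ⟨P, hP⟩ := hf
  exact ⟨P ^ k, fun u v => by simp only [← hP]; simp [ev]⟩

theorem sum {ι : Type*} (s : Finset ι) {f : ι → ℝ → ℝ → ℝ} (hf : ∀ i, IsPoly (f i)) :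
    IsPoly fun u v => ∑ i ∈ s, f i u v := by
  choose P hP using hf
  exact ⟨∑ i ∈ s, P i, fun u v => by simp only [← hP]; simp [ev]⟩

theorem comp {f g h : ℝ → ℝ → ℝ} (hf : IsPoly f) (hg : IsPoly g) (hh : IsPoly h) :
    IsPoly fun u v => f (g u v) (h u v) := by
  obtain ⟨P, hP⟩ := hf
  obtain ⟨R, hR⟩ := hg
  obtain ⟨K, hK⟩ := hh
  refine ⟨MvPolynomial.bind₁ ![R, K] P, fun u v => ?_⟩
  simp only [← hP, ← hR, ← hK]
  unfold ev
  simp only [← MvPolynomial.coe_aeval_eq_eval, RingHom.coe_coe, MvPolynomial.aeval_bind₁]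
  congr 2
  funext i
  fin_cases i <;> rfl

end IsPoly

theorem mvPolynomial_ext_of_ev {P R : MvPolynomial (Fin 2) ℝ} {s t : Set ℝ} (hs : s.Infinite)
    (ht : t.Infinite) (h : ∀ u ∈ s, ∀ v ∈ t, ev P u v = ev R u v) : P = R := by
  refine MvPolynomial.funext_set ![s, t] (fun i => by fin_cases i <;> simpa) fun x hx => ?_
  have h0 := hx 0 (mem_univ _)
  have h1 := hx 1 (mem_univ _)
  have := h (x 0) h0 (x 1) h1
  unfold ev at this
  have hx' : x = ![x 0, x 1] := by funext i; fin_cases i <;> rfl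
  rw [hx']; exact this

/-- Lets the identities for J and Π be proved by calculus on (2, ∞)², where no denominator vanishes,
and then extended. -/
theorem IsPoly.eq_of_eqOn {f g : ℝ → ℝ → ℝ} (hf : IsPoly f) (hg : IsPoly g) {s t : Set ℝ}
    (hs : s.Infinite) (ht : t.Infinite) (h : ∀ u ∈ s, ∀ v ∈ t, f u v = g u v) (u v : ℝ) :
    f u v = g u v := by
  obtain ⟨P, hP⟩ := hf
  obtain ⟨R, hR⟩ := hg
  have : P = R := mvPolynomial_ext_of_ev hs ht fun u hu v hv => by rw [hP, hR, h u hu v hv]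
  rw [← hP, ← hR, this]

/-! ### The antisymmetric form S and its integral representation -/

/-- An antisymmetric polynomial divisible by `(a - b)^3`. -/
def cubicDiff (k : ℕ) (a b : ℝ) : ℝ :=
  (a ^ (2 * k + 3) - b ^ (2 * k + 3)) / (2 * k + 3)
    - a * b * (a ^ (2 * k + 1) - b ^ (2 * k + 1)) / (2 * k + 1)

/-- The even and odd parts in e of a binomial power, with their leading terms displayed. -/
theorem exists_poly_add_pow (j : ℕ) : ∃ A B : ℝ → ℝ → ℝ, IsPoly A ∧ IsPoly B ∧ ∀ c e : ℝ,
    (c + e) ^ (j + 1) = c ^ (j + 1) + e ^ 2 * A c (e ^ 2)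
      + e * ((j + 1) * c ^ j + e ^ 2 * B c (e ^ 2)) := by
  induction j with
  | zero => exact ⟨fun _ _ => 0, fun _ _ => 0, .const 0, .const 0, fun c e => by simp⟩
  | succ j ih =>
    obtain ⟨A, B, hA, hB, h⟩ := ih
    refine ⟨fun c w => c * A c w + (j + 1) * c ^ j + w * B c w, fun c w => c * B c w + A c w,
      ((IsPoly.fst.mul hA).add ((IsPoly.const _).mul (IsPoly.fst.pow j))).add (IsPoly.snd.mul hB),
      (IsPoly.fst.mul hB).add hA, fun c e => ?_⟩
    rw [pow_succ, h]; push_cast; ring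

/-- With a = c + e and b = c - e only odd powers of e survive, and since ab = c² - e² the terms
linear in e cancel. -/
theorem exists_poly_cubicDiff (k : ℕ) : ∃ δ : ℝ → ℝ → ℝ, IsPoly δ ∧ ∀ a b : ℝ,
    cubicDiff k a b = (a - b) ^ 3 * δ ((a + b) / 2) (((a - b) / 2) ^ 2) := by
  obtain ⟨A, B, -, hB, h⟩ := exists_poly_add_pow (2 * k)
  obtain ⟨A', B', -, hB', h'⟩ := exists_poly_add_pow (2 * k + 2)
  refine ⟨fun c w => (B' c w / (2 * k + 3) + c ^ (2 * k) - (c ^ 2 - w) * (B c w / (2 * k + 1))) / 4,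
    (((hB'.div_const _).add (IsPoly.fst.pow _)).sub
      (((IsPoly.fst.pow 2).sub IsPoly.snd).mul (hB.div_const _))).div_const 4, fun a b => ?_⟩
  set c := (a + b) / 2
  set e := (a - b) / 2
  have ha : a = c + e := by simp only [c, e]; ring
  have hb : b = c + -e := by simp only [c, e]; ring
  have h1 : (2 * k + 1 : ℝ) ≠ 0 := by positivity
  have h2 : (2 * k + 3 : ℝ) ≠ 0 := by positivity
  unfold cubicDiff
  rw [ha, hb, show 2 * k + 3 = 2 * k + 2 + 1 by ring, h', h', h, h]
  simp only [even_two, Even.neg_pow]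
  push_cast
  field_simp
  ring

/-- The numerator of the equation of the `T` part of the moduli curve. -/
def S (n : ℕ) (e a b : ℝ) : ℝ := ∑ k ∈ Finset.range n,
  (n.choose (k + 1) : ℝ) * (-1) ^ (k + 1) * e ^ (2 * (n - 1 - k)) * cubicDiff k a b

/-- A primitive whose difference between `a` and `b` is `S n e a b`, if `r = a b`. -/
def Phi (n : ℕ) (e r X : ℝ) : ℝ := ∑ k ∈ Finset.range n,
  (n.choose (k + 1) : ℝ) * (-1) ^ (k + 1) * e ^ (2 * (n - 1 - k))
    * (X ^ (2 * k + 3) / (2 * k + 3) - r * (X ^ (2 * k + 1) / (2 * k + 1)))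

/-- The quotient of `(e^2 - X^2)^n - e^(2n)` by `X^2`. -/
def W (n : ℕ) (e X : ℝ) : ℝ := ∑ k ∈ Finset.range n,
  (n.choose (k + 1) : ℝ) * (-1) ^ (k + 1) * e ^ (2 * (n - 1 - k)) * X ^ (2 * k)

theorem S_eq_Phi (n : ℕ) (e a b : ℝ) : S n e a b = Phi n e (a * b) a - Phi n e (a * b) b := by
  unfold S Phi cubicDiff
  rw [← Finset.sum_sub_distrib]
  exact Finset.sum_congr rfl fun k _ => by ring

theorem S_swap (n : ℕ) (e a b : ℝ) : S n e b a = - S n e a b := by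
  unfold S cubicDiff
  rw [← Finset.sum_neg_distrib]
  exact Finset.sum_congr rfl fun k _ => by ring

theorem S_neg (n : ℕ) (e a b : ℝ) : S n e (-a) (-b) = - S n e a b := by
  unfold S cubicDiff
  rw [← Finset.sum_neg_distrib]
  refine Finset.sum_congr rfl fun k _ => ?_
  have h1 : Odd (2 * k + 1) := ⟨k, rfl⟩
  have h3 : Odd (2 * k + 3) := ⟨k + 1, by ring⟩
  rw [h1.neg_pow, h1.neg_pow, h3.neg_pow, h3.neg_pow]
  ring

theorem S_neg_left (n : ℕ) (e a b : ℝ) : S n (-e) a b = S n e a b := by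
  unfold S
  refine Finset.sum_congr rfl fun k _ => ?_
  rw [Even.neg_pow (even_two_mul _)]

theorem S_smul (n : ℕ) (c e a b : ℝ) : S n (c * e) (c * a) (c * b) = c ^ (2 * n + 1) * S n e a b := by
  unfold S
  rw [Finset.mul_sum]
  refine Finset.sum_congr rfl fun k hk => ?_
  have hk := Finset.mem_range.1 hk
  have h : cubicDiff k (c * a) (c * b) = c ^ (2 * k + 3) * cubicDiff k a b := by
    unfold cubicDiff; ring
  have h2 : 2 * n + 1 = 2 * (n - 1 - k) + (2 * k + 3) := by omega
  rw [h, h2, mul_pow, pow_add]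
  ring

theorem sq_mul_W (n : ℕ) (e X : ℝ) : X ^ 2 * W n e X = (e ^ 2 - X ^ 2) ^ n - (e ^ 2) ^ n := by
  have h : (e ^ 2 - X ^ 2) ^ n = (-X ^ 2 + e ^ 2) ^ n := by ring
  rw [h, add_pow, Finset.sum_range_succ']
  unfold W
  rw [Finset.mul_sum]
  simp only [pow_zero, one_mul, Nat.sub_zero, Nat.choose_zero_right, Nat.cast_one, mul_one]
  rw [add_sub_cancel_right]
  refine Finset.sum_congr rfl fun k hk => ?_
  rw [← pow_mul, show n - (k + 1) = n - 1 - k by omega, show (-X ^ 2) = (-1) * X ^ 2 by ring,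
    mul_pow, ← pow_mul, show 2 * (k + 1) = 2 * k + 2 by ring, pow_add]
  ring

/-- So S is the integral of (X² - ab)·W from b to a. As X + ab/X agrees at a and b, multiples of it
may be subtracted from the primitive when 0 is not between them; by `sq_mul_W` this replaces the
integrand by (1 - ab/X²)·((e² - X²)^n - const). -/
theorem hasDerivAt_Phi (n : ℕ) (e r X : ℝ) :
    HasDerivAt (Phi n e r) ((X ^ 2 - r) * W n e X) X := by
  unfold Phi W
  rw [Finset.mul_sum]
  refine HasDerivAt.fun_sum fun k _ => ?_
  have h1 := ((hasDerivAt_pow (2 * k + 3) X).div_const (2 * k + 3 : ℝ)).sub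
    (((hasDerivAt_pow (2 * k + 1) X).div_const (2 * k + 1 : ℝ)).const_mul r)
  refine (h1.const_mul _).congr_deriv ?_
  have h2 : (2 * k + 1 : ℝ) ≠ 0 := by positivity
  have h3 : (2 * k + 3 : ℝ) ≠ 0 := by positivity
  rw [show 2 * k + 3 - 1 = 2 * k + 2 by omega, show 2 * k + 1 - 1 = 2 * k by omega]
  push_cast
  field_simp
  ring

/-! ### Factorization of Π(u,v) - Π(v,u) and the polynomial T -/

theorem hasDerivAt_ratio (n : ℕ) (A B : ℝ) {t : ℝ} (h0 : t ≠ 0) (h1 : t ≠ 1) (h2 : t ≠ 2) :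
    HasDerivAt (fun t => (A + B * E (n + 1) t) / F (n + 1) t)
      ((B * kap n * (t - 1) - A * lam n t) * (t - 1) ^ n / (t ^ (2 * n + 2) * (t - 2) ^ 2)) t := by
  have hF := F_ne_zero n h0 h1 h2
  have h := (((differentiable_E n t).hasDerivAt.const_mul B).const_add A).fun_div
    (hasDerivAt_F n h1).differentiableAt.hasDerivAt hF
  refine h.congr_deriv ?_
  have e1 := E_ode n t
  have e2 := F_ode n h1
  have h1' := sub_ne_zero.2 h1
  have h2' := sub_ne_zero.2 h2
  have hne : t * (t - 1) * (t - 2) ≠ 0 := mul_ne_zero (mul_ne_zero h0 h1') h2'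
  have key : (B * deriv (E (n + 1)) t * F (n + 1) t - (A + B * E (n + 1) t) * deriv (F (n + 1)) t)
      / F (n + 1) t ^ 2 = (B * kap n * (t - 1) - A * lam n t) / (t * (t - 1) * (t - 2) * F (n + 1) t) := by
    rw [div_eq_div_iff (pow_ne_zero _ hF) (mul_ne_zero hne hF)]
    linear_combination B * F (n + 1) t ^ 2 * e1 - (A + B * E (n + 1) t) * F (n + 1) t * e2
  rw [key, F_eq]
  field_simp
  ring

/-- The factor of t - 1 is `bet`·`kap`. At a zero t of 1 + βE + CF the left side equals t(t-2)Q'(t),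
and this choice of β is the one making Q'(u) and Q'(v) opposite: in τ = (t-2)/t the quadratic is τ²
- τ(u)τ(v), up to a factor. -/
theorem quadratic_identity (n : ℕ) {u v : ℝ} (hu : u ≠ 0) (hv : v ≠ 0) (h : u + v - 2 ≠ 0) (t : ℝ) :
    (2 * (n + 1) * (u * v) / (u + v - 2) - 4 * (n + 1) + 2) * (t - 1) - lam n t
      = -(n + 1) * (u * v) / (2 * (u + v - 2)) * ((t - 2) ^ 2 - (u - 2) * (v - 2) / (u * v) * t ^ 2) := by
  unfold lam; field_simp; ring

/-- The coefficient `β` such that `1 + β E + C F` vanishes at `u` and `v`, for some `C`, when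
`(u, v)` is on the zero set of `T`. -/
def bet (n : ℕ) (u v : ℝ) : ℝ := (2 * (n + 1) * (u * v) / (u + v - 2) - 4 * (n + 1) + 2) / kap n

theorem bet_mul_kap (n : ℕ) (u v : ℝ) :
    bet n u v * kap n = 2 * (n + 1) * (u * v) / (u + v - 2) - 4 * (n + 1) + 2 := by
  unfold bet; rw [div_mul_cancel₀ _ (kap_neg n).ne]

/-- In the variable τ = (t-2)/t one has 1 - τ² = 4(t-1)/t², so the derivative of the ratio becomes
c(1 - ρ/τ²)(1 - τ²)^n with ρ = τ(u)τ(v), the integrand of S with e = 1. -/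
theorem ratio_sub_ratio {n : ℕ} {u v : ℝ} (hu : 2 < u) (hv : 2 < v) :
    (1 + bet n u v * E (n + 1) u) / F (n + 1) u - (1 + bet n u v * E (n + 1) v) / F (n + 1) v
      = -(n + 1) * (u * v) / (2 * (u + v - 2)) / (2 * 4 ^ n) * S n 1 ((u - 2) / u) ((v - 2) / v) := by
  set ρ := (u - 2) * (v - 2) / (u * v) with hρ
  set c := -(n + 1) * (u * v) / (2 * (u + v - 2)) / (2 * 4 ^ n) with hc
  set τ : ℝ → ℝ := fun t => (t - 2) / t with hτ
  -- The extra term X + ρ/X takes equal values at τ(u) and τ(v), so it does not affect the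
  -- difference.
  set Ψ : ℝ → ℝ := fun X => Phi n 1 ρ X + (X + ρ * X⁻¹) with hΨ
  set H : ℝ → ℝ := fun t => (1 + bet n u v * E (n + 1) t) / F (n + 1) t - c * Ψ (τ t) with hH
  have hder : ∀ t ∈ Ioi (2 : ℝ), HasDerivAt H 0 t := by
    intro t ht
    have ht : 2 < t := ht
    have t0 : t ≠ 0 := by linarith
    have t1 : t - 1 ≠ 0 := by linarith
    have t2 : t - 2 ≠ 0 := by linarith
    have h1 := hasDerivAt_ratio n 1 (bet n u v) t0 (sub_ne_zero.1 t1) (sub_ne_zero.1 t2)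
    have hτ0 : τ t ≠ 0 := div_ne_zero t2 t0
    have hdτ : HasDerivAt τ ((1 * t - (t - 2) * 1) / t ^ 2) t :=
      ((hasDerivAt_id t).sub_const 2).fun_div (hasDerivAt_id t) t0
    have hdΨ : HasDerivAt Ψ (((τ t) ^ 2 - ρ) * W n 1 (τ t) + (1 + ρ * (-(τ t ^ 2)⁻¹))) (τ t) :=
      (hasDerivAt_Phi n 1 ρ (τ t)).add ((hasDerivAt_id _).add ((hasDerivAt_inv hτ0).const_mul ρ))
    have h2 := (hdΨ.comp t hdτ).const_mul c
    refine (h1.sub h2).congr_deriv ?_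
    have hW := sq_mul_W n 1 (τ t)
    have hΨ' : ((τ t) ^ 2 - ρ) * W n 1 (τ t) + (1 + ρ * (-(τ t ^ 2)⁻¹))
        = (1 - ρ / τ t ^ 2) * (1 - τ t ^ 2) ^ n := by
      have : W n 1 (τ t) = ((1 - τ t ^ 2) ^ n - 1) / τ t ^ 2 := by
        rw [eq_div_iff (pow_ne_zero _ hτ0)]; linarith [hW, one_pow (M := ℝ) n, one_pow (M := ℝ) 2, show ((1:ℝ)^2)^n = 1 by simp, show ((1:ℝ)^2 - τ t ^ 2)^n = (1 - τ t ^ 2)^n by simp]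
      rw [this]; field_simp; ring
    rw [hΨ']
    have h3 : 1 - τ t ^ 2 = 4 * (t - 1) / t ^ 2 := by simp only [hτ]; field_simp; ring
    have hq := quadratic_identity n (u := u) (v := v) (by linarith) (by linarith) (by linarith) t
    rw [← bet_mul_kap, ← hρ] at hq
    rw [one_mul, hq, h3, hc]
    simp only [hτ]
    rw [div_pow _ (t ^ 2) n, mul_pow 4 _ n, div_pow]
    field_simp
    ring
  have hconst : H u = H v := isOpen_Ioi.is_const_of_deriv_eq_zero isPreconnected_Ioi
    (fun y hy => (hder y hy).differentiableAt.differentiableWithinAt)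
      (fun y hy => (hder y hy).deriv) hu hv
  have hu0 : u ≠ 0 := by linarith
  have hv0 : v ≠ 0 := by linarith
  have hu2 : u - 2 ≠ 0 := by linarith
  have hv2 : v - 2 ≠ 0 := by linarith
  have hρ' : ρ = τ u * τ v := by simp only [hρ, hτ]; field_simp
  have hsum : τ u + ρ * (τ u)⁻¹ = τ v + ρ * (τ v)⁻¹ := by
    simp only [hρ, hτ]; field_simp; ring
  have hS := S_eq_Phi n 1 (τ u) (τ v)
  rw [← hρ'] at hS
  simp only [hH, hΨ] at hconst
  change _ = c * S n 1 (τ u) (τ v)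
  rw [hS]
  linear_combination hconst + c * hsum

/-- The determinant-like expression whose vanishing defines the `T` part of the moduli curve. -/
def J (n : ℕ) (u v : ℝ) : ℝ :=
  (2 * (n + 1) * ((u - 1) * (v - 1) + 1) - 2 * n * (u + v - 2))
    * (E (n + 1) u * F (n + 1) v - E (n + 1) v * F (n + 1) u)
  + kap n * (u + v - 2) * (F (n + 1) v - F (n + 1) u)

theorem bet_J {n : ℕ} {u v : ℝ} (h : u + v - 2 ≠ 0) :
    J n u v = kap n * (u + v - 2) * ((1 + bet n u v * E (n + 1) u) * F (n + 1) v
      - (1 + bet n u v * E (n + 1) v) * F (n + 1) u) := by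
  have hb := bet_mul_kap n u v
  have hb2 : bet n u v * kap n * (u + v - 2)
      = 2 * (n + 1) * ((u - 1) * (v - 1) + 1) - 2 * n * (u + v - 2) := by
    rw [hb]; field_simp; ring
  unfold J; rw [← hb2]; ring

theorem J_eq_of_two_lt {n : ℕ} {u v : ℝ} (hu : 2 < u) (hv : 2 < v) :
    (u - 1) ^ (n + 1) * (v - 1) ^ (n + 1) * J n u v
      = kap n * (n + 1) / 4 ^ (n + 1) * (u * v * ((u - 2) * (v - 2)))
        * S n (u * v) (u * (v - 2)) (v * (u - 2)) := by
  have hu0 : u ≠ 0 := by linarith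
  have hv0 : v ≠ 0 := by linarith
  have hu1 : u - 1 ≠ 0 := by linarith
  have hv1 : v - 1 ≠ 0 := by linarith
  have hu2 : u - 2 ≠ 0 := by linarith
  have hv2 : v - 2 ≠ 0 := by linarith
  have huv : u + v - 2 ≠ 0 := by linarith
  have hFu := F_ne_zero n hu0 (sub_ne_zero.1 hu1) (sub_ne_zero.1 hu2)
  have hFv := F_ne_zero n hv0 (sub_ne_zero.1 hv1) (sub_ne_zero.1 hv2)
  have hr := ratio_sub_ratio (n := n) hu hv
  have hS := S_smul n (u * v) 1 ((u - 2) / u) ((v - 2) / v)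
  rw [mul_one, show u * v * ((u - 2) / u) = v * (u - 2) by field_simp,
    show u * v * ((v - 2) / v) = u * (v - 2) by field_simp, S_swap] at hS
  rw [bet_J huv]
  rw [div_sub_div _ _ hFu hFv, div_eq_iff (mul_ne_zero hFu hFv)] at hr
  have h1 : (1 + bet n u v * E (n + 1) u) * F (n + 1) v
      - (1 + bet n u v * E (n + 1) v) * F (n + 1) u = (1 + bet n u v * E (n + 1) u) * F (n + 1) v
      - F (n + 1) u * (1 + bet n u v * E (n + 1) v) := by ring
  rw [h1, hr]
  have hS' : S n (u * v) (u * (v - 2)) (v * (u - 2))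
      = -((u * v) ^ (2 * n + 1) * S n 1 ((u - 2) / u) ((v - 2) / v)) := by linarith
  rw [hS', F_eq, F_eq, mul_pow]
  field_simp
  ring

theorem isPoly_E (n : ℕ) {f : ℝ → ℝ → ℝ} (hf : IsPoly f) : IsPoly fun u v => E (n + 1) (f u v) := by
  simp only [E, Sig_eq]
  exact (hf.sub (.const 1)).mul (.sum _ fun i => (IsPoly.const _).mul (hf.pow i))

theorem isPoly_S (n : ℕ) {f g h : ℝ → ℝ → ℝ} (hf : IsPoly f) (hg : IsPoly g) (hh : IsPoly h) :
    IsPoly fun u v => S n (f u v) (g u v) (h u v) := by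
  unfold S cubicDiff
  refine .sum _ fun k => ((IsPoly.const _).mul (hf.pow _)).mul ?_
  exact (((hg.pow _).sub (hh.pow _)).div_const _).sub
    (((hg.mul hh).mul ((hg.pow _).sub (hh.pow _))).div_const _)

theorem J_eq {n : ℕ} {u v : ℝ} (hu : u ≠ 1) (hv : v ≠ 1) :
    (u - 1) ^ (n + 1) * (v - 1) ^ (n + 1) * J n u v
      = kap n * (n + 1) / 4 ^ (n + 1) * (u * v * ((u - 2) * (v - 2)))
        * S n (u * v) (u * (v - 2)) (v * (u - 2)) := by
  set f : ℝ → ℝ → ℝ := fun u v =>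
    (2 * (n + 1) * ((u - 1) * (v - 1) + 1) - 2 * n * (u + v - 2))
      * ((u - 1) ^ (n + 1) * E (n + 1) u * ((v - 2) * v ^ (2 * n + 1))
        - (v - 1) ^ (n + 1) * E (n + 1) v * ((u - 2) * u ^ (2 * n + 1)))
    + kap n * (u + v - 2) * ((u - 1) ^ (n + 1) * ((v - 2) * v ^ (2 * n + 1))
        - (v - 1) ^ (n + 1) * ((u - 2) * u ^ (2 * n + 1))) with hf
  have hfJ : ∀ u v : ℝ, u ≠ 1 → v ≠ 1 → (u - 1) ^ (n + 1) * (v - 1) ^ (n + 1) * J n u v = f u v := by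
    intro u v hu hv
    have hu1 := sub_ne_zero.2 hu
    have hv1 := sub_ne_zero.2 hv
    simp only [hf, J, F_eq]
    field_simp
  have U := IsPoly.fst
  have V := IsPoly.snd
  have hfp : IsPoly f := by
    have hE1 := isPoly_E n U
    have hE2 := isPoly_E n V
    have hs1 := U.sub (.const 1)
    have hs2 := V.sub (.const 1)
    have h1 := (hs1.pow (n + 1))
    have h2 := (hs2.pow (n + 1))
    have h3 := (V.sub (.const 2)).mul (V.pow (2 * n + 1))
    have h4 := (U.sub (.const 2)).mul (U.pow (2 * n + 1))
    have h5 := (U.add V).sub (.const 2)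
    refine IsPoly.add (IsPoly.mul (IsPoly.sub ?_ ?_) ?_) (IsPoly.mul ?_ ?_)
    · exact (IsPoly.const _).mul ((hs1.mul hs2).add (.const 1))
    · exact (IsPoly.const _).mul h5
    · exact ((h1.mul hE1).mul h3).sub ((h2.mul hE2).mul h4)
    · exact (IsPoly.const _).mul h5
    · exact (h1.mul h3).sub (h2.mul h4)
  have hgp : IsPoly fun u v => kap n * (n + 1) / 4 ^ (n + 1) * (u * v * ((u - 2) * (v - 2)))
        * S n (u * v) (u * (v - 2)) (v * (u - 2)) := by
    refine IsPoly.mul ((IsPoly.const _).mul ((U.mul V).mul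
      ((U.sub (.const 2)).mul (V.sub (.const 2))))) ?_
    exact isPoly_S n (U.mul V) (U.mul (V.sub (.const 2))) (V.mul (U.sub (.const 2)))
  rw [hfJ u v hu hv]
  refine hfp.eq_of_eqOn hgp (s := Ioi 2) (t := Ioi 2) (Ioi_infinite _) (Ioi_infinite _) ?_ u v
  intro u hu v hv
  have hu : 2 < u := hu
  have hv : 2 < v := hv
  rw [← hfJ u v (by linarith) (by linarith)]
  exact J_eq_of_two_lt hu hv

theorem isPoly_dSig (n : ℕ) {f : ℝ → ℝ → ℝ} (hf : IsPoly f) : IsPoly fun u v => dSig n (f u v) := by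
  unfold dSig
  exact .sum _ fun i => (IsPoly.const _).mul ((IsPoly.const _).mul (hf.pow _))

theorem isPoly_Sig (n : ℕ) {f : ℝ → ℝ → ℝ} (hf : IsPoly f) :
    IsPoly fun u v => Sig (n + 1) (f u v) := by
  simp only [Sig_eq]
  exact .sum _ fun i => (IsPoly.const _).mul (hf.pow _)

/-- `(u - 1)^(n + 1) (v - 1)^(n + 1) Π(u, v)` as a polynomial. -/
def piNum (n : ℕ) (u v : ℝ) : ℝ :=
  (v - 1) * ((u - 1) ^ (n + 1) * ((v - 2) * v ^ (2 * n + 1))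
      - (v - 1) ^ (n + 1) * ((u - 2) * u ^ (2 * n + 1))) * (Sig (n + 1) v + (v - 1) * dSig n v)
    - (u - 1) ^ (n + 1) * (E (n + 1) v - E (n + 1) u)
      * (v ^ (2 * n) * ((n + 1) * v ^ 2 - 2 * (2 * n + 1) * v + 2 * (2 * n + 1)))

theorem isPoly_piNum (n : ℕ) {f g : ℝ → ℝ → ℝ} (hf : IsPoly f) (hg : IsPoly g) :
    IsPoly fun u v => piNum n (f u v) (g u v) := by
  unfold piNum
  have h1 := (hf.sub (.const 1)).pow (n + 1)
  have h2 := (hg.sub (.const 1)).pow (n + 1)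
  have h3 := (hg.sub (.const 2)).mul (hg.pow (2 * n + 1))
  have h4 := (hf.sub (.const 2)).mul (hf.pow (2 * n + 1))
  refine (((hg.sub (.const 1)).mul ((h1.mul h3).sub (h2.mul h4))).mul
    ((isPoly_Sig n hg).add ((hg.sub (.const 1)).mul (isPoly_dSig n hg)))).sub
    ((h1.mul ((isPoly_E n hg).sub (isPoly_E n hf))).mul ((hg.pow _).mul ?_))
  exact (((IsPoly.const _).mul (hg.pow 2)).sub ((IsPoly.const _).mul hg)).add (.const _)

theorem pow_mul_Pi (n : ℕ) {u v : ℝ} (hu : u ≠ 1) (hv : v ≠ 1) :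
    (u - 1) ^ (n + 1) * (v - 1) ^ (n + 1) * Pi (n + 1) u v = piNum n u v := by
  have hu1 := sub_ne_zero.2 hu
  have hv1 := sub_ne_zero.2 hv
  unfold Pi piNum
  rw [deriv_F n hv, deriv_E, F_eq, F_eq]
  unfold lam
  field_simp
  ring

/-- The differential equations replace every derivative by values of E and F; the equation of the
hyperbola then splits off. -/
theorem Pi_sub_mul (n : ℕ) {u v : ℝ} (hu : u ≠ 1) (hv : v ≠ 1) :
    (u * v * ((u - 2) * (v - 2))) * (Pi (n + 1) u v - Pi (n + 1) v u)
      = (u * v - u - v) * J n u v := by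
  have e1 := E_ode n u
  have e2 := E_ode n v
  have f1 := F_ode n hu
  have f2 := F_ode n hv
  unfold Pi J
  unfold lam at e1 e2 f1 f2
  linear_combination (F (n + 1) v - F (n + 1) u) * (v * (v - 2) * e1 + u * (u - 2) * e2)
    - (E (n + 1) v - E (n + 1) u) * (v * (v - 2) * f1 + u * (u - 2) * f2)

theorem Pi_sub_eq (n : ℕ) {u v : ℝ} (hu : u ≠ 1) (hv : v ≠ 1) :
    (u - 1) ^ (n + 1) * (v - 1) ^ (n + 1) * (Pi (n + 1) u v - Pi (n + 1) v u)
      = (u * v - u - v) * (kap n * (n + 1) / 4 ^ (n + 1)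
        * S n (u * v) (u * (v - 2)) (v * (u - 2))) := by
  have U := IsPoly.fst
  have V := IsPoly.snd
  have h1 : (u - 1) ^ (n + 1) * (v - 1) ^ (n + 1) * (Pi (n + 1) u v - Pi (n + 1) v u)
      = piNum n u v - piNum n v u := by
    rw [← pow_mul_Pi n hu hv, ← pow_mul_Pi n hv hu]; ring
  rw [h1]
  refine ((isPoly_piNum n U V).sub (isPoly_piNum n V U)).eq_of_eqOn
    (g := fun u v => (u * v - u - v) * (kap n * (n + 1) / 4 ^ (n + 1)
        * S n (u * v) (u * (v - 2)) (v * (u - 2))))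
    (((((U.mul V).sub U).sub V)).mul ((IsPoly.const _).mul
      (isPoly_S n (U.mul V) (U.mul (V.sub (.const 2))) (V.mul (U.sub (.const 2))))))
    (s := Ioi 2) (t := Ioi 2) (Ioi_infinite _) (Ioi_infinite _) ?_ u v
  intro u hu v hv
  have hu : 2 < u := hu
  have hv : 2 < v := hv
  have hu' : u ≠ 1 := by linarith
  have hv' : v ≠ 1 := by linarith
  rw [← pow_mul_Pi n hu' hv', ← pow_mul_Pi n hv' hu']
  have hD : u * v * ((u - 2) * (v - 2)) ≠ 0 := by
    have : 0 < u - 2 := by linarith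
    have : 0 < v - 2 := by linarith
    positivity
  apply mul_left_cancel₀ hD
  have h2 := Pi_sub_mul n hu' hv'
  have h3 := J_eq (n := n) hu' hv'
  linear_combination (u - 1) ^ (n + 1) * (v - 1) ^ (n + 1) * h2 + (u * v - u - v) * h3

theorem isSymmetric_of_ev {P : MvPolynomial (Fin 2) ℝ} (h : ∀ u v, ev P u v = ev P v u) :
    P.IsSymmetric := by
  intro e
  apply MvPolynomial.funext
  intro x
  rw [MvPolynomial.eval_rename]
  have h1 : x = ![x 0, x 1] := by funext i; fin_cases i <;> rfl
  have hsurj : (e 0 = 0 ∧ e 1 = 1) ∨ (e 0 = 1 ∧ e 1 = 0) := by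
    revert e; decide
  rcases hsurj with ⟨h2, h3⟩ | ⟨h2, h3⟩
  · congr 2
    funext i; fin_cases i <;> simp [h2, h3]
  · have h4 : x ∘ e = ![x 1, x 0] := by funext i; fin_cases i <;> simp [h2, h3]
    rw [h4]
    conv_rhs => rw [h1]
    exact h _ _

theorem exists_isT (n : ℕ) : ∃ P, IsT (n + 1) P ∧ ∀ u v,
    2 * (v - u) ^ 3 * ev P u v
      = kap n * (n + 1) / 4 ^ (n + 1) * S n (u * v) (u * (v - 2)) (v * (u - 2)) := by
  choose δ hδ h using exists_poly_cubicDiff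
  have U := IsPoly.fst
  have V := IsPoly.snd
  obtain ⟨P, hP⟩ : IsPoly fun u v => 4 * (kap n * (n + 1) / 4 ^ (n + 1)) * ∑ k ∈ Finset.range n,
      (n.choose (k + 1) : ℝ) * (-1) ^ (k + 1) * (u * v) ^ (2 * (n - 1 - k))
        * δ k (u * v - u - v) ((v - u) ^ 2) := by
    refine (IsPoly.const _).mul (.sum _ fun k => ((IsPoly.const _).mul ((U.mul V).pow _)).mul ?_)
    exact (hδ k).comp (((U.mul V).sub U).sub V) ((V.sub U).pow 2)
  have key : ∀ u v, 2 * (v - u) ^ 3 * ev P u v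
      = kap n * (n + 1) / 4 ^ (n + 1) * S n (u * v) (u * (v - 2)) (v * (u - 2)) := by
    intro u v
    rw [hP]
    unfold S
    simp only [Finset.mul_sum]
    refine Finset.sum_congr rfl fun k _ => ?_
    rw [h, show (u * (v - 2) + v * (u - 2)) / 2 = u * v - u - v by ring,
      show (u * (v - 2) - v * (u - 2)) / 2 = v - u by ring]
    ring
  refine ⟨P, ⟨isSymmetric_of_ev fun u v => ?_, fun u v hu hv => ?_⟩, key⟩
  · rw [hP, hP]
    beta_reduce
    rw [show v * u - v - u = u * v - u - v by ring, show (v - u) ^ 2 = (u - v) ^ 2 by ring,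
      mul_comm v u]
  · rw [Pi_sub_eq n hu hv, ← key]; ring

theorem isT_unique {m : ℕ} {P R : MvPolynomial (Fin 2) ℝ} (hP : IsT m P) (hR : IsT m R) : P = R := by
  -- On this box v - u > 0 and uv - u - v = (u-1)(v-1) - 1 > 0, so the factor in front of T can be
  -- cancelled.
  refine mvPolynomial_ext_of_ev (s := Ioo 3 4) (t := Ioo 5 6) (Ioo_infinite (by norm_num))
    (Ioo_infinite (by norm_num)) fun u hu v hv => ?_
  obtain ⟨h3, h4⟩ := hu
  obtain ⟨h5, h6⟩ := hv
  have h1 := hP.2 u v (by linarith) (by linarith)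
  rw [hR.2 u v (by linarith) (by linarith)] at h1
  have h2 : 2 * (v - u) ^ 3 * (u * v - u - v) ≠ 0 := by
    have : v - u ≠ 0 := by linarith
    have : u * v - u - v ≠ 0 := by nlinarith
    positivity
  exact (mul_left_cancel₀ h2 h1).symm

theorem T_spec (n : ℕ) (u v : ℝ) : 2 * (v - u) ^ 3 * ev (T (n + 1)) u v
      = kap n * (n + 1) / 4 ^ (n + 1) * S n (u * v) (u * (v - 2)) (v * (u - 2)) := by
  obtain ⟨P, hP, h⟩ := exists_isT n
  have hT : IsT (n + 1) (T (n + 1)) := Classical.epsilon_spec ⟨P, hP⟩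
  rw [isT_unique hT hP, h]

theorem ev_T_eq_zero_iff (n : ℕ) {u v : ℝ} (huv : u < v) :
    ev (T (n + 1)) u v = 0 ↔ S n (u * v) (u * (v - 2)) (v * (u - 2)) = 0 := by
  have h := T_spec n u v
  have h1 : 2 * (v - u) ^ 3 ≠ 0 := by
    have : v - u ≠ 0 := by linarith
    positivity
  have h2 : kap n * (n + 1) / 4 ^ (n + 1) ≠ 0 := by
    have := (kap_neg n).ne
    positivity
  constructor
  · intro h0
    rw [h0, mul_zero] at h
    exact (mul_eq_zero.1 h.symm).resolve_left h2
  · intro h0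
    rw [h0, mul_zero] at h
    exact (mul_eq_zero.1 h).resolve_left h1

/-! ### Regions where S has no zeros -/

theorem W_neg {n : ℕ} (hn : 1 ≤ n) {e X : ℝ} (hX : X ≠ 0) (h : |X| ≤ |e| ∨ Odd n) : W n e X < 0 := by
  have h1 := sq_mul_W n e X
  have h2 : 0 < X ^ 2 := by positivity
  have h3 : e ^ 2 - X ^ 2 < e ^ 2 := by linarith
  have h4 : (e ^ 2 - X ^ 2) ^ n < (e ^ 2) ^ n := by
    rcases h with h | h
    · exact pow_lt_pow_left₀ h3 (by linarith [sq_le_sq.2 h]) (by omega)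
    · exact h.strictMono_pow h3
  by_contra! h5
  have := mul_nonneg h2.le h5
  linarith

theorem continuous_Phi (n : ℕ) (e r : ℝ) : Continuous (Phi n e r) :=
  continuous_iff_continuousAt.2 fun X => (hasDerivAt_Phi n e r X).continuousAt

/-- Here ab ≤ 0, so X² - ab > 0 for X ≠ 0, while W < 0: the integrand is negative on both sides of
0. -/
theorem S_neg_of_opposite {n : ℕ} (hn : 1 ≤ n) {e a b : ℝ} (hb : b ≤ 0) (ha : 0 ≤ a) (hab : b < a)
    (h : (|a| ≤ |e| ∧ |b| ≤ |e|) ∨ Odd n) : S n e a b < 0 := by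
  have hW : ∀ X ∈ Ioo b a, X ≠ 0 → W n e X < 0 := by
    intro X hX h0
    refine W_neg hn h0 (h.imp_left fun h => ?_)
    rcases le_total 0 X with h1 | h1
    · exact (abs_le_abs_of_nonneg h1 hX.2.le).trans h.1
    · exact (abs_le_abs_of_nonpos h1 hX.1.le).trans h.2
  have hd : ∀ X ∈ Ioo b a, X ≠ 0 → deriv (Phi n e (a * b)) X < 0 := by
    intro X hX h0
    rw [(hasDerivAt_Phi n e (a * b) X).deriv]
    have : 0 < X ^ 2 := by positivity
    exact mul_neg_of_pos_of_neg (by nlinarith) (hW X hX h0)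
  have h1 : StrictAntiOn (Phi n e (a * b)) (Icc 0 a) := by
    refine strictAntiOn_of_deriv_neg (convex_Icc _ _) (continuous_Phi _ _ _).continuousOn ?_
    rw [interior_Icc]
    exact fun X hX => hd X ⟨by linarith [hX.1], hX.2⟩ hX.1.ne'
  have h2 : StrictAntiOn (Phi n e (a * b)) (Icc b 0) := by
    refine strictAntiOn_of_deriv_neg (convex_Icc _ _) (continuous_Phi _ _ _).continuousOn ?_
    rw [interior_Icc]
    exact fun X hX => hd X ⟨hX.1, by linarith [hX.2]⟩ hX.2.ne
  rw [S_eq_Phi]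
  rcases ha.eq_or_lt with rfl | ha'
  · have := h2 ⟨le_rfl, hb⟩ ⟨hb, le_rfl⟩ hab
    linarith
  · have h3 := h1 ⟨le_rfl, ha⟩ ⟨ha, le_rfl⟩ ha'
    have h4 := h2.antitoneOn ⟨le_rfl, hb⟩ ⟨hb, le_rfl⟩ hb
    linarith

/-- After subtracting c(X + ab/X) from the primitive, with c chosen at the geometric mean s of a and
b, the integrand is (1 - s²/X²)((e² - X²)^n - (e² - s²)^n). Both factors change sign exactly at s,
so the product keeps one sign. -/
theorem S_ne_zero_of_strictMono {n : ℕ} {e a b : ℝ} (hb : 0 < b) (hab : b < a) {σ : ℝ}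
    (hσ : σ ≠ 0) (h : StrictMonoOn (fun X => σ * (e ^ 2 - X ^ 2) ^ n) (Icc b a)) :
    S n e a b ≠ 0 := by
  set s := √(a * b) with hs
  have ha : 0 < a := hb.trans hab
  have hs2 : s ^ 2 = a * b := Real.sq_sqrt (by positivity)
  have hs0 : 0 < s := Real.sqrt_pos.2 (by positivity)
  have hbs : b < s := by nlinarith
  have hsa : s < a := by nlinarith
  set c := (e ^ 2 - s ^ 2) ^ n - (e ^ 2) ^ n with hc
  set Ψ : ℝ → ℝ := fun X => σ * (Phi n e (a * b) X - c * (X + a * b * X⁻¹)) with hΨ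
  have hder : ∀ X, 0 < X → HasDerivAt Ψ
      ((1 - s ^ 2 / X ^ 2) * (σ * (e ^ 2 - X ^ 2) ^ n - σ * (e ^ 2 - s ^ 2) ^ n)) X := by
    intro X hX
    have h1 := ((hasDerivAt_Phi n e (a * b) X).sub
      (((hasDerivAt_id X).add ((hasDerivAt_inv hX.ne').const_mul (a * b))).const_mul c)).const_mul σ
    refine h1.congr_deriv ?_
    have h2 := sq_mul_W n e X
    have h3 : W n e X = ((e ^ 2 - X ^ 2) ^ n - (e ^ 2) ^ n) / X ^ 2 := by
      rw [eq_div_iff (by positivity)]; linarith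
    rw [h3, hc, ← hs2]
    field_simp
    ring
  have hcont : ContinuousOn Ψ (Icc b a) := fun X hX =>
    (hder X (hb.trans_le hX.1)).continuousAt.continuousWithinAt
  have hpos : ∀ X ∈ Icc b a, X ≠ s → 0 < deriv Ψ X := by
    intro X hX hXs
    have hX0 : 0 < X := hb.trans_le hX.1
    rw [(hder X hX0).deriv]
    rcases hXs.lt_or_gt with h1 | h1
    · refine mul_pos_of_neg_of_neg ?_ (sub_neg.2 (h hX ⟨hbs.le, hsa.le⟩ h1))
      rw [sub_neg, one_lt_div (by positivity)]
      exact pow_lt_pow_left₀ h1 hX0.le two_ne_zero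
    · refine mul_pos ?_ (sub_pos.2 (h ⟨hbs.le, hsa.le⟩ hX h1))
      rw [sub_pos, div_lt_one (by positivity)]
      exact pow_lt_pow_left₀ h1 hs0.le two_ne_zero
  have m1 : StrictMonoOn Ψ (Icc b s) := by
    refine strictMonoOn_of_deriv_pos (convex_Icc _ _) (hcont.mono (Icc_subset_Icc_right hsa.le)) ?_
    rw [interior_Icc]
    exact fun X hX => hpos X ⟨hX.1.le, hX.2.le.trans hsa.le⟩ hX.2.ne
  have m2 : StrictMonoOn Ψ (Icc s a) := by
    refine strictMonoOn_of_deriv_pos (convex_Icc _ _) (hcont.mono (Icc_subset_Icc_left hbs.le)) ?_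
    rw [interior_Icc]
    exact fun X hX => hpos X ⟨hbs.le.trans hX.1.le, hX.2.le⟩ hX.1.ne'
  have h3 := (m1 ⟨le_rfl, hbs.le⟩ ⟨hbs.le, le_rfl⟩ hbs).trans
    (m2 ⟨le_rfl, hsa.le⟩ ⟨hsa.le, le_rfl⟩ hsa)
  have h4 : Ψ a - Ψ b = σ * S n e a b := by
    rw [S_eq_Phi]; simp only [hΨ]; field_simp; ring
  intro h0
  rw [h0, mul_zero] at h4
  linarith

theorem S_ne_zero_of_pos {n : ℕ} (hn : 1 ≤ n) {e a b : ℝ} (hb : 0 < b) (hab : b < a)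
    (h : a ^ 2 ≤ e ^ 2 ∨ e ^ 2 ≤ b ^ 2) : S n e a b ≠ 0 := by
  rcases h with h | h
  · refine S_ne_zero_of_strictMono hb hab (σ := -1) (by norm_num) fun X hX Y hY hXY => ?_
    have hX0 : 0 < X := hb.trans_le hX.1
    have h1 : X ^ 2 < Y ^ 2 := pow_lt_pow_left₀ hXY hX0.le two_ne_zero
    have h2 : Y ^ 2 ≤ a ^ 2 := pow_le_pow_left₀ (hX0.trans hXY).le hY.2 2
    have := pow_lt_pow_left₀ (by linarith : e ^ 2 - Y ^ 2 < e ^ 2 - X ^ 2) (by linarith)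
      (by omega : n ≠ 0)
    simp only; linarith
  · refine S_ne_zero_of_strictMono hb hab (σ := (-1) ^ n) (by positivity) fun X hX Y hY hXY => ?_
    have hX0 : 0 < X := hb.trans_le hX.1
    have h1 : X ^ 2 < Y ^ 2 := pow_lt_pow_left₀ hXY hX0.le two_ne_zero
    have h2 : b ^ 2 ≤ X ^ 2 := pow_le_pow_left₀ hb.le hX.1 2
    have := pow_lt_pow_left₀ (by linarith : X ^ 2 - e ^ 2 < Y ^ 2 - e ^ 2) (by linarith)
      (by omega : n ≠ 0)
    simp only [← mul_pow]
    rw [show -1 * (e ^ 2 - X ^ 2) = X ^ 2 - e ^ 2 by ring, show -1 * (e ^ 2 - Y ^ 2) = Y ^ 2 - e ^ 2 by ring]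
    exact this

theorem S_ne_zero_of_neg {n : ℕ} (hn : 1 ≤ n) {e a b : ℝ} (ha : a < 0) (hab : b < a)
    (h : b ^ 2 ≤ e ^ 2 ∨ e ^ 2 ≤ a ^ 2) : S n e a b ≠ 0 := by
  have := S_ne_zero_of_pos hn (e := e) (a := -b) (b := -a) (by linarith) (by linarith)
    (by simpa using h)
  rwa [S_neg, S_swap, neg_neg] at this

theorem S_ne_zero_of_one_lt {n : ℕ} (hn : 1 ≤ n) {u v : ℝ} (hu : 1 < u) (huv : u < v) :
    S n (u * v) (u * (v - 2)) (v * (u - 2)) ≠ 0 := by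
  have hab : v * (u - 2) < u * (v - 2) := by nlinarith
  have ha : |u * (v - 2)| ≤ |u * v| := by
    rw [abs_mul, abs_mul]
    refine mul_le_mul_of_nonneg_left ?_ (abs_nonneg _)
    rw [abs_of_pos (by linarith : 0 < v), abs_le]; constructor <;> linarith
  have hb : |v * (u - 2)| ≤ |u * v| := by
    rw [abs_mul, abs_mul, mul_comm |u|]
    refine mul_le_mul_of_nonneg_left ?_ (abs_nonneg _)
    rw [abs_of_pos (by linarith : 0 < u), abs_le]; constructor <;> linarith
  rcases lt_or_ge 0 (v * (u - 2)) with h1 | h1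
  · exact S_ne_zero_of_pos hn h1 hab (Or.inl (sq_le_sq.2 ha))
  rcases lt_or_ge (u * (v - 2)) 0 with h2 | h2
  · exact S_ne_zero_of_neg hn h2 hab (Or.inl (sq_le_sq.2 hb))
  exact (S_neg_of_opposite hn h1 h2 hab (Or.inl ⟨ha, hb⟩)).ne

theorem sq_mul_le_sq_mul_sub_two {u v : ℝ} (hu : u < 1) : (u * v) ^ 2 ≤ (v * (u - 2)) ^ 2 := by
  rw [mul_comm u v, mul_pow, mul_pow]
  exact mul_le_mul_of_nonneg_left (by nlinarith) (sq_nonneg _)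

theorem S_ne_zero_of_same_side {n : ℕ} (hn : 1 ≤ n) {u v : ℝ} (hv : v < 1) (huv : u < v)
    (h : 0 < u ∨ v < 0) : S n (u * v) (u * (v - 2)) (v * (u - 2)) ≠ 0 := by
  have hab : v * (u - 2) < u * (v - 2) := by nlinarith
  rcases h with h | h
  · refine S_ne_zero_of_neg hn (by nlinarith) hab (Or.inr ?_)
    rw [mul_comm u v]; exact sq_mul_le_sq_mul_sub_two hv
  · exact S_ne_zero_of_pos hn (by nlinarith) hab (Or.inr (sq_mul_le_sq_mul_sub_two (by linarith)))

theorem S_ne_zero_of_odd {n : ℕ} (hn : Odd n) {u v : ℝ} (hu : u < 0) (hv0 : 0 < v) (hv : v < 1) :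
    S n (u * v) (u * (v - 2)) (v * (u - 2)) ≠ 0 :=
  (S_neg_of_opposite hn.pos (by nlinarith) (by nlinarith) (by nlinarith) (Or.inr hn)).ne

/-! ### Necessary conditions for a point of the curve -/

/-- The general element of `V (n + 1)`. -/
def Q (n : ℕ) (A B C : ℝ) (t : ℝ) : ℝ := (t - 1) * (A + B * E (n + 1) t + C * F (n + 1) t)

theorem mem_V_iff {n : ℕ} {f : ℝ → ℝ} : f ∈ V (n + 1) ↔ ∃ A B C, f = Q n A B C := by
  unfold V
  rw [Submodule.mem_span_triple]
  refine exists_congr fun A => exists_congr fun B => exists_congr fun C => ?_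
  rw [eq_comm]
  have : A • (fun t : ℝ => t - 1) + B • (fun t => (t - 1) * E (n + 1) t)
      + C • (fun t => (t - 1) * F (n + 1) t) = Q n A B C := by
    funext t; simp [Q]; ring
  rw [this]

theorem hasDerivAt_Q (n : ℕ) (A B C : ℝ) {t : ℝ} (ht : t ≠ 1) :
    HasDerivAt (Q n A B C) ((A + B * E (n + 1) t + C * F (n + 1) t)
      + (t - 1) * (B * deriv (E (n + 1)) t + C * deriv (F (n + 1)) t)) t := by
  have hE := (differentiable_E n t).hasDerivAt
  have hF := (hasDerivAt_F n ht).differentiableAt.hasDerivAt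
  have := ((hasDerivAt_id t).sub_const 1).mul (((hE.const_mul B).const_add A).add (hF.const_mul C))
  simp only [id, one_mul] at this
  exact this

theorem deriv_E_zero {n : ℕ} (hn : 1 ≤ n) : deriv (E (n + 1)) 0 = 0 := by
  have h : dSig n 0 = coef n 1 := by
    obtain ⟨k, rfl⟩ : ∃ k, n = k + 1 := ⟨n - 1, by omega⟩
    unfold dSig
    rw [Finset.sum_range_succ', Finset.sum_range_succ']
    simp
  rw [deriv_E, Sig_zero, h, coef_zero_eq_one hn]; ring

theorem deriv_F_zero {n : ℕ} (hn : 1 ≤ n) : deriv (F (n + 1)) 0 = 0 := by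
  rw [deriv_F n (by norm_num), zero_pow (by omega)]; simp

theorem analyticAt_E (n : ℕ) (t : ℝ) : AnalyticAt ℝ (E (n + 1)) t := by
  have : E (n + 1) = fun t => (t - 1) * ∑ i ∈ Finset.range (n + 1), coef n i * t ^ i :=
    funext fun t => by rw [E, Sig_eq]
  rw [this]
  fun_prop

theorem analyticAt_Q (n : ℕ) (A B C : ℝ) {t : ℝ} (ht : t ≠ 1 ∨ C = 0) :
    AnalyticAt ℝ (Q n A B C) t := by
  have hE := analyticAt_E n t
  have h1 : AnalyticAt ℝ (fun t : ℝ => t - 1) t := by fun_prop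
  rcases ht with ht | rfl
  · have hF : AnalyticAt ℝ (F (n + 1)) t := by
      rw [show F (n + 1) = fun t : ℝ => (t - 2) * t ^ (2 * n + 1) / (t - 1) ^ (n + 1) from
        funext (F_eq n)]
      exact AnalyticAt.div (by fun_prop) (by fun_prop) (pow_ne_zero _ (sub_ne_zero.2 ht))
    exact h1.mul ((analyticAt_const.add (analyticAt_const.mul hE)).add (analyticAt_const.mul hF))
  · have : Q n A B 0 = fun t => (t - 1) * (A + B * E (n + 1) t) := by
      funext t; simp [Q]
    rw [this]
    exact h1.mul (analyticAt_const.add (analyticAt_const.mul hE))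

/-- Continuity makes (t-1)^n·Q(t) tend to 0 at 1, but for t ≠ 1 this product is a polynomial with
value -C at 1. The default value of division by zero plays no role. -/
theorem eq_zero_of_continuousAt_Q {n : ℕ} (hn : 1 ≤ n) {A B C : ℝ}
    (h : ContinuousAt (Q n A B C) 1) : C = 0 := by
  have hE := continuous_E n
  have h1 : Filter.Tendsto (fun t => (t - 1) ^ n * Q n A B C t) (nhdsWithin 1 {1}ᶜ) (nhds 0) := by
    have h2 : ContinuousAt (fun t : ℝ => (t - 1) ^ n) 1 := by fun_prop
    have : Filter.Tendsto (fun t => (t - 1) ^ n * Q n A B C t) (nhds 1)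
      (nhds ((1 - 1) ^ n * Q n A B C 1)) := (h2.mul h).tendsto
    rw [sub_self, zero_pow (by omega : n ≠ 0), zero_mul] at this
    exact this.mono_left nhdsWithin_le_nhds
  have h2 : Filter.Tendsto (fun t => (t - 1) ^ (n + 1) * (A + B * E (n + 1) t)
      + C * ((t - 2) * t ^ (2 * n + 1))) (nhdsWithin 1 {1}ᶜ) (nhds (-C)) := by
    have h3 : Continuous (fun t => (t - 1) ^ (n + 1) * (A + B * E (n + 1) t)
      + C * ((t - 2) * t ^ (2 * n + 1))) := by fun_prop
    have := h3.tendsto 1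
    norm_num at this
    exact this.mono_left nhdsWithin_le_nhds
  have h3 : -C = 0 := by
    refine tendsto_nhds_unique (h2.congr' ?_) h1
    filter_upwards [self_mem_nhdsWithin] with t ht
    have ht : t - 1 ≠ 0 := sub_ne_zero.2 ht
    unfold Q; rw [F_eq]; field_simp; ring
  linarith

/-- Otherwise C = 0 and Q has a zero at 1, which (c) forbids in the interior. If 1 is an endpoint,
(e) makes the other endpoint x a critical point of Σ: impossible for x > 1, and for x < 1 it
produces another zero of Q in (x, 1). -/
theorem one_notMem_of_conditions {n : ℕ} (hn : 1 ≤ n) {A B C u v : ℝ} (huv : u < v)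
    (h : Conditions (Q n A B C) u v) : 1 ∉ Icc u v := by
  intro h1
  obtain rfl : C = 0 := eq_zero_of_continuousAt_Q hn (h.a 1 h1).continuousAt
  have hQ : ∀ t, Q n A B 0 t = (t - 1) * (A + B * E (n + 1) t) := by intro t; simp [Q]
  have hd : ∀ t, HasDerivAt (Q n A B 0)
      ((A + B * E (n + 1) t) + (t - 1) * (B * deriv (E (n + 1)) t)) t := by
    intro t
    have hE := (differentiable_E n t).hasDerivAt
    have := ((hasDerivAt_id t).sub_const 1).mul ((hE.const_mul B).const_add A)
    simp only [id, one_mul] at this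
    rw [funext hQ]
    exact this
  have hQ1 : Q n A B 0 1 = 0 := by rw [hQ]; ring
  have hd1 : deriv (Q n A B 0) 1 = A := by rw [(hd 1).deriv, E_one]; ring
  have key : ∀ x, x ≠ 1 → Q n A B 0 x = 0 → deriv (Q n A B 0) x = - A → A ≠ 0 → dSig n x = 0 := by
    intro x hx h0 hdx hA
    have hx1 := sub_ne_zero.2 hx
    rw [hQ] at h0
    have h0 := (mul_eq_zero.1 h0).resolve_left hx1
    rw [(hd x).deriv, h0, deriv_E] at hdx
    unfold E at h0
    have hB : B ≠ 0 := by
      rintro rfl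
      apply hA; linarith
    have : B * (x - 1) ^ 2 * dSig n x = 0 := by linear_combination hdx - h0
    rcases mul_eq_zero.1 this with h | h
    · exact absurd h (by positivity)
    · exact h
  rcases h1.1.eq_or_lt with rfl | hu1
  · have h2 := h.e.2
    have h3 := h.d.1.2
    rw [hd1] at h2 h3
    exact (dSig_pos hn (by linarith)).ne' (key v huv.ne' h.b.2 (by linarith) h3)
  rcases h1.2.eq_or_lt with rfl | hv1
  · have h2 := h.e.2
    have h3 := h.d.2.2
    rw [hd1] at h2 h3
    obtain ⟨t, ht, hEt⟩ := exists_E_eq_of_dSig_eq_zero hn (key u hu1.ne h.b.1 h2 h3)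
    refine h.c t ht (h.a t ⟨ht.1.le, ht.2.le⟩) ?_
    have h0 := h.b.1
    rw [hQ] at h0
    have h0 := (mul_eq_zero.1 h0).resolve_left (by linarith)
    rw [hQ, hEt, h0, mul_zero]
  · exact h.c 1 ⟨hu1, hv1⟩ (h.a 1 h1) hQ1

theorem ne_zero_of_conditions {n : ℕ} (hn : 1 ≤ n) {A B C t : ℝ} (h0 : Q n A B C t = 0)
    (h1 : deriv (Q n A B C) t ≠ 0) : t ≠ 0 := by
  rintro rfl
  apply h1
  rw [(hasDerivAt_Q n A B C (by norm_num)).deriv, deriv_E_zero hn, deriv_F_zero hn]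
  unfold Q at h0
  linarith

/-- Cramer's rule for the two equations in B and C given by (b) and (e); the trivial solution would
make Q'(u) = 0. -/
theorem Pi_eq_of_conditions {n : ℕ} {A B C u v : ℝ} (hu : u ≠ 1) (hv : v ≠ 1)
    (h : Conditions (Q n A B C) u v) : Pi (n + 1) u v - Pi (n + 1) v u = 0 := by
  have h1 := (mul_eq_zero.1 h.b.1).resolve_left (sub_ne_zero.2 hu)
  have h2 := (mul_eq_zero.1 h.b.2).resolve_left (sub_ne_zero.2 hv)
  have h3 := h.e.2
  have h4 := h.d.1.2
  rw [(hasDerivAt_Q n A B C hu).deriv, h1, zero_add] at h3 h4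
  rw [(hasDerivAt_Q n A B C hv).deriv, h2, zero_add] at h3
  have hB : B * (Pi (n + 1) u v - Pi (n + 1) v u) = 0 := by
    unfold Pi
    linear_combination (F (n + 1) v - F (n + 1) u) * h3
      - ((u - 1) * deriv (F (n + 1)) u + (v - 1) * deriv (F (n + 1)) v) * (h2 - h1)
  have hC : C * (Pi (n + 1) u v - Pi (n + 1) v u) = 0 := by
    unfold Pi
    linear_combination - (E (n + 1) v - E (n + 1) u) * h3
      + ((u - 1) * deriv (E (n + 1)) u + (v - 1) * deriv (E (n + 1)) v) * (h2 - h1)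
  by_contra hne
  have hB := (mul_eq_zero.1 hB).resolve_right hne
  have hC := (mul_eq_zero.1 hC).resolve_right hne
  apply h4
  rw [hB, hC]; ring

theorem cases_of_conditions {n : ℕ} (hn : 1 ≤ n) {A B C u v : ℝ} (huv : u < v)
    (h : Conditions (Q n A B C) u v) :
    (u * v = u + v ∧ (1 < u ∧ u < 2 ∨ u < 0 ∧ 0 < v ∧ v < 1)) ∨
      (Even n ∧ ev (T (n + 1)) u v = 0 ∧ u < 0 ∧ 0 < v ∧ v < 1) := by
  have h1 := one_notMem_of_conditions hn huv h
  have hu0 := ne_zero_of_conditions hn h.b.1 h.d.1.2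
  have hv0 := ne_zero_of_conditions hn h.b.2 h.d.2.2
  have hside : 1 < u ∨ v < 1 := by
    by_contra! h2; exact h1 h2
  have hu1 : u ≠ 1 := fun h => h1 (h ▸ ⟨le_rfl, huv.le⟩)
  have hv1 : v ≠ 1 := fun h => h1 (h ▸ ⟨huv.le, le_rfl⟩)
  have hPi := Pi_sub_eq n hu1 hv1
  rw [Pi_eq_of_conditions hu1 hv1 h, mul_zero] at hPi
  have hk : kap n * (n + 1) / 4 ^ (n + 1) ≠ 0 := by
    have := (kap_neg n).ne
    positivity
  have hor : u * v = u + v ∨ S n (u * v) (u * (v - 2)) (v * (u - 2)) = 0 := by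
    rcases mul_eq_zero.1 hPi.symm with h | h
    · left; linarith
    · right; exact (mul_eq_zero.1 h).resolve_left hk
  rcases hside with hside | hside
  · have hH := hor.resolve_right (S_ne_zero_of_one_lt hn hside huv)
    left
    refine ⟨hH, Or.inl ⟨hside, ?_⟩⟩
    by_contra! h2
    nlinarith
  · by_cases hs : 0 < u ∨ v < 0
    · exfalso
      have hH := hor.resolve_right (S_ne_zero_of_same_side hn hside huv hs)
      rcases hs with hs | hs <;> nlinarith
    · push Not at hs
      have hu : u < 0 := lt_of_le_of_ne hs.1 hu0
      have hv : 0 < v := lt_of_le_of_ne hs.2 (Ne.symm hv0)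
      rcases hor with hH | hS
      · exact Or.inl ⟨hH, Or.inr ⟨hu, hv, hside⟩⟩
      · right
        refine ⟨?_, (ev_T_eq_zero_iff n huv).2 hS, hu, hv, hside⟩
        by_contra hodd
        exact S_ne_zero_of_odd (Nat.not_even_iff_odd.1 hodd) hu hv hside hS

/-! ### Points of the curve on the hyperbola -/

theorem eq_star_of_hyperbola {u v : ℝ} (h : u * v = u + v) : u ≠ 1 ∧ v ≠ 1 ∧ v = star u ∧ u = star v := by
  have hu : u ≠ 1 := by rintro rfl; linarith
  have hv : v ≠ 1 := by rintro rfl; linarith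
  have hu1 := sub_ne_zero.2 hu
  have hv1 := sub_ne_zero.2 hv
  refine ⟨hu, hv, ?_, ?_⟩
  · unfold star; rw [eq_div_iff hu1]; linarith
  · unfold star; rw [eq_div_iff hv1]; linarith

theorem hyperbola_star {t : ℝ} (ht : t ≠ 1) : t * star t = t + star t := by
  have := sub_ne_zero.2 ht
  unfold star; field_simp; ring

/-- The function `(t - 1) (A + B G)` as an element of `V`. -/
theorem Q_eq_G (n : ℕ) (A B t : ℝ) : Q n A B (-B / 2) t = (t - 1) * (A + B * G (n + 1) t) := by
  unfold Q G; ring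

theorem hasDerivAt_G (n : ℕ) {t : ℝ} (ht : t ≠ 1) :
    HasDerivAt (G (n + 1)) (deriv (E (n + 1)) t - deriv (F (n + 1)) t / 2) t :=
  (differentiable_E n t).hasDerivAt.sub
    ((hasDerivAt_F n ht).differentiableAt.hasDerivAt.div_const 2)

theorem deriv_G (n : ℕ) {t : ℝ} (ht : t ≠ 1) :
    deriv (G (n + 1)) t = deriv (E (n + 1)) t - deriv (F (n + 1)) t / 2 := (hasDerivAt_G n ht).deriv

theorem continuousAt_G (n : ℕ) {t : ℝ} (ht : t ≠ 1) : ContinuousAt (G (n + 1)) t :=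
  (hasDerivAt_G n ht).continuousAt

theorem deriv_G_star (n : ℕ) {t : ℝ} (ht : t ≠ 1) :
    deriv (G (n + 1)) t = - deriv (G (n + 1)) (star t) / (t - 1) ^ 2 := by
  have h1 : HasDerivAt (G (n + 1) ∘ star) (deriv (G (n + 1)) (star t) * (-1 / (t - 1) ^ 2)) t :=
    ((hasDerivAt_G n (star_ne_one ht)).differentiableAt.hasDerivAt).comp t (hasDerivAt_star ht)
  have h2 : G (n + 1) ∘ star =ᶠ[nhds t] G (n + 1) := by
    filter_upwards [isOpen_ne.mem_nhds ht] with x hx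
    exact G_star n hx
  rw [(h1.congr_of_eventuallyEq h2.symm).deriv]
  ring

theorem G_zero (n : ℕ) : G (n + 1) 0 = E (n + 1) 0 := by
  unfold G; rw [F_zero]; ring

/-- The witness is Q = (t-1)(G - G(v)); invariance of G supplies both the second zero and (e). -/
theorem mem_curve_of_hyperbola {n : ℕ} {u v : ℝ} (hH : u * v = u + v) (huv : u < v)
    (h1 : 1 ∉ Icc u v) (hd : deriv (G (n + 1)) v ≠ 0)
    (hc : ∀ t ∈ Ioo u v, G (n + 1) t ≠ G (n + 1) v) : (u, v) ∈ curve (n + 1) := by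
  obtain ⟨hu1, hv1, hv, hu⟩ := eq_star_of_hyperbola hH
  have hu1' := sub_ne_zero.2 hu1
  have hv1' := sub_ne_zero.2 hv1
  right
  refine ⟨huv, Q n (-G (n + 1) v) 1 (-1 / 2), mem_V_iff.2 ⟨_, _, _, rfl⟩, ?_⟩
  have hGu : G (n + 1) u = G (n + 1) v := by rw [hu]; exact G_star n hv1
  have hQ : ∀ t, Q n (-G (n + 1) v) 1 (-1 / 2) t = (t - 1) * (-G (n + 1) v + 1 * G (n + 1) t) :=
    fun t => Q_eq_G n _ 1 t
  have hder : ∀ t, t ≠ 1 → G (n + 1) t = G (n + 1) v → HasDerivAt (Q n (-G (n + 1) v) 1 (-1 / 2))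
      ((t - 1) * deriv (G (n + 1)) t) t := by
    intro t ht hGt
    have hG := (hasDerivAt_G n ht).differentiableAt.hasDerivAt
    have h := ((hasDerivAt_id t).sub_const 1).mul ((hG.const_mul 1).const_add (-G (n + 1) v))
    rw [funext hQ]
    refine h.congr_deriv ?_
    simp only [id]
    rw [hGt]; ring
  have hdu := hder u hu1 hGu
  have hdv := hder v hv1 rfl
  have hrel : (u - 1) * deriv (G (n + 1)) u = -((v - 1) * deriv (G (n + 1)) v) := by
    rw [deriv_G_star n hu1, ← hv]
    field_simp
    have : (u - 1) * (v - 1) = 1 := by linarith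
    linarith
  have hnz : (v - 1) * deriv (G (n + 1)) v ≠ 0 := mul_ne_zero hv1' hd
  refine ⟨fun t ht => analyticAt_Q n _ _ _ (Or.inl fun h => h1 (h ▸ ht)), ⟨?_, ?_⟩, ?_, ?_, ?_⟩
  · rw [hQ, hGu]; ring
  · rw [hQ]; ring
  · intro t ht _
    rw [hQ]
    refine mul_ne_zero (sub_ne_zero.2 fun h => h1 (h ▸ ⟨ht.1.le, ht.2.le⟩)) ?_
    intro h; exact hc t ht (by linarith)
  · refine ⟨⟨hdu.differentiableAt, ?_⟩, hdv.differentiableAt, ?_⟩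
    · rw [hdu.deriv, hrel]; exact neg_ne_zero.2 hnz
    · rw [hdv.deriv]; exact hnz
  · exact ⟨⟨hdu.differentiableAt, hdv.differentiableAt⟩, by rw [hdu.deriv, hdv.deriv, hrel]⟩

/-- Since F(u) = -F(v) and E(v) - E(u) = F(v), condition (b) alone forces C = -B/2, that is Q =
(t-1)(A + BG). -/
theorem G_of_conditions_of_hyperbola {n : ℕ} {A B C u v : ℝ} (hH : u * v = u + v)
    (hv0 : 0 < v) (hv : v < 1) (h : Conditions (Q n A B C) u v) :
    deriv (G (n + 1)) v ≠ 0 ∧ ∀ t ∈ Ioo u v, G (n + 1) t ≠ G (n + 1) v := by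
  obtain ⟨hu1, hv1, hvu, huv⟩ := eq_star_of_hyperbola hH
  have h1 := (mul_eq_zero.1 h.b.1).resolve_left (sub_ne_zero.2 hu1)
  have h2 := (mul_eq_zero.1 h.b.2).resolve_left (sub_ne_zero.2 hv1)
  have hF := F_star n hv1
  have hE := E_star n hv1
  rw [← huv] at hF hE
  have hFv := F_ne_zero n hv0.ne' hv1 (by linarith)
  obtain rfl : C = -B / 2 := by
    apply mul_right_cancel₀ hFv
    rw [hF] at h1
    linear_combination (1 / 2) * (h2 - h1 - B * hE)
  have hG : A + B * G (n + 1) v = 0 := by unfold G; linear_combination h2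
  constructor
  · intro hd
    apply h.d.2.2
    rw [(hasDerivAt_Q n A B _ hv1).deriv, h2]
    rw [deriv_G n hv1] at hd
    linear_combination (v - 1) * B * hd
  · intro t ht hGt
    have ht1 : t ≠ 1 := by linarith [ht.2]
    refine h.c t ht (analyticAt_Q n A B _ (Or.inl ht1)) ?_
    rw [Q_eq_G, hGt, hG, mul_zero]

theorem star_lt_star {a b : ℝ} (hab : a < b) (h : b < 1 ∨ 1 < a) : star b < star a := by
  have ha : a ≠ 1 := by rcases h with h | h <;> linarith
  have hb : b ≠ 1 := by rcases h with h | h <;> linarith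
  have h1 : star b - 1 < star a - 1 := by
    rw [star_sub_one ha, star_sub_one hb]
    rcases h with h | h
    · exact one_div_lt_one_div_of_neg_of_lt (by linarith) (by linarith)
    · exact one_div_lt_one_div_of_lt (by linarith) (by linarith)
  linarith

theorem star_zero : star 0 = 0 := by simp [star]

theorem star_two : star 2 = 2 := by norm_num [star]

theorem star_neg {t : ℝ} (h0 : 0 < t) (h1 : t < 1) : star t < 0 := by
  have := star_lt_star h0 (Or.inl h1); rwa [star_zero] at this

theorem star_pos_of_neg {t : ℝ} (h0 : t < 0) : 0 < star t := by
  have := star_lt_star h0 (Or.inl one_pos); rwa [star_zero] at this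

theorem star_lt_one {t : ℝ} (h : t < 1) : star t < 1 := by
  have := star_sub_one h.ne
  have h2 : 1 / (t - 1) < 0 := one_div_neg.2 (by linarith)
  linarith

theorem one_lt_star {t : ℝ} (h : 1 < t) : 1 < star t := by
  have := star_sub_one h.ne'
  have h2 : 0 < 1 / (t - 1) := one_div_pos.2 (by linarith)
  linarith

theorem coef_nonneg (n i : ℕ) : 0 ≤ coef n i := by unfold coef; positivity

/-- Because (t-1)F'(t) is invariant under t ↦ t*, 2(t-1)G'(t) is the difference of (x-1)E'(x) =
(x-1)Σ(x) + (x-1)²Σ'(x) between x = t and x = t*; this expression increases for x > 1, and t* < t.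
-/
theorem deriv_G_pos_of_two_lt {n : ℕ} (hn : 1 ≤ n) {t : ℝ} (ht : 2 < t) :
    0 < deriv (G (n + 1)) t := by
  have ht1 : t ≠ 1 := by linarith
  have h1 : 1 < star t := one_lt_star (by linarith)
  have h2 : star t < t := by
    have := star_lt_star ht (Or.inr (by norm_num)); rw [star_two] at this; linarith
  have hS : Sig (n + 1) (star t) ≤ Sig (n + 1) t := by
    rw [Sig_eq, Sig_eq]
    exact Finset.sum_le_sum fun i _ => mul_le_mul_of_nonneg_left
      (pow_le_pow_left₀ (by linarith) h2.le i) (coef_nonneg n i)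
  have hd : dSig n (star t) ≤ dSig n t := by
    unfold dSig
    exact Finset.sum_le_sum fun i _ => mul_le_mul_of_nonneg_left
      (mul_le_mul_of_nonneg_left (pow_le_pow_left₀ (by linarith) h2.le _) (by positivity))
      (coef_nonneg n i)
  have hd0 : 0 < dSig n (star t) := dSig_pos hn (by linarith)
  have hS0 : 0 ≤ Sig (n + 1) (star t) := by
    rw [Sig_eq]
    exact Finset.sum_nonneg fun i _ => mul_nonneg (coef_nonneg n i) (pow_nonneg (by linarith) i)
  have hlt : (star t - 1) * deriv (E (n + 1)) (star t) < (t - 1) * deriv (E (n + 1)) t := by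
    rw [deriv_E, deriv_E]
    have e1 : (star t - 1) * Sig (n + 1) (star t) ≤ (t - 1) * Sig (n + 1) t :=
      mul_le_mul (by linarith) hS hS0 (by linarith)
    have e2 : (star t - 1) ^ 2 * dSig n (star t) < (t - 1) ^ 2 * dSig n t :=
      mul_lt_mul (pow_lt_pow_left₀ (by linarith) (by linarith) two_ne_zero) hd hd0 (by positivity)
    linarith
  have hG := deriv_G n ht1
  have hGs := deriv_G n (star_ne_one ht1)
  have hrel := deriv_G_star n ht1
  have f1 := F_ode n ht1
  have f2 := F_ode n (star_ne_one ht1)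
  rw [F_star n ht1, lam_star n ht1, star_sub_one ht1, star_sub_two ht1] at f2
  have ht1' := sub_ne_zero.2 ht1
  have f3 : (star t - 1) * deriv (F (n + 1)) (star t) = (t - 1) * deriv (F (n + 1)) t := by
    have ht0 : t ≠ 0 := by linarith
    have ht2 : t - 2 ≠ 0 := by linarith
    rw [star_sub_one ht1]
    unfold star at f2 ⊢
    field_simp at f2 ⊢
    have : t * (t - 2) * (deriv (F (n + 1)) (t / (t - 1)) - (t - 1) ^ 2 * deriv (F (n + 1)) t) = 0 := by
      linear_combination - f2 - (t - 1) * f1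
    have := (mul_eq_zero.1 this).resolve_left (mul_ne_zero ht0 ht2)
    linarith
  have h3 : (t - 1) * deriv (G (n + 1)) t = -((star t - 1) * deriv (G (n + 1)) (star t)) := by
    rw [hrel, star_sub_one ht1]; field_simp
  rw [hGs] at h3
  have h4 : 2 * ((t - 1) * deriv (G (n + 1)) t)
      = (t - 1) * deriv (E (n + 1)) t - (star t - 1) * deriv (E (n + 1)) (star t) := by
    linear_combination h3 + (t - 1) * hG + f3 / 2
  have h5 : 0 < (t - 1) * deriv (G (n + 1)) t := by linarith
  exact pos_of_mul_pos_right h5 (by linarith)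

/-- The involution carries (u, a) into (a, v) and preserves G, so half of the interval suffices. -/
theorem G_ne_of_mem_Ioo {n : ℕ} {u v a : ℝ} (ha : star a = a) (hH : v = star u)
    (hside : a < 1 ∧ v < 1 ∨ 1 < u) (h : ∀ t ∈ Ico a v, G (n + 1) t ≠ G (n + 1) v) :
    ∀ t ∈ Ioo u v, G (n + 1) t ≠ G (n + 1) v := by
  intro t ht
  rcases le_or_gt a t with hta | hta
  · exact h t ⟨hta, ht.2⟩
  · have ht1 : t ≠ 1 := by rcases hside with hs | hs <;> [linarith [ht.2]; linarith [ht.1]]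
    rw [← G_star n ht1]
    refine h (star t) ⟨?_, ?_⟩
    · have := star_lt_star hta (hside.imp And.left ht.1.trans')
      rw [ha] at this; exact this.le
    · rw [hH]
      exact star_lt_star ht.1 (hside.imp_left fun h => ht.2.trans h.2)

theorem setI_subset_curve {n : ℕ} (hn : 1 ≤ n) {u v : ℝ} (hH : u * v = u + v) (h1 : 1 < u)
    (h2 : u < 2) : (u, v) ∈ curve (n + 1) := by
  obtain ⟨hu1, hv1, hv, hu⟩ := eq_star_of_hyperbola hH
  have hv2 : 2 < v := by
    have := star_lt_star h2 (Or.inr h1); rwa [star_two, ← hv] at this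
  have hmono : StrictMonoOn (G (n + 1)) (Ici 2) := by
    refine strictMonoOn_of_deriv_pos (convex_Ici _) (fun x hx => ?_) ?_
    · have hx : 2 ≤ x := hx
      exact (continuousAt_G n (by linarith)).continuousWithinAt
    · rw [interior_Ici]; exact fun x hx => deriv_G_pos_of_two_lt hn hx
  refine mem_curve_of_hyperbola hH (by linarith) (fun h => by linarith [h.1])
    (deriv_G_pos_of_two_lt hn hv2).ne' (G_ne_of_mem_Ioo (a := 2) star_two hv
      (Or.inr h1) fun t ht => (hmono ht.1 hv2.le ht.2).ne)

theorem mem_curve_of_neg {n : ℕ} {u v : ℝ} (hH : u * v = u + v) (hu0 : u < 0)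
    (hd : deriv (G (n + 1)) v ≠ 0) (h : ∀ t ∈ Ico 0 v, G (n + 1) t ≠ G (n + 1) v) :
    (u, v) ∈ curve (n + 1) := by
  obtain ⟨hu1, hv1, hv, hu⟩ := eq_star_of_hyperbola hH
  have hv0 : 0 < v := hv ▸ star_pos_of_neg hu0
  have hv1 : v < 1 := hv ▸ star_lt_one (by linarith)
  exact mem_curve_of_hyperbola hH (by linarith) (fun h => by linarith [h.2]) hd
    (G_ne_of_mem_Ioo star_zero hv (Or.inl ⟨one_pos, hv1⟩) h)

theorem deriv_G_pos_of_odd {n : ℕ} (hn : Odd n) {t : ℝ} (h0 : 0 < t) (h1 : t < 1) :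
    0 < deriv (G (n + 1)) t := by
  rw [deriv_G n h1.ne, deriv_F n h1.ne]
  have h2 := deriv_E_pos hn.pos h0
  have h3 : t ^ (2 * n) * lam n t / (t - 1) ^ (n + 2) < 0 := by
    refine div_neg_of_pos_of_neg (mul_pos (by positivity) (lam_pos n t)) ?_
    exact (hn.add_even even_two).pow_neg (by linarith)
  linarith

theorem mem_curve_of_odd {n : ℕ} (hn : Odd n) {u v : ℝ} (hH : u * v = u + v) (hu : u < 0) :
    (u, v) ∈ curve (n + 1) := by
  obtain ⟨hu1, hv1, hv, -⟩ := eq_star_of_hyperbola hH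
  have hv0 : 0 < v := hv ▸ star_pos_of_neg hu
  have hv1 : v < 1 := hv ▸ star_lt_one (by linarith)
  have hmono : StrictMonoOn (G (n + 1)) (Ico 0 1) := by
    refine strictMonoOn_of_deriv_pos (convex_Ico _ _) (fun x hx => ?_) ?_
    · exact (continuousAt_G n hx.2.ne).continuousWithinAt
    · rw [interior_Ico]; exact fun x hx => deriv_G_pos_of_odd hn hx.1 hx.2
  exact mem_curve_of_neg hH hu (deriv_G_pos_of_odd hn hv0 hv1).ne'
    fun t ht => (hmono ⟨ht.1, ht.2.trans hv1⟩ ⟨hv0.le, hv1⟩ ht.2).ne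

/-! ### Shape of G on (0, 1) for even n -/

theorem F_pos_of_even {n : ℕ} (hn : Even n) {t : ℝ} (h0 : 0 < t) (h1 : t < 1) : 0 < F (n + 1) t := by
  rw [F_eq]
  refine div_pos_of_neg_of_neg (mul_neg_of_neg_of_pos (by linarith) (by positivity)) ?_
  exact hn.add_one.pow_neg (by linarith)

theorem deriv_F_pos_of_even {n : ℕ} (hn : Even n) {t : ℝ} (h0 : 0 < t) (h1 : t < 1) :
    0 < deriv (F (n + 1)) t := by
  rw [deriv_F n h1.ne]
  refine div_pos (mul_pos (by positivity) (lam_pos n t)) ?_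
  exact (hn.add even_two).pow_pos (by linarith)

/-- With K this ratio, G - E(0) = F·(K - 1/2), so G crosses the level E(0) at most once on (0, 1).
-/
theorem strictAntiOn_ratio {n : ℕ} (hn : Even n) :
    StrictAntiOn (fun t => (-E (n + 1) 0 + 1 * E (n + 1) t) / F (n + 1) t) (Ioo 0 1) := by
  have hd : ∀ t ∈ Ioo (0 : ℝ) 1, HasDerivAt (fun t => (-E (n + 1) 0 + 1 * E (n + 1) t) / F (n + 1) t)
      ((1 * kap n * (t - 1) - -E (n + 1) 0 * lam n t) * (t - 1) ^ n / (t ^ (2 * n + 2) * (t - 2) ^ 2)) t :=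
    fun t ht => hasDerivAt_ratio n _ 1 ht.1.ne' ht.2.ne (by linarith [ht.2])
  refine strictAntiOn_of_deriv_neg (convex_Ioo _ _) (fun x hx => (hd x hx).continuousAt.continuousWithinAt) ?_
  rw [interior_Ioo]
  intro t ht
  obtain ⟨h0, h1⟩ := ht
  rw [(hd t ⟨h0, h1⟩).deriv]
  -- Since `kap` = 2(2n+1)E(0), the lower-order terms of `lam` cancel.
  have h2 : 1 * kap n * (t - 1) - -E (n + 1) 0 * lam n t = E (n + 1) 0 * ((n + 1) * t ^ 2) := by
    unfold kap lam; ring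
  rw [h2]
  have h3 : 0 < (t - 2) ^ 2 := by have : t - 2 ≠ 0 := by linarith
                                  positivity
  have h4 : 0 < (t - 1) ^ n := hn.pow_pos (by linarith)
  exact div_neg_of_neg_of_pos (mul_neg_of_neg_of_pos
    (mul_neg_of_neg_of_pos (E_zero_neg n) (by positivity)) h4) (by positivity)

/-- Near 0, E - E(0) is at least (c₁ - c₂)t² with c₁ > c₂, while F vanishes to order 2n + 1. -/
theorem exists_E_sub_gt {n : ℕ} (hn2 : 2 ≤ n) :
    ∃ t ∈ Ioo (0 : ℝ) 1, F (n + 1) t / 2 < E (n + 1) t - E (n + 1) 0 := by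
  set c := coef n 1 - coef n 2 with hc
  have hc0 : 0 < c := by have := coef_two_lt hn2; linarith
  have hcont : ContinuousAt (fun t : ℝ => (t - 2) * t ^ (2 * n - 1) / (t - 1) ^ (n + 1)) 0 := by
    refine ContinuousAt.div (by fun_prop) (by fun_prop) ?_
    exact pow_ne_zero _ (by norm_num)
  have h0 : (fun t : ℝ => (t - 2) * t ^ (2 * n - 1) / (t - 1) ^ (n + 1)) 0 = 0 := by
    simp [zero_pow (by omega : 2 * n - 1 ≠ 0)]
  have hev := hcont.eventually_lt_const (by rw [h0]; exact hc0)
  have hev2 : ∀ᶠ t in nhdsWithin (0 : ℝ) (Ioi 0), t ∈ Ioo (0 : ℝ) 1 := Ioo_mem_nhdsGT one_pos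
  obtain ⟨t, ht1, ht2⟩ := ((hev.filter_mono nhdsWithin_le_nhds).and hev2).exists
  refine ⟨t, ht2, ?_⟩
  have ht0 := ht2.1
  have hF : F (n + 1) t = t ^ 2 * ((t - 2) * t ^ (2 * n - 1) / (t - 1) ^ (n + 1)) := by
    rw [F_eq, show 2 * n + 1 = 2 + (2 * n - 1) by omega, pow_add]; ring
  have h1 := mul_lt_mul_of_pos_left ht1 (by positivity : 0 < t ^ 2)
  rw [← hF] at h1
  rw [E_zero, E_eq_sum]
  have h2 := Finset.single_le_sum (f := fun i => (coef n i - coef n (i + 1)) * t ^ (i + 1))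
    (s := Finset.range n) (fun i hi => by
      have := coef_anti (n := n) (i := i) (Finset.mem_range.1 hi)
      have : 0 ≤ coef n i - coef n (i + 1) := by linarith
      positivity) (Finset.mem_range.2 (by omega : 1 < n))
  norm_num at h2
  have h3 : 0 < t ^ (n + 1) := by positivity
  have h4 : 0 < t ^ 2 * c := by positivity
  rw [hc] at h1 h4
  linarith

theorem exists_zero_level {n : ℕ} (hn : Even n) (hn2 : 2 ≤ n) : ∃ z₁ ∈ Ioo (0 : ℝ) 1,
    (∀ t ∈ Ioo 0 z₁, E (n + 1) 0 < G (n + 1) t) ∧ G (n + 1) z₁ = E (n + 1) 0 ∧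
    ∀ t ∈ Ioo z₁ 1, G (n + 1) t < E (n + 1) 0 := by
  set K : ℝ → ℝ := fun t => (-E (n + 1) 0 + 1 * E (n + 1) t) / F (n + 1) t with hK
  have hanti : StrictAntiOn K (Ioo 0 1) := strictAntiOn_ratio hn
  have hKc : ContinuousOn K (Ioo 0 1) := fun t ht =>
    (hasDerivAt_ratio n _ 1 ht.1.ne' ht.2.ne (by linarith [ht.2])).continuousAt.continuousWithinAt
  have hG : ∀ t ∈ Ioo (0 : ℝ) 1, G (n + 1) t - E (n + 1) 0 = F (n + 1) t * (K t - 1 / 2) := by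
    intro t ht
    have := (F_pos_of_even hn ht.1 ht.2).ne'
    simp only [hK, G]; field_simp; ring
  obtain ⟨a, ha, hKa⟩ := exists_E_sub_gt hn2
  have hKa' : 1 / 2 < K a := by
    simp only [hK]; rw [lt_div_iff₀ (F_pos_of_even hn ha.1 ha.2)]; linarith
  -- The pole of F makes K tend to 0 at 1.
  obtain ⟨b, hb, hKb⟩ : ∃ b ∈ Ioo (0 : ℝ) 1, K b < 1 / 2 := by
    have hE := continuous_E n
    have hcont : ContinuousAt (fun t : ℝ => (-E (n + 1) 0 + 1 * E (n + 1) t) * (t - 1) ^ (n + 1)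
        / ((t - 2) * t ^ (2 * n + 1))) 1 := by
      refine ContinuousAt.div (by fun_prop) (by fun_prop) (by norm_num)
    have hev := hcont.eventually_lt_const (u := 1 / 2) (by norm_num)
    have hev2 : ∀ᶠ t in nhdsWithin (1 : ℝ) (Iio 1), t ∈ Ioo (0 : ℝ) 1 := Ioo_mem_nhdsLT one_pos
    obtain ⟨t, ht1, ht2⟩ := ((hev.filter_mono nhdsWithin_le_nhds).and hev2).exists
    refine ⟨t, ht2, ?_⟩
    simp only [hK]; rw [F_eq, div_div_eq_mul_div]; exact ht1
  obtain ⟨c, hc, hKc⟩ := isPreconnected_Ioo.intermediate_value hb ha hKc ⟨hKb.le, hKa'.le⟩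
  refine ⟨c, hc, fun t ht => ?_, ?_, fun t ht => ?_⟩
  · have ht' : t ∈ Ioo (0 : ℝ) 1 := ⟨ht.1, ht.2.trans hc.2⟩
    have h1 := hanti ht' hc ht.2
    rw [hKc] at h1
    have := mul_pos (F_pos_of_even hn ht'.1 ht'.2) (sub_pos.2 h1)
    have := hG t ht'
    linarith
  · have := hG c hc
    rw [hKc, sub_self, mul_zero] at this
    linarith
  · have ht' : t ∈ Ioo (0 : ℝ) 1 := ⟨hc.1.trans ht.1, ht.2⟩
    have h1 := hanti hc ht' ht.1
    rw [hKc] at h1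
    have := mul_neg_of_pos_of_neg (F_pos_of_even hn ht'.1 ht'.2) (sub_neg.2 h1)
    have := hG t ht'
    linarith

/-- The slope `E' / F'`. -/
def slope (n : ℕ) (t : ℝ) : ℝ :=
  (0 + 1 * E (n + 1) t) / F (n + 1) t + kap n * ((t - 1) ^ (n + 2) / (lam n t * ((t - 2) * t ^ (2 * n + 1))))

/-- The derivative has one sign on (0, 1); as G' = F'·(slope - 1/2), for even n G' changes sign at
most once there. -/
theorem hasDerivAt_slope (n : ℕ) {t : ℝ} (h0 : t ≠ 0) (h1 : t ≠ 1) (h2 : t ≠ 2) :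
    HasDerivAt (slope n) (-kap n * (n + 1) * (t - 1) ^ (n + 1) / (lam n t ^ 2 * t ^ (2 * n))) t := by
  have h1' := sub_ne_zero.2 h1
  have h2' := sub_ne_zero.2 h2
  have hl := (lam_pos n t).ne'
  have e1 := hasDerivAt_ratio n 0 1 h0 h1 h2
  have e2 : HasDerivAt (fun t : ℝ => (t - 1) ^ (n + 2)) (((n + 2 : ℕ) : ℝ) * (t - 1) ^ (n + 1) * 1) t :=
    ((hasDerivAt_id t).sub_const 1).pow (n + 2)
  have e3 : HasDerivAt (lam n) ((n + 1) * (((2 : ℕ) : ℝ) * t ^ (2 - 1)) - 2 * (2 * n + 1) * 1) t :=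
    (((hasDerivAt_pow 2 t).const_mul _).sub ((hasDerivAt_id t).const_mul _)).add_const _
  have e4 : HasDerivAt (fun t : ℝ => (t - 2) * t ^ (2 * n + 1))
      (1 * t ^ (2 * n + 1) + (t - 2) * (((2 * n + 1 : ℕ) : ℝ) * t ^ (2 * n))) t :=
    ((hasDerivAt_id t).sub_const 2).mul (hasDerivAt_pow (2 * n + 1) t)
  have e5 := e1.add ((e2.fun_div (e3.mul e4) (mul_ne_zero hl (mul_ne_zero h2' (pow_ne_zero _ h0)))).const_mul (kap n))
  refine e5.congr_deriv ?_
  simp only [Pi.mul_apply]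
  field_simp
  unfold lam
  push_cast
  ring

theorem deriv_E_eq_slope (n : ℕ) {t : ℝ} (h0 : t ≠ 0) (h1 : t ≠ 1) (h2 : t ≠ 2) :
    deriv (E (n + 1)) t = deriv (F (n + 1)) t * slope n t := by
  have h1' := sub_ne_zero.2 h1
  have h2' := sub_ne_zero.2 h2
  have hl := (lam_pos n t).ne'
  apply mul_left_cancel₀ (mul_ne_zero (mul_ne_zero h0 h1') h2')
  rw [← mul_assoc, F_ode n h1, E_ode]
  unfold slope
  rw [F_eq]
  field_simp
  ring

theorem strictAntiOn_slope {n : ℕ} (hn : Even n) : StrictAntiOn (slope n) (Ioo 0 1) := by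
  refine strictAntiOn_of_deriv_neg (convex_Ioo _ _) (fun t ht =>
    (hasDerivAt_slope n ht.1.ne' ht.2.ne (by linarith [ht.2])).continuousAt.continuousWithinAt) ?_
  rw [interior_Ioo]
  intro t ht
  rw [(hasDerivAt_slope n ht.1.ne' ht.2.ne (by linarith [ht.2])).deriv]
  have h1 := kap_neg n
  have h2 := lam_pos n t
  have h3 := ht.1
  have h4 : (t - 1) ^ (n + 1) < 0 := hn.add_one.pow_neg (by linarith [ht.2])
  refine div_neg_of_neg_of_pos (mul_neg_of_pos_of_neg ?_ h4) (by positivity)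
  exact mul_pos (by linarith) (by positivity)

theorem exists_shape {n : ℕ} (hn : Even n) (hn2 : 2 ≤ n) : ∃ w₁ z₁ : ℝ, 0 < w₁ ∧ w₁ < z₁ ∧ z₁ < 1 ∧
    (∀ t ∈ Ioo 0 w₁, 0 < deriv (G (n + 1)) t) ∧ deriv (G (n + 1)) w₁ = 0 ∧
    (∀ t ∈ Ioo w₁ 1, deriv (G (n + 1)) t < 0) ∧
    (∀ t ∈ Ioo 0 z₁, E (n + 1) 0 < G (n + 1) t) ∧ G (n + 1) z₁ = E (n + 1) 0 ∧
    ∀ t ∈ Ioo z₁ 1, G (n + 1) t < E (n + 1) 0 := by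
  obtain ⟨z₁, hz, h1, h2, h3⟩ := exists_zero_level hn hn2
  -- Rolle's theorem, as G(0) = E(0) = G(z₁); this also yields w₁ < z₁.
  obtain ⟨w₁, hw, hw0⟩ := exists_deriv_eq_zero hz.1 (f := G (n + 1))
    (fun t ht => (continuousAt_G n (by linarith [ht.2, hz.2])).continuousWithinAt)
    (by rw [h2, G_zero])
  have hw' : w₁ ∈ Ioo (0 : ℝ) 1 := ⟨hw.1, hw.2.trans hz.2⟩
  have hG : ∀ t ∈ Ioo (0 : ℝ) 1, deriv (G (n + 1)) t = deriv (F (n + 1)) t * (slope n t - 1 / 2) := by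
    intro t ht
    rw [deriv_G n ht.2.ne, deriv_E_eq_slope n ht.1.ne' ht.2.ne (by linarith [ht.2])]; ring
  have hanti := strictAntiOn_slope hn
  have hsw : slope n w₁ = 1 / 2 := by
    have := hG w₁ hw'
    rw [hw0] at this
    have := (mul_eq_zero.1 this.symm).resolve_left (deriv_F_pos_of_even hn hw'.1 hw'.2).ne'
    linarith
  refine ⟨w₁, z₁, hw.1, hw.2, hz.2, fun t ht => ?_, hw0, fun t ht => ?_, h1, h2, h3⟩
  · have ht' : t ∈ Ioo (0 : ℝ) 1 := ⟨ht.1, ht.2.trans hw'.2⟩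
    rw [hG t ht']
    have := hanti ht' hw' ht.2
    exact mul_pos (deriv_F_pos_of_even hn ht'.1 ht'.2) (by linarith)
  · have ht' : t ∈ Ioo (0 : ℝ) 1 := ⟨hw'.1.trans ht.1, ht.2⟩
    rw [hG t ht']
    have := hanti hw' ht' ht.1
    exact mul_neg_of_pos_of_neg (deriv_F_pos_of_even hn ht'.1 ht'.2) (by linarith)

/-! ### Points of the curve on the zero set of T -/

theorem one_add_bet_mul_E_zero (n : ℕ) (u v : ℝ) :
    (2 * n + 1) * (1 + bet n u v * E (n + 1) 0) = (n + 1) * (u * v) / (u + v - 2) := by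
  have h := bet_mul_kap n u v
  unfold kap at h
  linear_combination (1 / 2) * h

theorem bet_relation_of_ev_T {n : ℕ} {u v : ℝ} (huv : u < v) (hv : v < 1)
    (hT : ev (T (n + 1)) u v = 0) :
    (1 + bet n u v * E (n + 1) u) * F (n + 1) v = (1 + bet n u v * E (n + 1) v) * F (n + 1) u := by
  have hS := (ev_T_eq_zero_iff n huv).1 hT
  have hu1 : u ≠ 1 := by linarith
  have hJ := J_eq (n := n) hu1 hv.ne
  rw [hS, mul_zero] at hJ
  have hJ := (mul_eq_zero.1 hJ).resolve_left
    (mul_ne_zero (pow_ne_zero _ (sub_ne_zero.2 hu1)) (pow_ne_zero _ (sub_ne_zero.2 hv.ne)))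
  have hs : u + v - 2 ≠ 0 := by linarith
  rw [bet_J hs] at hJ
  exact sub_eq_zero.1 ((mul_eq_zero.1 hJ).resolve_left (mul_ne_zero (kap_neg n).ne hs))

/-- T = 0 says that (1 + βE)/F agrees at u and v, so one C makes Q = (t-1)(1 + βE + CF) vanish at
both. The choice of β gives (e), and monotonicity of (1 + βE)/F on each side of 0 gives (c). -/
theorem mem_curve_of_ev_T {n : ℕ} {u v : ℝ} (hu : u < 0) (hv0 : 0 < v) (hv : v < 1)
    (hT : ev (T (n + 1)) u v = 0) : (u, v) ∈ curve (n + 1) := by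
  have huv : u < v := hu.trans hv0
  have hrel := bet_relation_of_ev_T huv hv hT
  have hu1 : u ≠ 1 := by linarith
  have hFu := F_ne_zero n hu.ne hu1 (by linarith)
  have hFv := F_ne_zero n hv0.ne' hv.ne (by linarith)
  have hs : u + v - 2 ≠ 0 := by linarith
  set β := bet n u v with hβ
  set C := -(1 + β * E (n + 1) u) / F (n + 1) u with hC
  have hquad := quadratic_identity n hu.ne hv0.ne' hs
  rw [← bet_mul_kap, ← hβ] at hquad
  have hqu : 1 + β * E (n + 1) u + C * F (n + 1) u = 0 := by rw [hC]; field_simp; ring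
  have hqv : 1 + β * E (n + 1) v + C * F (n + 1) v = 0 := by
    rw [hC]; field_simp; linear_combination -hrel
  have hder : ∀ t, t ≠ 0 → t ≠ 1 → t ≠ 2 → 1 + β * E (n + 1) t + C * F (n + 1) t = 0 →
      t * (t - 2) * deriv (Q n 1 β C) t = -(n + 1) * (u * v) / (2 * (u + v - 2))
        * ((t - 2) ^ 2 - (u - 2) * (v - 2) / (u * v) * t ^ 2) := by
    intro t h0 h1 h2 hq
    rw [(hasDerivAt_Q n 1 β C h1).deriv, hq, ← hquad]
    linear_combination β * E_ode n t + C * F_ode n h1 + lam n t * hq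
  have hdu : deriv (Q n 1 β C) u = -((n + 1) * (u - v) / (u + v - 2)) := by
    have h2 : u - 2 ≠ 0 := by linarith
    apply mul_left_cancel₀ (mul_ne_zero hu.ne h2)
    rw [hder u hu.ne hu1 (by linarith) hqu]
    field_simp
    ring
  have hdv : deriv (Q n 1 β C) v = (n + 1) * (u - v) / (u + v - 2) := by
    have h2 : v - 2 ≠ 0 := by linarith
    have h3 := hu.ne
    apply mul_left_cancel₀ (mul_ne_zero hv0.ne' h2)
    rw [hder v hv0.ne' hv.ne (by linarith) hqv]
    field_simp
    ring
  have hd0 : (n + 1) * (u - v) / (u + v - 2) ≠ 0 := by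
    have : u - v ≠ 0 := by linarith
    positivity
  -- By Rolle, equality would give a zero of (t-2)² - ρt², impossible as uv < 0 makes ρ negative.
  have hratio : ∀ a b : ℝ, a < b → b < 1 → (b < 0 ∨ 0 < a) →
      (1 + β * E (n + 1) a) / F (n + 1) a ≠ (1 + β * E (n + 1) b) / F (n + 1) b := by
    intro a b hab hb hs0 heq
    have hne : ∀ t ∈ Icc a b, t ≠ 0 ∧ t ≠ 1 ∧ t ≠ 2 := by
      intro t ht
      refine ⟨?_, by linarith [ht.2], by linarith [ht.2]⟩
      rcases hs0 with h | h
      · linarith [ht.2]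
      · linarith [ht.1]
    have hd : ∀ t ∈ Icc a b, HasDerivAt (fun t => (1 + β * E (n + 1) t) / F (n + 1) t)
        ((β * kap n * (t - 1) - 1 * lam n t) * (t - 1) ^ n / (t ^ (2 * n + 2) * (t - 2) ^ 2)) t :=
      fun t ht => hasDerivAt_ratio n 1 β (hne t ht).1 (hne t ht).2.1 (hne t ht).2.2
    obtain ⟨t, ht, ht0⟩ := exists_hasDerivAt_eq_zero hab
      (fun t ht => (hd t ht).continuousAt.continuousWithinAt) heq
      (fun t ht => hd t ⟨ht.1.le, ht.2.le⟩)
    obtain ⟨n0, n1, n2⟩ := hne t ⟨ht.1.le, ht.2.le⟩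
    have n1' := sub_ne_zero.2 n1
    have n2' := sub_ne_zero.2 n2
    have h1 : β * kap n * (t - 1) - 1 * lam n t ≠ 0 := by
      rw [one_mul, hquad]
      have hρ : (u - 2) * (v - 2) / (u * v) < 0 :=
        div_neg_of_pos_of_neg (by nlinarith) (mul_neg_of_neg_of_pos hu hv0)
      have h3 : 0 < (t - 2) ^ 2 := by positivity
      have h4 : 0 < (t - 2) ^ 2 - (u - 2) * (v - 2) / (u * v) * t ^ 2 := by
        nlinarith [sq_nonneg t, mul_nonneg_of_nonpos_of_nonpos hρ.le (by linarith [sq_nonneg t] : -t ^ 2 ≤ 0)]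
      have h5 : -((n : ℝ) + 1) ≠ 0 := by
        have : (0 : ℝ) < n + 1 := by positivity
        linarith
      have h6 := hv0.ne'
      have h7 := hu.ne
      positivity
    have : (β * kap n * (t - 1) - 1 * lam n t) * (t - 1) ^ n / (t ^ (2 * n + 2) * (t - 2) ^ 2) ≠ 0 := by
      have h8 : t ^ (2 * n + 2) ≠ 0 := pow_ne_zero _ n0
      positivity
    exact this ht0
  have hFC : ∀ t, t ≠ 0 → t ≠ 1 → t ≠ 2 → 1 + β * E (n + 1) t + C * F (n + 1) t = 0 →
      (1 + β * E (n + 1) t) / F (n + 1) t = -C := by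
    intro t h0 h1 h2 hq
    rw [div_eq_iff (F_ne_zero n h0 h1 h2)]; linarith
  right
  refine ⟨huv, Q n 1 β C, mem_V_iff.2 ⟨_, _, _, rfl⟩, ?_⟩
  have hda : ∀ t, t ≠ 1 → DifferentiableAt ℝ (Q n 1 β C) t :=
    fun t ht => (hasDerivAt_Q n 1 β C ht).differentiableAt
  refine ⟨fun t ht => analyticAt_Q n _ _ _ (Or.inl (by linarith [ht.2])), ⟨?_, ?_⟩, ?_, ?_, ?_⟩
  · simp only [Q]; rw [hqu, mul_zero]
  · simp only [Q]; rw [hqv, mul_zero]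
  · intro t ht _ h0
    have ht1 : t ≠ 1 := by linarith [ht.2]
    have hq := (mul_eq_zero.1 h0).resolve_left (sub_ne_zero.2 ht1)
    rcases lt_trichotomy t 0 with h | rfl | h
    · exact hratio u t ht.1 (by linarith) (Or.inl h)
        ((hFC u hu.ne hu1 (by linarith) hqu).trans (hFC t h.ne ht1 (by linarith) hq).symm)
    -- The ratio is unavailable at 0, where F = 0; but 1 + βE(0) is a nonzero multiple of uv/(u + v
    -- - 2).
    · rw [F_zero, mul_zero, add_zero] at hq
      have := one_add_bet_mul_E_zero n u v
      rw [← hβ, hq, mul_zero] at this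
      have h3 : (n + 1) * (u * v) / (u + v - 2) ≠ 0 := by
        have := hu.ne
        have := hv0.ne'
        positivity
      exact h3 this.symm
    · exact hratio t v ht.2 hv (Or.inr h)
        ((hFC t h.ne' ht1 (by linarith [ht.2]) hq).trans (hFC v hv0.ne' hv.ne (by linarith) hqv).symm)
  · exact ⟨⟨hda u hu1, by rw [hdu]; exact neg_ne_zero.2 hd0⟩, hda v hv.ne, by rw [hdv]; exact hd0⟩
  · exact ⟨⟨hda u hu1, hda v hv.ne⟩, by rw [hdu, hdv]⟩

/-- At such a point 1 + βG(v) = 0, whereas β > 0 and 1 + βE(0) > 0. This places the crossing of the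
two beams beyond z. -/
theorem G_lt_of_ev_T_of_hyperbola {n : ℕ} (hn : 1 ≤ n) {u v : ℝ} (hH : u * v = u + v) (hu : u < 0)
    (hv0 : 0 < v) (hv : v < 1) (hT : ev (T (n + 1)) u v = 0) : G (n + 1) v < E (n + 1) 0 := by
  have huv : u < v := hu.trans hv0
  have hrel := bet_relation_of_ev_T huv hv hT
  obtain ⟨hu1, hv1, -, hus⟩ := eq_star_of_hyperbola hH
  have hF := F_star n hv1
  have hE := E_star n hv1
  rw [← hus] at hF hE
  have hFv := F_ne_zero n hv0.ne' hv1 (by linarith)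
  set β := bet n u v with hβ
  have hG : 1 + β * G (n + 1) v = 0 := by
    have : F (n + 1) v * (1 + β * G (n + 1) v) = 0 := by
      unfold G
      rw [hF] at hrel
      linear_combination (1 / 2) * hrel + (1 / 2) * β * F (n + 1) v * hE
    exact (mul_eq_zero.1 this).resolve_left hFv
  have hneg : u + v < 0 := by rw [← hH]; exact mul_neg_of_neg_of_pos hu hv0
  have hy0 : 0 < u * v / (u + v - 2) := by rw [hH]; exact div_pos_of_neg_of_neg hneg (by linarith)
  have hy1 : u * v / (u + v - 2) < 1 := by rw [hH, div_lt_one_of_neg (by linarith)]; linarith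
  have hn' : (1 : ℝ) ≤ n := by exact_mod_cast hn
  have hβ0 : 0 < β := by
    have h1 := bet_mul_kap n u v
    rw [mul_div_assoc, ← hβ] at h1
    have h2 := kap_neg n
    have h3 : β * kap n < 0 := by rw [h1]; nlinarith
    exact pos_of_mul_neg_left h3 h2.le
  have h0 := one_add_bet_mul_E_zero n u v
  rw [mul_div_assoc, ← hβ] at h0
  have h1 : 0 < (2 * (n : ℝ) + 1) * (1 + β * E (n + 1) 0) := by
    rw [h0]; exact mul_pos (by linarith) hy0
  have h2 := pos_of_mul_pos_right h1 (by linarith)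
  by_contra! h3
  nlinarith [mul_le_mul_of_nonneg_left h3 hβ0.le]

/-! ### Connectedness of the T-beam -/

/-- The defining function of the `T`-beam in the coordinates `ρ = √(p q)`, `l = √(p / q)`, where
`p = u / (u - 2)` and `q = v / (2 - v)`. -/
def M (n : ℕ) (ρ l : ℝ) : ℝ := S n ρ l (-l⁻¹)

theorem M_inv (n : ℕ) (ρ l : ℝ) : M n ρ l⁻¹ = M n ρ l := by
  unfold M
  rw [inv_inv, S_swap, ← S_neg, neg_neg]

theorem lt_of_deriv_pos_punctured {f : ℝ → ℝ} {a b : ℝ} (ha : a < 0) (hb : 0 < b)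
    (hf : Continuous f) (hd : ∀ x, x ≠ 0 → 0 < deriv f x) : f a < f b := by
  have h1 : StrictMonoOn f (Icc a 0) := by
    refine strictMonoOn_of_deriv_pos (convex_Icc _ _) hf.continuousOn ?_
    rw [interior_Icc]; exact fun x hx => hd x hx.2.ne
  have h2 : StrictMonoOn f (Icc 0 b) := by
    refine strictMonoOn_of_deriv_pos (convex_Icc _ _) hf.continuousOn ?_
    rw [interior_Icc]; exact fun x hx => hd x hx.1.ne'
  exact (h1 ⟨le_rfl, ha.le⟩ ⟨ha.le, le_rfl⟩ ha).trans (h2 ⟨le_rfl, hb.le⟩ ⟨hb.le, le_rfl⟩ hb)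

theorem M_eq_Phi (n : ℕ) (ρ : ℝ) {l : ℝ} (hl : l ≠ 0) :
    M n ρ l = Phi n ρ (-1) l - Phi n ρ (-1) (-l⁻¹) := by
  unfold M
  rw [S_eq_Phi, show l * -l⁻¹ = -1 by field_simp]

theorem strictAnti_sub_pow {n : ℕ} (hn : Even n) (hn2 : 2 ≤ n) {c : ℝ} (hc : 0 < c) :
    StrictAnti fun r : ℝ => (r - c) ^ n - r ^ n := by
  refine strictAnti_of_deriv_neg fun r => ?_
  have h := (((hasDerivAt_id r).sub_const c).pow n).sub (hasDerivAt_pow n r)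
  have h' : HasDerivAt (fun r : ℝ => (r - c) ^ n - r ^ n) _ r := h
  rw [h'.deriv]
  have hodd : Odd (n - 1) := Nat.Even.sub_odd (by omega) hn odd_one
  have := hodd.strictMono_pow (R := ℝ) (sub_lt_self r hc)
  have hn0 : (0 : ℝ) < n := by positivity
  simp only [id] at this ⊢
  nlinarith

theorem W_lt_W {n : ℕ} (hn : Even n) (hn2 : 2 ≤ n) {ρ ρ' X : ℝ} (h0 : 0 ≤ ρ) (h : ρ < ρ')
    (hX : X ≠ 0) : W n ρ' X < W n ρ X := by
  have hX2 : 0 < X ^ 2 := by positivity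
  have h1 := strictAnti_sub_pow hn hn2 hX2 (pow_lt_pow_left₀ h h0 two_ne_zero)
  simp only [← sq_mul_W] at h1
  exact lt_of_mul_lt_mul_left h1 hX2.le

/-- The integrand (X² + 1)·W decreases in ρ, since (r - c)^n - r^n decreases in r for even n and c >
0. -/
theorem M_strictAnti {n : ℕ} (hn : Even n) (hn2 : 2 ≤ n) {ρ ρ' l : ℝ} (hl : 0 < l) (h0 : 0 ≤ ρ)
    (h : ρ < ρ') : M n ρ' l < M n ρ l := by
  have := lt_of_deriv_pos_punctured (f := fun X => Phi n ρ (-1) X - Phi n ρ' (-1) X)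
    (neg_neg_of_pos (inv_pos.2 hl)) hl ((continuous_Phi _ _ _).sub (continuous_Phi _ _ _)) fun X hX => by
      have hd : HasDerivAt (fun X => Phi n ρ (-1) X - Phi n ρ' (-1) X) _ X :=
        (hasDerivAt_Phi n ρ (-1) X).sub (hasDerivAt_Phi n ρ' (-1) X)
      rw [hd.deriv, ← mul_sub]
      exact mul_pos (by linarith [sq_nonneg X]) (sub_pos.2 (W_lt_W hn hn2 h0 h hX))
  rw [M_eq_Phi n _ hl.ne', M_eq_Phi n _ hl.ne']
  beta_reduce at this
  linarith

theorem M_zero_pos {n : ℕ} (hn : Even n) (hn2 : 2 ≤ n) {l : ℝ} (hl : 0 < l) : 0 < M n 0 l := by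
  have := lt_of_deriv_pos_punctured (neg_neg_of_pos (inv_pos.2 hl)) hl
    (continuous_Phi n 0 (-1)) fun X hX => by
      rw [(hasDerivAt_Phi n 0 (-1) X).deriv]
      have h1 := sq_mul_W n 0 X
      have hX2 : 0 < X ^ 2 := by positivity
      rw [zero_pow two_ne_zero, zero_pow (by omega : n ≠ 0)] at h1
      have h2 : 0 < X ^ 2 * W n 0 X := by
        rw [h1, sub_zero]; exact hn.pow_pos (by linarith)
      exact mul_pos (by linarith) (pos_of_mul_pos_right h2 hX2.le)
  rw [M_eq_Phi n _ hl.ne']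
  linarith

theorem M_one_neg {n : ℕ} (hn2 : 2 ≤ n) : M n 1 1 < 0 :=
  S_neg_of_opposite (by omega) (by norm_num) (by norm_num) (by norm_num) (Or.inl (by norm_num))

/-- Normalizing ab = -1 keeps the integrand fixed, so only the moving endpoints l and -1/l
contribute. -/
theorem hasDerivAt_M {n : ℕ} (ρ : ℝ) {l : ℝ} (hl : 0 < l) : HasDerivAt (M n ρ)
    ((1 + (l ^ 2)⁻¹) * ((ρ ^ 2 - l ^ 2) ^ n - (ρ ^ 2 - (l ^ 2)⁻¹) ^ n)) l := by
  have h1 := hasDerivAt_Phi n ρ (-1) l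
  have h2 := (hasDerivAt_Phi n ρ (-1) (-l⁻¹)).comp l (hasDerivAt_inv hl.ne').neg
  have h3 : (fun l => Phi n ρ (-1) l - (Phi n ρ (-1) ∘ fun l => -l⁻¹) l) =ᶠ[nhds l] M n ρ := by
    filter_upwards [isOpen_ne.mem_nhds hl.ne'] with x hx
    exact (M_eq_Phi n ρ hx).symm
  have h4 := (h1.sub h2).congr_of_eventuallyEq h3.symm
  refine h4.congr_deriv ?_
  have w1 := sq_mul_W n ρ l
  have w2 := sq_mul_W n ρ (-l⁻¹)
  rw [neg_sq, inv_pow] at w2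
  have hw1 : W n ρ l = ((ρ ^ 2 - l ^ 2) ^ n - (ρ ^ 2) ^ n) * (l ^ 2)⁻¹ := by
    rw [← w1]; field_simp
  have hw2 : W n ρ (-l⁻¹) = ((ρ ^ 2 - (l ^ 2)⁻¹) ^ n - (ρ ^ 2) ^ n) * l ^ 2 := by
    rw [← w2]; field_simp
  rw [hw1, hw2]
  field_simp
  ring

theorem M_lt_of_lt {n : ℕ} (hn : Even n) (hn2 : 2 ≤ n) {ρ l l' : ℝ} (hρ : 0 < ρ) (h1 : 1 ≤ l)
    (h : l < l') (hl' : ρ * l' ≤ 1) : M n ρ l < M n ρ l' := by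
  have hmono : StrictMonoOn (M n ρ) (Icc l l') := by
    refine strictMonoOn_of_deriv_pos (convex_Icc _ _) (fun x hx =>
      (hasDerivAt_M ρ (by linarith [hx.1] : 0 < x)).continuousAt.continuousWithinAt) ?_
    rw [interior_Icc]
    intro x hx
    have hx1 : 1 < x := by linarith [hx.1]
    rw [(hasDerivAt_M ρ (by linarith : 0 < x)).deriv]
    refine mul_pos (by positivity) (sub_pos.2 ?_)
    rw [← hn.neg_pow, ← hn.neg_pow (ρ ^ 2 - x ^ 2), neg_sub, neg_sub]
    have hρx : ρ * x ≤ 1 := le_trans (mul_le_mul_of_nonneg_left hx.2.le hρ.le) hl'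
    -- Both bases x² - ρ² and x⁻² - ρ² are then nonnegative, so their n-th powers compare as they
    -- do.
    have h3 : ρ ^ 2 ≤ (x ^ 2)⁻¹ := by
      rw [← one_div, le_div_iff₀ (by positivity), ← mul_pow]
      exact pow_le_one₀ (by positivity) hρx
    have h4 : (x ^ 2)⁻¹ < x ^ 2 := by
      have : 1 < x ^ 2 := one_lt_pow₀ hx1 two_ne_zero
      exact (inv_lt_one_of_one_lt₀ this).trans this
    exact pow_lt_pow_left₀ (by linarith) (by linarith) (by omega)
  exact hmono ⟨le_rfl, h.le⟩ ⟨h.le, le_rfl⟩ h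

theorem M_le_of_le {n : ℕ} (hn : Even n) (hn2 : 2 ≤ n) {ρ l l' : ℝ} (hρ : 0 < ρ) (h1 : 1 ≤ l)
    (h : l ≤ l') (hl' : ρ * l' ≤ 1) : M n ρ l ≤ M n ρ l' := by
  rcases h.eq_or_lt with rfl | h
  · exact le_rfl
  · exact (M_lt_of_lt hn hn2 hρ h1 h hl').le

theorem continuous_M_left (n : ℕ) (l : ℝ) : Continuous fun ρ => M n ρ l := by
  unfold M S; fun_prop

/-- The `T`-beam in the coordinates `(ρ, l)`. -/
def beamParam (n : ℕ) : Set (ℝ × ℝ) :=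
  {y | 0 < y.1 ∧ 0 < y.2 ∧ y.1 * y.2 < 1 ∧ y.1 < y.2 ∧ M n y.1 y.2 = 0}

theorem mem_beamParam_inv {n : ℕ} {ρ l : ℝ} (h : (ρ, l) ∈ beamParam n) : (ρ, l⁻¹) ∈ beamParam n := by
  obtain ⟨h1, h2, h3, h4, h5⟩ := h
  simp only at h1 h2 h3 h4 h5
  refine ⟨h1, inv_pos.2 h2, ?_, ?_, ?_⟩
  · simp only; rw [← div_eq_mul_inv, div_lt_one h2]; exact h4
  · simp only; rw [← one_div, lt_div_iff₀ h2]; exact h3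
  · simp only; rw [M_inv]; exact h5

theorem exists_mem_beamParam {n : ℕ} (hn : Even n) (hn2 : 2 ≤ n) {l : ℝ} (h1 : 1 ≤ l)
    (h : M n l⁻¹ l < 0) : ∃ ρ, (ρ, l) ∈ beamParam n := by
  have hl : 0 < l := by linarith
  have hiv := intermediate_value_Ioo' (inv_pos.2 hl).le (continuous_M_left n l).continuousOn
  obtain ⟨ρ, hρ, hM⟩ := hiv ⟨h, M_zero_pos hn hn2 hl⟩
  refine ⟨ρ, hρ.1, hl, ?_, ?_, hM⟩
  · have := mul_lt_mul_of_pos_right hρ.2 hl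
    rwa [inv_mul_cancel₀ hl.ne'] at this
  · exact hρ.2.trans_le ((inv_le_one_of_one_le₀ h1).trans h1)

/-- If the beam has a point over l' then it has one over each l in [1, l'], as M(1/l, l) < M(ρ, l) ≤
M(ρ, l') = 0. -/
theorem M_inv_self_neg_of_le {n : ℕ} (hn : Even n) (hn2 : 2 ≤ n) {ρ l l' : ℝ} (h1 : 1 ≤ l)
    (h : l ≤ l') (hl' : (ρ, l') ∈ beamParam n) : M n l⁻¹ l < 0 := by
  obtain ⟨e1, e2, e3, e4, e5⟩ := hl'
  simp only at e1 e2 e3 e4 e5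
  have hρ : ρ < l'⁻¹ := by rw [← one_div, lt_div_iff₀ e2]; exact e3
  have h2 : ρ < l⁻¹ := hρ.trans_le (inv_anti₀ (by linarith) h)
  have h3 := M_strictAnti hn hn2 (by linarith : 0 < l) e1.le h2
  have h4 := M_le_of_le hn hn2 e1 h1 h e3.le
  linarith

theorem exists_center {n : ℕ} (hn : Even n) (hn2 : 2 ≤ n) : ∃ ρ, (ρ, 1) ∈ beamParam n :=
  exists_mem_beamParam hn hn2 le_rfl (by rw [inv_one]; exact M_one_neg hn2)

theorem eq_of_mem_beamParam {n : ℕ} (hn : Even n) (hn2 : 2 ≤ n) {ρ ρ' l : ℝ}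
    (h : (ρ, l) ∈ beamParam n) (h' : 0 ≤ ρ') (hM : M n ρ' l = 0) : ρ' = ρ := by
  obtain ⟨e1, e2, e3, e4, e5⟩ := h
  simp only at e1 e2 e3 e4 e5
  rcases lt_trichotomy ρ' ρ with h1 | h1 | h1
  · linarith [M_strictAnti hn hn2 e2 h' h1]
  · exact h1
  · linarith [M_strictAnti hn hn2 e2 e1.le h1]

theorem center_le {n : ℕ} (hn : Even n) (hn2 : 2 ≤ n) {ρ₀ ρ l : ℝ} (h0 : (ρ₀, 1) ∈ beamParam n)
    (h : (ρ, l) ∈ beamParam n) : ρ₀ ≤ ρ := by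
  wlog h1 : 1 ≤ l generalizing l
  · refine this (mem_beamParam_inv h) ?_
    exact (one_le_inv₀ h.2.1).2 (le_of_not_ge h1)
  obtain ⟨e1, e2, e3, e4, e5⟩ := h
  simp only at e1 e2 e3 e4 e5
  by_contra! hlt
  have h2 := M_strictAnti hn hn2 one_pos e1.le hlt
  have h3 := M_le_of_le hn hn2 e1 le_rfl h1 e3.le
  have h4 : M n ρ₀ 1 = 0 := h0.2.2.2.2
  linarith

theorem exists_path {n : ℕ} (hn : Even n) (hn2 : 2 ≤ n) {ρ₀ ρ l : ℝ} (h0 : (ρ₀, 1) ∈ beamParam n)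
    (h : (ρ, l) ∈ beamParam n) (h1 : 1 ≤ l) :
    ∃ t ⊆ beamParam n, (ρ₀, 1) ∈ t ∧ (ρ, l) ∈ t ∧ IsPreconnected t := by
  have hex : ∀ x : ℝ, ∃ r, x ∈ Icc 1 l → (r, x) ∈ beamParam n := by
    intro x
    by_cases hx : x ∈ Icc 1 l
    · obtain ⟨r, hr⟩ := exists_mem_beamParam hn hn2 hx.1 (M_inv_self_neg_of_le hn hn2 hx.1 hx.2 h)
      exact ⟨r, fun _ => hr⟩
    · exact ⟨0, fun h => absurd h hx⟩
  choose R hR using hex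
  -- Monotonicity in ρ replaces the implicit function theorem: the sign of M(a, x) tells on which
  -- side of R(x) the number a lies, and it persists for nearby x.
  have hcont : ContinuousOn R (Icc 1 l) := by
    intro x hx
    have hRx := hR x hx
    have hx0 : 0 < x := hRx.2.1
    have hMc : ∀ c, ContinuousWithinAt (M n c) (Icc 1 l) x := fun c =>
      (hasDerivAt_M c hx0).continuousAt.continuousWithinAt
    refine tendsto_order.2 ⟨fun a ha => ?_, fun a ha => ?_⟩
    · rcases lt_or_ge a 0 with ha0 | ha0
      · filter_upwards [self_mem_nhdsWithin] with y hy
        exact ha0.trans (hR y hy).1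
      · have h2 : 0 < M n a x := by
          have h3 := M_strictAnti hn hn2 hx0 ha0 ha
          have h4 : M n (R x) x = 0 := hRx.2.2.2.2
          linarith
        filter_upwards [self_mem_nhdsWithin, (hMc a).eventually_const_lt h2] with y hy hy2
        by_contra! hle
        have h4 : M n (R y) y = 0 := (hR y hy).2.2.2.2
        rcases hle.eq_or_lt with he | hl
        · rw [he] at h4; linarith
        · linarith [M_strictAnti hn hn2 (hR y hy).2.1 (hR y hy).1.le hl]
    · have h2 : M n a x < 0 := by
        have h3 := M_strictAnti hn hn2 hx0 hRx.1.le ha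
        have h4 : M n (R x) x = 0 := hRx.2.2.2.2
        linarith
      filter_upwards [self_mem_nhdsWithin, (hMc a).eventually_lt_const h2] with y hy hy2
      by_contra! hle
      have h4 : M n (R y) y = 0 := (hR y hy).2.2.2.2
      have ha0 : 0 < a := lt_trans hRx.1 ha
      rcases hle.eq_or_lt with he | hl
      · rw [← he] at h4; linarith
      · linarith [M_strictAnti hn hn2 (hR y hy).2.1 ha0.le hl]
  refine ⟨(fun x => (R x, x)) '' Icc 1 l, ?_, ⟨1, ⟨le_rfl, h1⟩, ?_⟩, ⟨l, ⟨h1, le_rfl⟩, ?_⟩,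
    isPreconnected_Icc.image _ (hcont.prodMk continuousOn_id)⟩
  · rintro _ ⟨x, hx, rfl⟩; exact hR x hx
  · have hr := hR 1 ⟨le_rfl, h1⟩
    beta_reduce
    rw [← eq_of_mem_beamParam hn hn2 hr h0.1.le h0.2.2.2.2]
  · have hr := hR l ⟨h1, le_rfl⟩
    beta_reduce
    rw [← eq_of_mem_beamParam hn hn2 hr h.1.le h.2.2.2.2]

theorem isPreconnected_beamParam {n : ℕ} (hn : Even n) (hn2 : 2 ≤ n) :
    IsPreconnected (beamParam n) := by
  obtain ⟨ρ₀, h0⟩ := exists_center hn hn2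
  refine isPreconnected_of_forall (ρ₀, 1) fun y hy => ?_
  rcases le_total 1 y.2 with h1 | h1
  · exact exists_path hn hn2 h0 hy h1
  · have hy' := mem_beamParam_inv (ρ := y.1) (l := y.2) hy
    obtain ⟨t, ht, h2, h3, h4⟩ := exists_path hn hn2 h0 hy' ((one_le_inv₀ hy.2.1).2 h1)
    refine ⟨(fun y : ℝ × ℝ => (y.1, y.2⁻¹)) '' t, ?_, ⟨_, h2, by simp⟩, ⟨_, h3, by simp⟩, h4.image _ ?_⟩
    · rintro _ ⟨x, hx, rfl⟩; exact mem_beamParam_inv (ht hx)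
    · exact continuousOn_fst.prodMk (continuousOn_snd.inv₀ fun x hx => (ht hx).2.1.ne')

/-- The point of the plane with coordinates `(ρ, l)`. -/
def beamMap (y : ℝ × ℝ) : ℝ × ℝ :=
  (2 * (y.1 * y.2) / (y.1 * y.2 - 1), 2 * (y.1 / y.2) / (y.1 / y.2 + 1))

/-- Homogeneity of S: u(v-2), v(u-2), uv are (u-2)(v-2)ρ times l, -1/l, -ρ, and S is even in its
first argument. -/
theorem S_eq_M (n : ℕ) {u v ρ l : ℝ} (hu : u < 0) (hv0 : 0 < v) (hv : v < 1) (hl : 0 < l)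
    (hp : ρ * l = u / (u - 2)) (hq : ρ / l = v / (2 - v)) :
    S n (u * v) (u * (v - 2)) (v * (u - 2)) = ((u - 2) * (v - 2) * ρ) ^ (2 * n + 1) * M n ρ l := by
  have hu2 : u - 2 ≠ 0 := by linarith
  have hv2 : v - 2 ≠ 0 := by linarith
  have hv2' : 2 - v ≠ 0 := by linarith
  have h1 : u = ρ * l * (u - 2) := by rw [hp]; field_simp
  have h2 : v = - (ρ / l) * (v - 2) := by rw [hq]; field_simp; ring
  have e1 : (u - 2) * (v - 2) * ρ * l = u * (v - 2) := by linear_combination -(v - 2) * h1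
  have e2 : (u - 2) * (v - 2) * ρ * (-l⁻¹) = v * (u - 2) := by
    rw [div_eq_mul_inv] at h2; linear_combination -(u - 2) * h2
  have e3 : (u - 2) * (v - 2) * ρ * -ρ = u * v := by
    have h3 : ρ ^ 2 = u / (u - 2) * (v / (2 - v)) := by rw [← hp, ← hq]; field_simp
    have : (u - 2) * (v - 2) * ρ * -ρ = -((u - 2) * (v - 2) * ρ ^ 2) := by ring
    rw [this, h3]; field_simp; ring
  unfold M
  rw [← S_neg_left n ρ, ← S_smul, e1, e2, e3]

theorem beamT_eq_image (n : ℕ) : beamT (n + 1) = beamMap '' beamParam n := by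
  ext ⟨u, v⟩
  constructor
  · rintro ⟨hT, hu, hv0, hv⟩
    have hT : ev (T (n + 1)) u v = 0 := hT
    have hu : u < 0 := hu
    have hv0 : 0 < v := hv0
    have hv : v < 1 := hv
    have hp : 0 < u / (u - 2) := div_pos_of_neg_of_neg hu (by linarith)
    have hp1 : u / (u - 2) < 1 := by rw [div_lt_one_of_neg (by linarith)]; linarith
    have hq : 0 < v / (2 - v) := div_pos hv0 (by linarith)
    have hq1 : v / (2 - v) < 1 := by rw [div_lt_one (by linarith)]; linarith
    set p := u / (u - 2) with hpd
    set q := v / (2 - v) with hqd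
    have hsp := Real.sqrt_pos.2 hp
    have hsq := Real.sqrt_pos.2 hq
    have e1 : √p * √q * (√p / √q) = p := by
      field_simp; exact Real.sq_sqrt hp.le
    have e2 : √p * √q / (√p / √q) = q := by
      field_simp; exact Real.sq_sqrt hq.le
    have hS := S_eq_M n hu hv0 hv (div_pos hsp hsq) e1 e2
    rw [(ev_T_eq_zero_iff n (hu.trans hv0)).1 hT] at hS
    have hne : ((u - 2) * (v - 2) * (√p * √q)) ^ (2 * n + 1) ≠ 0 := by
      have : u - 2 ≠ 0 := by linarith
      have : v - 2 ≠ 0 := by linarith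
      positivity
    refine ⟨(√p * √q, √p / √q), ⟨by positivity, by positivity, by simp only; rw [e1]; exact hp1, ?_,
      (mul_eq_zero.1 hS.symm).resolve_left hne⟩, ?_⟩
    · have h3 : √p * √q / (√p / √q) < 1 := by rw [e2]; exact hq1
      rwa [div_lt_one (div_pos hsp hsq)] at h3
    · unfold beamMap
      simp only
      rw [e1, e2, hpd, hqd]
      have h1 : u - 2 ≠ 0 := by linarith
      have h2 : 2 - v ≠ 0 := by linarith
      ext
      · have : u / (u - 2) - 1 ≠ 0 := by linarith
        simp only
        rw [div_eq_iff this]; field_simp; ring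
      · have : v / (2 - v) + 1 ≠ 0 := by linarith
        simp only
        rw [div_eq_iff this]; field_simp; ring
  · rintro ⟨⟨ρ, l⟩, ⟨h1, h2, h3, h4, h5⟩, heq⟩
    simp only at h1 h2 h3 h4 h5
    unfold beamMap at heq
    simp only [Prod.mk.injEq] at heq
    have hp : 0 < ρ * l := by positivity
    have hq : 0 < ρ / l := by positivity
    have hq1 : ρ / l < 1 := by rwa [div_lt_one h2]
    set p := ρ * l with hpd
    set q := ρ / l with hqd
    have hu : u < 0 := by rw [← heq.1]; exact div_neg_of_pos_of_neg (by linarith) (by linarith)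
    have hv0 : 0 < v := by rw [← heq.2]; positivity
    have hv : v < 1 := by rw [← heq.2, div_lt_one (by linarith)]; linarith
    have hp' : p = u / (u - 2) := by
      have e1 : p - 1 ≠ 0 := by linarith
      rw [eq_div_iff (by linarith), ← heq.1]; field_simp; ring
    have hq' : q = v / (2 - v) := by
      have e1 : q + 1 ≠ 0 := by linarith
      rw [eq_div_iff (by linarith), ← heq.2]; field_simp; ring
    refine ⟨?_, hu, hv0, hv⟩
    change ev (T (n + 1)) u v = 0
    rw [ev_T_eq_zero_iff n (hu.trans hv0), S_eq_M n hu hv0 hv h2 hp' hq', h5, mul_zero]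

theorem isPreconnected_beamT {n : ℕ} (hn : Even n) (hn2 : 2 ≤ n) :
    IsPreconnected (beamT (n + 1)) := by
  rw [beamT_eq_image]
  refine (isPreconnected_beamParam hn hn2).image _ ?_
  unfold beamMap
  refine ContinuousOn.prodMk ?_ ?_
  · refine ContinuousOn.div (by fun_prop) (by fun_prop) fun y hy => ?_
    linarith [hy.2.2.1]
  · have hc : ContinuousOn (fun y : ℝ × ℝ => y.1 / y.2) (beamParam n) :=
      continuousOn_fst.div continuousOn_snd fun y hy => hy.2.1.ne'
    refine ContinuousOn.div (hc.const_mul 2 |>.congr fun _ _ => rfl) (hc.add continuousOn_const) fun y hy => ?_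
    have : 0 < y.1 / y.2 := div_pos hy.1 hy.2.1
    linarith

/-! ### Connected components -/

theorem connectedComponentIn_eq_of_separated {X : Type*} [TopologicalSpace X] {S K U U' : Set X}
    (hK : IsPreconnected K) (hKS : K ⊆ S) (hU : IsOpen U) (hU' : IsOpen U') (hd : Disjoint U U')
    (hS : S ⊆ U ∪ U') (hSU : S ∩ U ⊆ K) (hKU : K ⊆ U) {p : X} (hp : p ∈ K) :
    connectedComponentIn S p = K := by
  refine Subset.antisymm (fun q hq => hSU ⟨connectedComponentIn_subset S p hq, ?_⟩)
    (hK.subset_connectedComponentIn hp hKS)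
  have hsub : connectedComponentIn S p ⊆ U :=
    isPreconnected_connectedComponentIn.subset_left_of_subset_union hU hU' hd
      ((connectedComponentIn_subset S p).trans hS) ⟨p, mem_connectedComponentIn (hKS hp), hKU hp⟩
  exact hsub hq

theorem segment_eq_image {A : Set ℝ} (hA : 1 ∉ A) : segment A = (fun t => (t, star t)) '' A := by
  ext ⟨u, v⟩
  constructor
  · rintro ⟨h1, h2⟩
    obtain ⟨-, -, hv, -⟩ := eq_star_of_hyperbola (u := u) (v := v) h1
    exact ⟨u, h2, by rw [hv]⟩
  · rintro ⟨t, ht, heq⟩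
    simp only [Prod.mk.injEq] at heq
    obtain ⟨rfl, rfl⟩ := heq
    exact ⟨hyperbola_star fun h => hA (h ▸ ht), ht⟩

theorem isPreconnected_segment {A : Set ℝ} (hA : 1 ∉ A) (h : IsPreconnected A) :
    IsPreconnected (segment A) := by
  rw [segment_eq_image hA]
  refine h.image _ (continuousOn_id.prodMk fun t ht => ?_)
  exact (hasDerivAt_star fun h => hA (h ▸ ht)).continuousAt.continuousWithinAt

theorem isPreconnected_setI : IsPreconnected setI :=
  isPreconnected_segment (by simp) isPreconnected_Ioo

theorem mem_setI_bounds {p : ℝ × ℝ} (h : p ∈ setI) : 1 < p.1 := h.2.1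

theorem setI_nonempty : (3 / 2, 3) ∈ setI := by
  refine ⟨?_, ?_, ?_⟩
  · change (3 / 2 : ℝ) * 3 = 3 / 2 + 3; norm_num
  all_goals norm_num

theorem zero_mem_segment {A : Set ℝ} (h : 0 ∈ A) : ((0 : ℝ), (0 : ℝ)) ∈ segment A := by
  refine ⟨?_, h⟩
  change (0 : ℝ) * 0 = 0 + 0; norm_num

theorem zero_notMem_setI : ((0 : ℝ), (0 : ℝ)) ∉ setI := fun h => by
  have h1 : (1 : ℝ) < 0 := mem_setI_bounds h
  linarith

theorem hyperbola_bounds {u v : ℝ} (hH : u * v = u + v) (hu : u < 0) : 0 < v ∧ v < 1 := by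
  obtain ⟨-, -, hv, -⟩ := eq_star_of_hyperbola hH
  rw [hv]
  exact ⟨star_pos_of_neg hu, star_lt_one (by linarith)⟩

theorem eq_zero_of_hyperbola {v : ℝ} (hH : 0 * v = 0 + v) : v = 0 := by linarith

theorem setI_subset {n : ℕ} (hn : 1 ≤ n) : setI ⊆ curve (n + 1) := by
  rintro ⟨u, v⟩ ⟨hH, h1, h2⟩
  exact setI_subset_curve hn hH h1 h2

theorem curve_cases {n : ℕ} (hn : 1 ≤ n) {u v : ℝ} (h : (u, v) ∈ curve (n + 1)) :
    (u = 0 ∧ v = 0) ∨ (u, v) ∈ setI ∨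
      (u * v = u + v ∧ u < 0 ∧ deriv (G (n + 1)) v ≠ 0 ∧ ∀ t ∈ Ioo u v, G (n + 1) t ≠ G (n + 1) v) ∨
      (Even n ∧ (u, v) ∈ beamT (n + 1)) := by
  rcases h with h | ⟨huv, f, hf, hc⟩
  · left; simpa using h
  · right
    obtain ⟨A, B, C, rfl⟩ := mem_V_iff.1 hf
    rcases cases_of_conditions hn huv hc with ⟨hH, h1 | h1⟩ | ⟨he, hT, h1, h2, h3⟩
    · exact Or.inl ⟨hH, h1⟩
    · obtain ⟨h2, h3⟩ := G_of_conditions_of_hyperbola hH h1.2.1 h1.2.2 hc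
      exact Or.inr (Or.inl ⟨hH, h1.1, h2, h3⟩)
    · exact Or.inr (Or.inr ⟨he, hT, h1, h2, h3⟩)

theorem components_of_odd {n : ℕ} (hn : Odd n) :
    components (curve (n + 1)) = {setTri (n + 1), setI} ∧ setTri (n + 1) ≠ setI := by
  have hTri : setTri (n + 1) = segment (Iic 0) := if_pos hn.add_one
  rw [hTri]
  have hcurve : curve (n + 1) = segment (Iic 0) ∪ setI := by
    ext ⟨u, v⟩
    constructor
    · intro h
      rcases curve_cases hn.pos h with ⟨rfl, rfl⟩ | h | ⟨hH, hu, -⟩ | ⟨he, -⟩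
      · exact Or.inl (zero_mem_segment (mem_Iic.2 le_rfl))
      · exact Or.inr h
      · exact Or.inl ⟨hH, hu.le⟩
      · exact absurd he (Nat.not_even_iff_odd.2 hn)
    · rintro (⟨hH, hu⟩ | h)
      · have hH : u * v = u + v := hH
        rcases (show u ≤ 0 from hu).eq_or_lt with rfl | hu
        · left; rw [eq_zero_of_hyperbola hH]
        · exact mem_curve_of_odd hn hH hu
      · exact setI_subset hn.pos h
  have hU : IsOpen {p : ℝ × ℝ | p.1 < 1} := isOpen_lt continuous_fst continuous_const
  have hU' : IsOpen {p : ℝ × ℝ | 1 < p.1} := isOpen_lt continuous_const continuous_fst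
  have hd : Disjoint {p : ℝ × ℝ | p.1 < 1} {p : ℝ × ℝ | 1 < p.1} :=
    disjoint_left.2 fun p (h1 : p.1 < 1) (h2 : 1 < p.1) => by linarith
  have hT1 : segment (Iic 0) ⊆ {p : ℝ × ℝ | p.1 < 1} := fun p hp => by
    have : p.1 ≤ 0 := hp.2
    change p.1 < 1; linarith
  have hI1 : setI ⊆ {p : ℝ × ℝ | 1 < p.1} := fun p hp => mem_setI_bounds hp
  have hcT : ∀ p ∈ segment (Iic 0), connectedComponentIn (curve (n + 1)) p = segment (Iic 0) := by
    intro p hp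
    refine connectedComponentIn_eq_of_separated (isPreconnected_segment (by simp) isPreconnected_Iic)
      ?_ hU hU' hd ?_ ?_ hT1 hp <;> rw [hcurve]
    · exact subset_union_left
    · exact union_subset_union hT1 hI1
    · rintro q ⟨hq | hq, hqU⟩
      · exact hq
      · exact absurd hqU (fun h => hd.ne_of_mem h (hI1 hq) rfl)
  have hcI : ∀ p ∈ setI, connectedComponentIn (curve (n + 1)) p = setI := by
    intro p hp
    refine connectedComponentIn_eq_of_separated isPreconnected_setI
      ?_ hU' hU hd.symm ?_ ?_ hI1 hp <;> rw [hcurve]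
    · exact subset_union_right
    · rw [union_comm]; exact union_subset_union hI1 hT1
    · rintro q ⟨hq | hq, hqU⟩
      · exact absurd hqU (fun h => hd.ne_of_mem (hT1 hq) h rfl)
      · exact hq
  have h0 : ((0 : ℝ), (0 : ℝ)) ∈ segment (Iic 0) := zero_mem_segment (mem_Iic.2 le_rfl)
  refine ⟨?_, fun h => zero_notMem_setI (h ▸ h0)⟩
  ext K
  constructor
  · rintro ⟨p, hp, rfl⟩
    rw [hcurve] at hp
    rcases hp with hp | hp
    · exact Or.inl (hcT p hp)
    · exact Or.inr (hcI p hp)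
  · rintro (rfl | rfl)
    · exact ⟨_, hcurve ▸ Or.inl h0, (hcT _ h0).symm⟩
    · exact ⟨_, hcurve ▸ Or.inr setI_nonempty, (hcI _ setI_nonempty).symm⟩

theorem isZ_iff {n : ℕ} {z₁ : ℝ} (h0 : 0 < z₁) (h1 : z₁ < 1)
    (hlt : ∀ t ∈ Ioo 0 z₁, E (n + 1) 0 < G (n + 1) t) (heq : G (n + 1) z₁ = E (n + 1) 0)
    (hgt : ∀ t ∈ Ioo z₁ 1, G (n + 1) t < E (n + 1) 0) (t : ℝ) : IsZ (n + 1) t ↔ t = star z₁ := by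
  constructor
  · rintro ⟨ht, hG⟩
    have ht1 : t ≠ 1 := by linarith
    rw [← G_star n ht1] at hG
    have h2 := star_pos_of_neg ht
    have h3 := star_lt_one (by linarith : t < 1)
    have : star t = z₁ := by
      rcases lt_trichotomy (star t) z₁ with h | h | h
      · linarith [hlt _ ⟨h2, h⟩]
      · exact h
      · linarith [hgt _ ⟨h, h3⟩]
    rw [← this, star_star ht1]
  · rintro rfl
    exact ⟨star_neg h0 h1, by rw [G_star n h1.ne, heq]⟩

theorem isW_iff {n : ℕ} {w₁ : ℝ} (h0 : 0 < w₁) (h1 : w₁ < 1)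
    (hlt : ∀ t ∈ Ioo 0 w₁, 0 < deriv (G (n + 1)) t) (heq : deriv (G (n + 1)) w₁ = 0)
    (hgt : ∀ t ∈ Ioo w₁ 1, deriv (G (n + 1)) t < 0) (t : ℝ) : IsW (n + 1) t ↔ t = star w₁ := by
  constructor
  · rintro ⟨ht, hG⟩
    have ht1 : t ≠ 1 := by linarith
    rw [deriv_G_star n ht1] at hG
    have h2 := star_pos_of_neg ht
    have h3 := star_lt_one (by linarith : t < 1)
    have ht1' := sub_ne_zero.2 ht1
    have h4 : deriv (G (n + 1)) (star t) = 0 := by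
      field_simp at hG; linarith
    have : star t = w₁ := by
      rcases lt_trichotomy (star t) w₁ with h | h | h
      · linarith [hlt _ ⟨h2, h⟩]
      · exact h
      · linarith [hgt _ ⟨h, h3⟩]
    rw [← this, star_star ht1]
  · rintro rfl
    refine ⟨star_neg h0 h1, ?_⟩
    rw [deriv_G_star n (star_ne_one h1.ne), star_star h1.ne, heq]; simp

theorem mem_curve_iff_of_even {n : ℕ} {w₁ z₁ : ℝ} (hw : 0 < w₁) (hwz : w₁ < z₁) (hz : z₁ < 1)
    (d1 : ∀ t ∈ Ioo 0 w₁, 0 < deriv (G (n + 1)) t) (d2 : deriv (G (n + 1)) w₁ = 0)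
    (d3 : ∀ t ∈ Ioo w₁ 1, deriv (G (n + 1)) t < 0)
    (g1 : ∀ t ∈ Ioo 0 z₁, E (n + 1) 0 < G (n + 1) t) (g2 : G (n + 1) z₁ = E (n + 1) 0)
    (g3 : ∀ t ∈ Ioo z₁ 1, G (n + 1) t < E (n + 1) 0) {v : ℝ} (hv0 : 0 < v) (hv : v < 1) :
    (deriv (G (n + 1)) v ≠ 0 ∧ ∀ t ∈ Ico 0 v, G (n + 1) t ≠ G (n + 1) v) ↔ v < w₁ ∨ z₁ < v := by
  have hmono : StrictMonoOn (G (n + 1)) (Icc 0 w₁) := by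
    refine strictMonoOn_of_deriv_pos (convex_Icc _ _) (fun x hx => ?_) ?_
    · exact (continuousAt_G n (by linarith [hx.2])).continuousWithinAt
    · rw [interior_Icc]; exact d1
  have hanti : StrictAntiOn (G (n + 1)) (Ico w₁ 1) := by
    refine strictAntiOn_of_deriv_neg (convex_Ico _ _) (fun x hx => ?_) ?_
    · exact (continuousAt_G n hx.2.ne).continuousWithinAt
    · rw [interior_Ico]; exact d3
  constructor
  · rintro ⟨hd, hc⟩
    by_contra! hcon
    rcases hcon.1.eq_or_lt with h | h
    · exact hd (h ▸ d2)
    rcases hcon.2.eq_or_lt with h' | h'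
    · exact hc 0 ⟨le_rfl, hv0⟩ (by rw [G_zero, h', g2])
    · have h1 := g1 v ⟨hv0, h'⟩
      have h2 := hanti ⟨le_rfl, hwz.trans hz⟩ ⟨h.le, hv⟩ h
      have hiv := intermediate_value_Ioo hw.le (f := G (n + 1)) fun x hx =>
        (continuousAt_G n (by linarith [hx.2])).continuousWithinAt
      rw [G_zero] at hiv
      obtain ⟨t, ht, hGt⟩ := hiv ⟨h1, h2⟩
      exact hc t ⟨ht.1.le, ht.2.trans h⟩ hGt
  · rintro (h | h)
    · exact ⟨(d1 v ⟨hv0, h⟩).ne', fun t ht => (hmono ⟨ht.1, (ht.2.trans h).le⟩ ⟨hv0.le, h.le⟩ ht.2).ne⟩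
    · refine ⟨(d3 v ⟨hwz.trans h, hv⟩).ne, fun t ht => ?_⟩
      have h1 := g3 v ⟨h, hv⟩
      rcases lt_or_ge z₁ t with h2 | h2
      · exact (hanti ⟨(hwz.trans h2).le, ht.2.trans hv⟩ ⟨(hwz.trans h).le, hv⟩ ht.2).ne'
      · refine (h1.trans_le ?_).ne'
        rcases ht.1.eq_or_lt with rfl | h3
        · rw [G_zero]
        rcases h2.eq_or_lt with rfl | h4
        · exact g2.ge
        · exact (g1 t ⟨h3, h4⟩).le

theorem beamMap_center {ρ : ℝ} (h0 : 0 < ρ) (h1 : ρ < 1) :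
    beamMap (ρ, 1) = (2 * ρ / (ρ - 1), star (2 * ρ / (ρ - 1))) := by
  have e1 : ρ - 1 ≠ 0 := by linarith
  have e2 : 2 * ρ / (ρ - 1) - 1 = (ρ + 1) / (ρ - 1) := by field_simp; ring
  have e3 : ρ + 1 ≠ 0 := by linarith
  unfold beamMap star
  rw [e2]
  ext
  · simp
  · simp only [div_one]; field_simp

theorem beamMap_sub_two {n : ℕ} {y : ℝ × ℝ} (hy : y ∈ beamParam n) :
    (beamMap y).1 - 2 = 2 / (y.1 * y.2 - 1) ∧ (beamMap y).2 - 2 = -2 / (y.1 / y.2 + 1) := by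
  have h1 : y.1 * y.2 - 1 ≠ 0 := by linarith [hy.2.2.1]
  have h2 : y.1 / y.2 + 1 ≠ 0 := by have := div_pos hy.1 hy.2.1; linarith
  unfold beamMap
  generalize y.1 * y.2 = p at *
  generalize y.1 / y.2 = q at *
  simp only
  constructor
  · field_simp; ring
  · field_simp; ring

/-- The hyperbola is p = q in the coordinates p = ρl, q = ρ/l. -/
theorem eq_one_of_beamMap_mem_hyperbola {n : ℕ} {y : ℝ × ℝ} (hy : y ∈ beamParam n)
    (hH : beamMap y ∈ hyperbola) : y.2 = 1 := by
  obtain ⟨h1, h2⟩ := beamMap_sub_two hy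
  have hH : (beamMap y).1 * (beamMap y).2 = (beamMap y).1 + (beamMap y).2 := hH
  have hp : y.1 * y.2 - 1 ≠ 0 := by linarith [hy.2.2.1]
  have hq : y.1 / y.2 + 1 ≠ 0 := by have := div_pos hy.1 hy.2.1; linarith
  have h3 : (beamMap y).1 = 2 + 2 / (y.1 * y.2 - 1) := by linarith
  have h4 : (beamMap y).2 = 2 + -2 / (y.1 / y.2 + 1) := by linarith
  rw [h3, h4] at hH
  have hpq : y.1 * y.2 = y.1 / y.2 := by
    generalize y.1 * y.2 = p at *
    generalize y.1 / y.2 = q at *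
    field_simp at hH
    linarith
  have hy1 := hy.1.ne'
  have hy2 := hy.2.1
  have h5 : y.2 * y.2 = 1 := by
    field_simp at hpq
    nlinarith
  nlinarith

theorem neg_mul_eq_of_mem_beamParam {n : ℕ} {y : ℝ × ℝ} (hy : y ∈ beamParam n) :
    -((beamMap y).1 * (beamMap y).2) = y.1 ^ 2 * (((beamMap y).1 - 2) * ((beamMap y).2 - 2)) := by
  obtain ⟨h1, h2⟩ := beamMap_sub_two hy
  rw [h1, h2]
  have hp : y.1 * y.2 - 1 ≠ 0 := by linarith [hy.2.2.1]
  have hq : y.1 / y.2 + 1 ≠ 0 := by have := div_pos hy.1 hy.2.1; linarith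
  have h3 : y.1 ^ 2 = (y.1 * y.2) * (y.1 / y.2) := by have := hy.2.1.ne'; field_simp
  unfold beamMap
  rw [h3]
  generalize y.1 * y.2 = p at *
  generalize y.1 / y.2 = q at *
  simp only
  field_simp

theorem components_of_even {n : ℕ} (hn : Even n) (hn2 : 2 ≤ n) :
    (∃! T, IsT (n + 1) T) ∧ (∃! z, IsZ (n + 1) z) ∧ (∃! w, IsW (n + 1) w) ∧ z (n + 1) < w (n + 1) ∧
    components (curve (n + 1)) = {setX (n + 1), setTri (n + 1), setI} ∧
    setX (n + 1) ≠ setTri (n + 1) ∧ setX (n + 1) ≠ setI ∧ setTri (n + 1) ≠ setI ∧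
    setX (n + 1) ∩ hyperbola = beamH (n + 1) ∧ setX (n + 1) ∩ zeroT (n + 1) = beamT (n + 1) ∧
    ∃ x : ℝ, x < 0 ∧ (∀ t : ℝ, t < 0 → (ev (T (n + 1)) t (star t) = 0 ↔ t = x)) ∧
      beamH (n + 1) ∩ beamT (n + 1) = {(x, star x)} := by
  have hn1 : 1 ≤ n := by omega
  obtain ⟨w₁, z₁, hw, hwz, hz, d1, d2, d3, g1, g2, g3⟩ := exists_shape hn hn2
  have hw1 : w₁ < 1 := hwz.trans hz
  have hz0 : 0 < z₁ := hw.trans hwz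
  have hZ := isZ_iff hz0 hz g1 g2 g3
  have hW := isW_iff hw hw1 d1 d2 d3
  have hz_eq : z (n + 1) = star z₁ := (hZ _).1 (Classical.epsilon_spec ⟨_, (hZ _).2 rfl⟩)
  have hw_eq : w (n + 1) = star w₁ := (hW _).1 (Classical.epsilon_spec ⟨_, (hW _).2 rfl⟩)
  have hmem := fun {v : ℝ} => mem_curve_iff_of_even hw hwz hz d1 d2 d3 g1 g2 g3 (v := v)
  have hzneg : star z₁ < 0 := star_neg hz0 hz
  have hwneg : star w₁ < 0 := star_neg hw hw1
  have hzw : star z₁ < star w₁ := star_lt_star hwz (Or.inl hz)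
  have hTri : setTri (n + 1) = segment (Ioc (star w₁) 0) := by
    rw [← hw_eq]; exact if_neg (Nat.not_even_iff_odd.2 hn.add_one)
  have hBH : beamH (n + 1) = segment (Iio (star z₁)) := by rw [← hz_eq]; rfl
  -- points of the hyperbola
  have hHv : ∀ {u v : ℝ}, u * v = u + v → u < 0 → (star w₁ < u ↔ v < w₁) ∧ (u < star z₁ ↔ z₁ < v) := by
    intro u v hH hu
    obtain ⟨-, -, hv, huv⟩ := eq_star_of_hyperbola hH
    obtain ⟨h0, h1⟩ := hyperbola_bounds hH hu
    have hlt : ∀ {a b : ℝ}, a < 1 → b < 1 → (star a < star b ↔ b < a) := by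
      intro a b ha hb
      refine ⟨fun h => ?_, fun h => star_lt_star h (Or.inl ha)⟩
      by_contra! h'
      rcases h'.eq_or_lt with h' | h'
      · rw [h'] at h; exact lt_irrefl _ h
      · exact lt_asymm h (star_lt_star h' (Or.inl hb))
    rw [huv]
    exact ⟨hlt hw1 h1, hlt h1 hz⟩
  have hTH : ∀ {u v : ℝ}, u * v = u + v → (u, v) ∈ beamT (n + 1) → (u, v) ∈ beamH (n + 1) := by
    rintro u v hH ⟨hT, hu, hv0, hv⟩
    have hG := G_lt_of_ev_T_of_hyperbola hn1 hH hu hv0 hv hT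
    have hzv : z₁ < v := by
      by_contra! h
      rcases h.eq_or_lt with rfl | h
      · linarith
      · linarith [g1 v ⟨hv0, h⟩]
    rw [hBH]
    exact ⟨hH, (hHv hH hu).2.2 hzv⟩
  have hHT : ∀ {p : ℝ × ℝ}, p ∈ beamH (n + 1) → p ∈ zeroT (n + 1) → p ∈ beamT (n + 1) := by
    rintro ⟨u, v⟩ h hT
    rw [hBH] at h
    have hu : u < 0 := lt_trans h.2 hzneg
    obtain ⟨h0, h1⟩ := hyperbola_bounds h.1 hu
    exact ⟨hT, hu, h0, h1⟩
  have hcurve : curve (n + 1) = setX (n + 1) ∪ (segment (Ioc (star w₁) 0) ∪ setI) := by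
    ext ⟨u, v⟩
    constructor
    · intro h
      rcases curve_cases hn1 h with ⟨rfl, rfl⟩ | h | ⟨hH, hu, hd, hc⟩ | ⟨-, h⟩
      · exact Or.inr (Or.inl (zero_mem_segment ⟨hwneg, le_rfl⟩))
      · exact Or.inr (Or.inr h)
      · obtain ⟨h0, h1⟩ := hyperbola_bounds hH hu
        rcases (hmem h0 h1).1 ⟨hd, fun t ht => hc t ⟨by linarith [ht.1], ht.2⟩⟩ with h | h
        · exact Or.inr (Or.inl ⟨hH, (hHv hH hu).1.2 h, hu.le⟩)
        · refine Or.inl (Or.inl ?_)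
          rw [hBH]; exact ⟨hH, (hHv hH hu).2.2 h⟩
      · exact Or.inl (Or.inr h)
    · have hH0 : ∀ {u v : ℝ}, u * v = u + v → u < 0 → v < w₁ ∨ z₁ < v → (u, v) ∈ curve (n + 1) := by
        intro u v hH hu h
        obtain ⟨h0, h1⟩ := hyperbola_bounds hH hu
        obtain ⟨hd, hc⟩ := (hmem h0 h1).2 h
        exact mem_curve_of_neg hH hu hd hc
      rintro ((h | ⟨hT, hu, hv0, hv⟩) | ⟨hH, h1, h2⟩ | h)
      · rw [hBH] at h
        have hu : u < 0 := lt_trans h.2 hzneg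
        exact hH0 h.1 hu (Or.inr ((hHv h.1 hu).2.1 h.2))
      · exact mem_curve_of_ev_T hu hv0 hv hT
      · have hH : u * v = u + v := hH
        rcases (show u ≤ 0 from h2).eq_or_lt with rfl | hu
        · left; rw [eq_zero_of_hyperbola hH]
        · exact hH0 hH hu (Or.inl ((hHv hH hu).1.1 h1))
      · exact setI_subset hn1 h
  -- the intersection of the beams
  obtain ⟨ρ₀, hρ⟩ := exists_center hn hn2
  have hρ0 : 0 < ρ₀ := hρ.1
  have hρ1 : ρ₀ < 1 := hρ.2.2.2.1
  set x := 2 * ρ₀ / (ρ₀ - 1) with hx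
  have hmap : beamMap (ρ₀, 1) = (x, star x) := beamMap_center hρ0 hρ1
  have hx0 : x < 0 := div_neg_of_pos_of_neg (by linarith) (by linarith)
  have hxT : (x, star x) ∈ beamT (n + 1) := by
    rw [beamT_eq_image, ← hmap]; exact mem_image_of_mem _ hρ
  have hxH : x * star x = x + star x := hyperbola_star (by linarith)
  have hxB : (x, star x) ∈ beamH (n + 1) := hTH hxH hxT
  have hxuniq : ∀ {p : ℝ × ℝ}, p ∈ beamT (n + 1) → p ∈ hyperbola → p = (x, star x) := by
    intro p hp hH
    rw [beamT_eq_image] at hp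
    obtain ⟨⟨ρ, l⟩, hy, rfl⟩ := hp
    have hl : l = 1 := eq_one_of_beamMap_mem_hyperbola hy hH
    subst hl
    have hρeq : ρ = ρ₀ := eq_of_mem_beamParam hn hn2 hρ hy.1.le hy.2.2.2.2
    rw [hρeq, hmap]
  have hxz : z₁ < star x := by
    have h := hxB
    rw [hBH] at h
    exact (hHv hxH hx0).2.1 h.2
  -- separation
  set c := (w₁ / (2 - w₁)) ^ 2 with hc
  -- On the hyperbola -uv/((u-2)(v-2)) = (v/(2-v))², which increases with v on [0, 1); the level c
  -- is its value at v = w₁.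
  have hlevel : ∀ {u v : ℝ}, u * v = u + v → v < 1 →
      (-(u * v) - c * ((u - 2) * (v - 2))) * (1 - v) = v ^ 2 - c * (2 - v) ^ 2 := by
    intro u v hH hv
    have : u * (v - 1) = v := by linarith
    linear_combination (v + c * (v - 2)) * this
  have hcv : ∀ {v : ℝ}, 0 < v → v < 1 → (w₁ < v → c * (2 - v) ^ 2 < v ^ 2) := by
    intro v h0 h1 h
    rw [hc, div_pow, div_mul_eq_mul_div, div_lt_iff₀ (by nlinarith), ← mul_pow, ← mul_pow]
    exact pow_lt_pow_left₀ (by nlinarith) (by nlinarith) two_ne_zero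
  have hcv' : ∀ {v : ℝ}, 0 ≤ v → v < w₁ → v ^ 2 < c * (2 - v) ^ 2 := by
    intro v h0 h
    rw [hc, div_pow, div_mul_eq_mul_div, lt_div_iff₀ (by nlinarith), ← mul_pow, ← mul_pow]
    exact pow_lt_pow_left₀ (by nlinarith) (by nlinarith) two_ne_zero
  -- The crossing point lies on both beams: its level is ρ₀², and x* > z₁ > w₁. As ρ ≥ ρ₀ on the
  -- T-beam, that whole beam lies above the level c.
  have hcρ : c < ρ₀ ^ 2 := by
    have h1 := hlevel hxH (star_lt_one (by linarith))
    have h2 := hcv (star_pos_of_neg hx0) (star_lt_one (by linarith)) (hwz.trans hxz)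
    have h3 := neg_mul_eq_of_mem_beamParam hρ
    rw [hmap] at h3
    simp only at h3
    rw [h3, ← sub_mul] at h1
    have h4 : 0 < star x := star_pos_of_neg hx0
    have h5 : star x < 1 := star_lt_one (by linarith)
    have h6 : 0 < (x - 2) * (star x - 2) := mul_pos_of_neg_of_neg (by linarith) (by linarith)
    by_contra! h7
    have h8 : (ρ₀ ^ 2 - c) * ((x - 2) * (star x - 2)) * (1 - star x) ≤ 0 :=
      mul_nonpos_of_nonpos_of_nonneg (mul_nonpos_of_nonpos_of_nonneg (by linarith) h6.le) (by linarith)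
    linarith
  set U₁ : Set (ℝ × ℝ) := {p | p.1 < 1 ∧ c * ((p.1 - 2) * (p.2 - 2)) < -(p.1 * p.2)} with hU₁
  set U₂ : Set (ℝ × ℝ) := {p | p.1 < 1 ∧ -(p.1 * p.2) < c * ((p.1 - 2) * (p.2 - 2))} with hU₂
  set U₃ : Set (ℝ × ℝ) := {p | 1 < p.1} with hU₃
  have hlt1 : IsOpen {p : ℝ × ℝ | p.1 < 1} := isOpen_lt continuous_fst continuous_const
  have o1 : IsOpen U₁ := hlt1.inter (isOpen_lt
    (f := fun p : ℝ × ℝ => c * ((p.1 - 2) * (p.2 - 2)))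
    (g := fun p : ℝ × ℝ => -(p.1 * p.2)) (by fun_prop) (by fun_prop))
  have o2 : IsOpen U₂ := hlt1.inter (isOpen_lt
    (f := fun p : ℝ × ℝ => -(p.1 * p.2))
    (g := fun p : ℝ × ℝ => c * ((p.1 - 2) * (p.2 - 2))) (by fun_prop) (by fun_prop))
  have o3 : IsOpen U₃ := isOpen_lt continuous_const continuous_fst
  have hX1 : setX (n + 1) ⊆ U₁ := by
    rintro ⟨u, v⟩ (h | h)
    · rw [hBH] at h
      have hH : u * v = u + v := h.1
      have hu : u < 0 := lt_trans h.2 hzneg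
      obtain ⟨h0, h1⟩ := hyperbola_bounds hH hu
      have hzv := (hHv hH hu).2.1 h.2
      have h2 := hlevel hH h1
      have h3 := hcv h0 h1 (hwz.trans hzv)
      refine ⟨by simp only; linarith, sub_pos.1 (pos_of_mul_pos_left ?_ (by linarith : 0 ≤ 1 - v))⟩
      simp only; linarith
    · have huv := h.2
      rw [beamT_eq_image] at h
      obtain ⟨⟨ρ, l⟩, hy, hyeq⟩ := h
      have h3 := neg_mul_eq_of_mem_beamParam hy
      rw [hyeq] at h3
      have hle : ρ₀ ≤ ρ := center_le hn hn2 hρ hy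
      have hu : u < 0 := huv.1
      have hv : v < 1 := huv.2.2
      refine ⟨by simp only; linarith, ?_⟩
      rw [h3]
      refine mul_lt_mul_of_pos_right (hcρ.trans_le (pow_le_pow_left₀ hρ0.le hle 2)) ?_
      exact mul_pos_of_neg_of_neg (by simp only; linarith) (by simp only; linarith)
  have hT2 : segment (Ioc (star w₁) 0) ⊆ U₂ := by
    rintro ⟨u, v⟩ ⟨hH, h1, h2⟩
    have hH : u * v = u + v := hH
    have h1 : star w₁ < u := h1
    have hv : 0 ≤ v ∧ v < w₁ := by
      rcases (show u ≤ 0 from h2).eq_or_lt with rfl | hu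
      · rw [eq_zero_of_hyperbola hH]; exact ⟨le_rfl, hw⟩
      · exact ⟨(hyperbola_bounds hH hu).1.le, (hHv hH hu).1.1 h1⟩
    have h3 := hlevel hH (hv.2.trans hw1)
    have h4 := hcv' hv.1 hv.2
    have h2 : u ≤ 0 := h2
    refine ⟨by simp only; linarith, ?_⟩
    simp only
    by_contra! h5
    have : 0 ≤ (-(u * v) - c * ((u - 2) * (v - 2))) * (1 - v) :=
      mul_nonneg (by linarith) (by linarith [hv.2])
    linarith
  have hI3 : setI ⊆ U₃ := fun p hp => mem_setI_bounds hp
  have d12 : Disjoint U₁ U₂ := disjoint_left.2 fun p h1 h2 => lt_asymm h1.2 h2.2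
  have d13 : Disjoint U₁ U₃ := disjoint_left.2 fun p h1 h2 => lt_asymm h1.1 h2
  have d23 : Disjoint U₂ U₃ := disjoint_left.2 fun p h1 h2 => lt_asymm h1.1 h2
  have pX : IsPreconnected (setX (n + 1)) := by
    refine IsPreconnected.union (x, star x) hxB hxT ?_ (isPreconnected_beamT hn hn2)
    rw [hBH]
    exact isPreconnected_segment (fun h => by have : 1 < star z₁ := h; linarith) isPreconnected_Iio
  have pT : IsPreconnected (segment (Ioc (star w₁) 0)) :=
    isPreconnected_segment (fun h => by have : (1 : ℝ) ≤ 0 := h.2; linarith) isPreconnected_Ioc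
  have hcX : ∀ p ∈ setX (n + 1), connectedComponentIn (curve (n + 1)) p = setX (n + 1) := by
    intro p hp
    refine connectedComponentIn_eq_of_separated pX ?_ o1 (o2.union o3)
      (disjoint_union_right.2 ⟨d12, d13⟩) ?_ ?_ hX1 hp <;> rw [hcurve]
    · exact subset_union_left
    · exact union_subset_union hX1 (union_subset_union hT2 hI3)
    · rintro q ⟨hq | hq | hq, hqU⟩
      · exact hq
      · exact absurd rfl (d12.ne_of_mem hqU (hT2 hq))
      · exact absurd rfl (d13.ne_of_mem hqU (hI3 hq))
  have hcT : ∀ p ∈ segment (Ioc (star w₁) 0),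
      connectedComponentIn (curve (n + 1)) p = segment (Ioc (star w₁) 0) := by
    intro p hp
    refine connectedComponentIn_eq_of_separated pT ?_ o2 (o1.union o3)
      (disjoint_union_right.2 ⟨d12.symm, d23⟩) ?_ ?_ hT2 hp <;> rw [hcurve]
    · exact subset_union_of_subset_right subset_union_left _
    · rw [union_left_comm]
      exact union_subset_union hT2 (union_subset_union hX1 hI3)
    · rintro q ⟨hq | hq | hq, hqU⟩
      · exact absurd rfl (d12.ne_of_mem (hX1 hq) hqU)
      · exact hq
      · exact absurd rfl (d23.ne_of_mem hqU (hI3 hq))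
  have hcI : ∀ p ∈ setI, connectedComponentIn (curve (n + 1)) p = setI := by
    intro p hp
    refine connectedComponentIn_eq_of_separated isPreconnected_setI ?_ o3 (o1.union o2)
      (disjoint_union_right.2 ⟨d13.symm, d23.symm⟩) ?_ ?_ hI3 hp <;> rw [hcurve]
    · exact subset_union_of_subset_right subset_union_right _
    · rw [← union_assoc, union_comm]
      exact union_subset_union hI3 (union_subset_union hX1 hT2)
    · rintro q ⟨hq | hq | hq, hqU⟩
      · exact absurd rfl (d13.ne_of_mem (hX1 hq) hqU)
      · exact absurd rfl (d23.ne_of_mem (hT2 hq) hqU)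
      · exact hq
  have h0T : ((0 : ℝ), (0 : ℝ)) ∈ segment (Ioc (star w₁) 0) := zero_mem_segment ⟨hwneg, le_rfl⟩
  have hxX : (x, star x) ∈ setX (n + 1) := Or.inl hxB
  rw [hTri]
  refine ⟨?_, ⟨_, (hZ _).2 rfl, fun y hy => (hZ y).1 hy⟩, ⟨_, (hW _).2 rfl, fun y hy => (hW y).1 hy⟩,
    by rw [hz_eq, hw_eq]; exact hzw, ?_, ?_, ?_, ?_, ?_, ?_, x, hx0, ?_, ?_⟩
  · obtain ⟨P, hP, -⟩ := exists_isT n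
    exact ⟨P, hP, fun R hR => isT_unique hR hP⟩
  · ext K
    constructor
    · rintro ⟨p, hp, rfl⟩
      rw [hcurve] at hp
      rcases hp with hp | hp | hp
      · exact Or.inl (hcX p hp)
      · exact Or.inr (Or.inl (hcT p hp))
      · exact Or.inr (Or.inr (hcI p hp))
    · rintro (rfl | rfl | rfl)
      · exact ⟨_, hcurve ▸ Or.inl hxX, (hcX _ hxX).symm⟩
      · exact ⟨_, hcurve ▸ Or.inr (Or.inl h0T), (hcT _ h0T).symm⟩
      · exact ⟨_, hcurve ▸ Or.inr (Or.inr setI_nonempty), (hcI _ setI_nonempty).symm⟩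
  · exact fun h => d12.ne_of_mem (hX1 hxX) (hT2 (h ▸ hxX)) rfl
  · exact fun h => d13.ne_of_mem (hX1 hxX) (hI3 (h ▸ hxX)) rfl
  · exact fun h => zero_notMem_setI (h ▸ h0T)
  · ext ⟨u, v⟩
    constructor
    · rintro ⟨h | h, hH⟩
      · exact h
      · exact hTH hH h
    · exact fun h => ⟨Or.inl h, h.1⟩
  · ext p
    constructor
    · rintro ⟨h | h, hT⟩
      · exact hHT h hT
      · exact h
    · exact fun h => ⟨Or.inr h, h.1⟩
  · intro t ht
    constructor
    · intro hT
      have h1 : (t, star t) ∈ beamT (n + 1) := ⟨hT, ht, star_pos_of_neg ht, star_lt_one (by linarith)⟩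
      exact congrArg Prod.fst (hxuniq h1 (hyperbola_star (by linarith)))
    · rintro rfl
      exact hxT.1
  · ext p
    constructor
    · exact fun h => hxuniq h.2 h.1.1
    · rintro rfl
      exact ⟨hxB, hxT⟩

end ModuliCurve

end

theorem corollary22p2 (m : ℕ) (hm : 2 ≤ m) :
    (Even m →
      ModuliCurve.components (ModuliCurve.curve m) = {ModuliCurve.setTri m, ModuliCurve.setI} ∧
      ModuliCurve.setTri m ≠ ModuliCurve.setI) ∧
    (Odd m →
      -- the data entering the definitions of the sets are well defined
      (∃! T, ModuliCurve.IsT m T) ∧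
      (∃! z, ModuliCurve.IsZ m z) ∧
      (∃! w, ModuliCurve.IsW m w) ∧
      ModuliCurve.z m < ModuliCurve.w m ∧
      -- the connected components
      ModuliCurve.components (ModuliCurve.curve m) =
        {ModuliCurve.setX m, ModuliCurve.setTri m, ModuliCurve.setI} ∧
      ModuliCurve.setX m ≠ ModuliCurve.setTri m ∧
      ModuliCurve.setX m ≠ ModuliCurve.setI ∧
      ModuliCurve.setTri m ≠ ModuliCurve.setI ∧
      -- the two beams of `X` and their intersection
      ModuliCurve.setX m ∩ ModuliCurve.hyperbola = ModuliCurve.beamH m ∧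
      ModuliCurve.setX m ∩ ModuliCurve.zeroT m = ModuliCurve.beamT m ∧
      ∃ x : ℝ, x < 0 ∧
        (∀ t : ℝ, t < 0 →
          (ModuliCurve.ev (ModuliCurve.T m) t (ModuliCurve.star t) = 0 ↔ t = x)) ∧
        ModuliCurve.beamH m ∩ ModuliCurve.beamT m = {(x, ModuliCurve.star x)}) := by
  obtain ⟨n, rfl⟩ : ∃ n, m = n + 1 := ⟨m - 1, by omega⟩
  refine ⟨fun h => ModuliCurve.components_of_odd ?_, fun h => ?_⟩
  · rwa [Nat.even_add_one, Nat.not_even_iff_odd] at h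
  · rw [Nat.odd_add_one, Nat.not_odd_iff_even] at h
    refine ModuliCurve.components_of_even h ?_
    obtain ⟨k, hk⟩ := h
    omega
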